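/- Let $\mathcal H_{\rm at}$ be a separable complex Hilbert space and $H_{\rm at}$ a self-adjoint operator in $\mathcal H_{\rm at}$ such that $E_0:=E_{\rm at}:=\inf\sigma(H_{\rm at})$ is finite, is a nondegenerate eigenvalue of $H_{\rm at}$ with normalized eigenvector $\varphi_{\rm at}$, and is isolated: $E_{\rm at}<\inf(\sigma(H_{\rm at})\setminus\{E_{\rm at}\})$. Let $$\mathcal H=\mathcal H_{\rm at}\otimes\mathcal F\simeq\bigoplus_{n=0}^\infty L^2_s((\mathbb R^3)^n;\mathcal H_{\rm at}),$$ where $\mathcal F$ is the symmetric Fock space over $L^2(\mathbb R^3)$ with vacuum $\Omega$ and $L^2_s$ denotes the square integrable functions that are invariant under permutations of the $n$ variables, and put $\psi_0=\varphi_{\rm at}\otimes\Omega$. Let $H_f$ be the free field Hamiltonian, $(H_f\psi)_n(k_1,\dots,k_n)=(|k_1|+\dots+|k_n|)\psi_n(k_1,\dots,k_n)$. Let $G:\mathbb R^3\to\mathcal L(\mathcal H_{\rm at})$ be strongly measurable; let $$(a(G)\psi)_n(k_1,\dots,k_n)=\sqrt{n+1}\int G(k)^*\psi_{n+1}(k,k_1,\dots,k_n)\,dk$$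 on its maximal domain, $a^*(G)=a(G)^*$, and let $\phi(G)$ be the closure of $a(G)+a^*(G)$. For $\lambda\in\mathbb R$ let $$H(\lambda)=H_{\rm at}\otimes 1+1\otimes H_f+\lambda\,\phi(G),\qquad E(\lambda)=\inf\sigma(H(\lambda)).$$ Assume that there is $\lambda_0>0$ such that for every $\lambda\in[0,\lambda_0]$ the number $E(\lambda)$ is a simple eigenvalue of $H(\lambda)$. Then: (a) If $\int\|G(k)\|^2(1+|k|^{-1})\,dk<\infty$, then for every $\lambda\in\mathbb R$ the infimum $E(\lambda)$ is finite and $E(\lambda)\le E_0$, and $E(\lambda)-E_0=O(|\lambda|^2)$ as $\lambda\to0$. (b) If $\int\|G(k)\|^2(1+|k|^{-2})\,dk<\infty$, then for every $\lambda\in[-\lambda_0,\lambda_0]$ the operator $H(\lambda)$ has an eigenvector $\psi(\lambda)$ with eigenvalue $E(\lambda)$, and these can be chosen such that $\langle\psi_0,\psi(\lambda)\rangle=1$ for all $\lambda$ in a neighborhood of zero and $\|\psi(\lambda)-\psi_0\|=O(|\lambda|)$ as $\lambda\to0$. -/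

import Mathlib

open MeasureTheory Filter Topology Asymptotics

noncomputable section

namespace SpinBoson

/-! ### Unbounded operators: eigenvectors and spectrum -/

section Operators

variable {E : Type*} [NormedAddCommGroup E] [InnerProductSpace ℂ E]

/-- The eigenspace `{x ∈ dom A : A x = z x}` of an unbounded operator. -/
def eigenspace (A : E →ₗ.[ℂ] E) (z : ℂ) : Submodule ℂ E where
  carrier := {x | (x, z • x) ∈ A.graph}
  add_mem' {x y} hx hy := by
    have h := A.graph.add_mem hx hy
    rwa [Prod.mk_add_mk, ← smul_add] at h
  zero_mem' := by
    change ((0 : E), z • (0 : E)) ∈ A.graph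
    rw [smul_zero]
    exact A.graph.zero_mem
  smul_mem' c x hx := by
    have h := A.graph.smul_mem c hx
    rwa [Prod.smul_mk, smul_comm] at h

/-- `x` is an eigenvector of `A` with eigenvalue `z`. -/
def IsEigenvector (A : E →ₗ.[ℂ] E) (z : ℂ) (x : E) : Prop :=
  x ≠ 0 ∧ x ∈ eigenspace A z

/-- `z` is a simple (nondegenerate) eigenvalue of `A`. -/
def IsSimpleEigenvalue (A : E →ₗ.[ℂ] E) (z : ℂ) : Prop :=
  Module.finrank ℂ (eigenspace A z) = 1

/-- The resolvent set: those `z` for which `A - z : dom A → E` has a bounded two-sided inverse. -/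
def resolventSet (A : E →ₗ.[ℂ] E) : Set ℂ :=
  {z | ∃ R : E →L[ℂ] E,
    (∀ y : E, (R y, y + z • R y) ∈ A.graph) ∧
    (∀ x : A.domain, R (A x - z • (x : E)) = x)}

/-- The spectrum of an unbounded operator. -/
def spectrum (A : E →ₗ.[ℂ] E) : Set ℂ := (resolventSet A)ᶜ

/-- The real points of the spectrum (all of the spectrum if `A` is self-adjoint). -/
def realSpectrum (A : E →ₗ.[ℂ] E) : Set ℝ := {x | (x : ℂ) ∈ spectrum A}

/-- `inf σ(A)`. -/
def infSpectrum (A : E →ₗ.[ℂ] E) : ℝ := sInf (realSpectrum A)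

end Operators

/-! ### The Hilbert space `⨁ₙ L²ₛ((ℝ³)ⁿ; 𝔥)` -/

/-- Momentum space `ℝ³` with the Euclidean norm. -/
abbrev R3 : Type := EuclideanSpace ℝ (Fin 3)

section Space

variable (𝔥 : Type*) [NormedAddCommGroup 𝔥] [InnerProductSpace ℂ 𝔥]

/-- `L²((ℝ³)ⁿ; 𝔥)`. -/
abbrev L2 (n : ℕ) : Type _ := Lp 𝔥 2 (volume : Measure (Fin n → R3))

theorem measurePreserving_perm {n : ℕ} (π : Equiv.Perm (Fin n)) :
    MeasurePreserving (fun K : Fin n → R3 => fun i => K (π i)) volume volume := by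
  have h := volume_measurePreserving_piCongrLeft (fun _ : Fin n => R3) π.symm
  convert h using 1
  ext K i
  have := MeasurableEquiv.piCongrLeft_apply_apply (β := fun _ : Fin n => R3) π.symm K (π i)
  simp only [Equiv.symm_apply_apply] at this
  rw [this]

/-- `L²ₛ((ℝ³)ⁿ; 𝔥)`: the functions that are invariant under permutations of the `n` momenta. -/
def L2s (n : ℕ) : Submodule ℂ (L2 𝔥 n) where
  carrier := {f | ∀ π : Equiv.Perm (Fin n),
    (fun K : Fin n → R3 => f (fun i => K (π i))) =ᵐ[volume] f}
  add_mem' {f g} hf hg π := by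
    have h := Lp.coeFn_add f g
    have h' := (measurePreserving_perm π).quasiMeasurePreserving.ae h
    filter_upwards [h, h', hf π, hg π] with K h1 h2 h3 h4
    simp only [Pi.add_apply] at h1 h2
    rw [h1, h2, h3, h4]
  zero_mem' π := by
    have h := Lp.coeFn_zero 𝔥 2 (volume : Measure (Fin n → R3))
    have h' := (measurePreserving_perm π).quasiMeasurePreserving.ae h
    filter_upwards [h, h'] with K h1 h2
    rw [h1, h2]; rfl
  smul_mem' c f hf π := by
    have h := Lp.coeFn_smul c f
    have h' := (measurePreserving_perm π).quasiMeasurePreserving.ae h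
    filter_upwards [h, h', hf π] with K h1 h2 h3
    simp only [Pi.smul_apply] at h1 h2
    rw [h1, h2, h3]

theorem isClosed_L2s (n : ℕ) : IsClosed (L2s 𝔥 n : Set (L2 𝔥 n)) := by
  have : (L2s 𝔥 n : Set (L2 𝔥 n)) = ⋂ π : Equiv.Perm (Fin n),
      {f | Lp.compMeasurePreserving _ (measurePreserving_perm π) f = f} := by
    ext f
    simp only [Set.mem_iInter, Set.mem_ofPred_eq]
    refine forall_congr' fun π => ?_
    have h := Lp.coeFn_compMeasurePreserving f (measurePreserving_perm π)
    rw [Lp.ext_iff]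
    exact ⟨fun hf => h.trans hf, fun hf => h.symm.trans hf⟩
  rw [this]
  exact isClosed_iInter fun π =>
    isClosed_eq (Lp.isometry_compMeasurePreserving (measurePreserving_perm π)).continuous
      continuous_id

instance (n : ℕ) [CompleteSpace 𝔥] : CompleteSpace (L2s 𝔥 n) :=
  (isClosed_L2s 𝔥 n).completeSpace_coe

/-- The total Hilbert space `𝔥 ⊗ 𝓕 ≃ ⨁ₙ L²ₛ((ℝ³)ⁿ; 𝔥)`, where `𝓕` is the symmetric Fock space. -/
abbrev Fock : Type _ := lp (fun n : ℕ => L2s 𝔥 n) 2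

variable {𝔥}

/-- The `n`-photon wave function `ψₙ : (ℝ³)ⁿ → 𝔥` of `ψ` (defined almost everywhere). -/
def wave (ψ : Fock 𝔥) (n : ℕ) : (Fin n → R3) → 𝔥 := ((ψ n : L2s 𝔥 n) : L2 𝔥 n)

theorem wave_add (ψ χ : Fock 𝔥) (n : ℕ) : wave (ψ + χ) n =ᵐ[volume] wave ψ n + wave χ n :=
  Lp.coeFn_add _ _

theorem wave_smul (c : ℂ) (ψ : Fock 𝔥) (n : ℕ) : wave (c • ψ) n =ᵐ[volume] c • wave ψ n :=
  Lp.coeFn_smul _ _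

theorem wave_zero (n : ℕ) : wave (0 : Fock 𝔥) n =ᵐ[volume] 0 :=
  Lp.coeFn_zero _ _ _

theorem Fock_ext {ψ χ : Fock 𝔥} (h : ∀ n, wave ψ n =ᵐ[volume] wave χ n) : ψ = χ := by
  apply lp.ext
  funext n
  exact Subtype.ext (Lp.ext (h n))

theorem volume_univ_zero : volume (Set.univ : Set (Fin 0 → R3)) ≠ ⊤ := by
  simp [volume_pi]

/-- The vector `x ⊗ Ω = (x, 0, 0, …)`, with `Ω` the vacuum. -/
def tensorVacuum (x : 𝔥) : Fock 𝔥 :=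
  lp.single 2 0 ⟨indicatorConstLp 2 MeasurableSet.univ volume_univ_zero x, fun π => by
    refine Eventually.of_forall fun K => ?_
    exact congrArg _ (Subsingleton.elim _ _)⟩

end Space

/-! ### The operators -/

section Ops

variable {𝔥 : Type*} [NormedAddCommGroup 𝔥] [InnerProductSpace ℂ 𝔥]

/-- Graph of `1 ⊗ H_f`: all `(ψ, χ)` with `χₙ(k₁,…,kₙ) = (|k₁| + ⋯ + |kₙ|) ψₙ(k₁,…,kₙ)`. -/
def fieldGraph : Submodule ℂ (Fock 𝔥 × Fock 𝔥) where
  carrier := {p | ∀ n, ∀ᵐ K : Fin n → R3, wave p.2 n K = ((∑ i, ‖K i‖ : ℝ) : ℂ) • wave p.1 n K}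
  add_mem' {p q} hp hq n := by
    filter_upwards [hp n, hq n, wave_add p.1 q.1 n, wave_add p.2 q.2 n] with K h1 h2 h3 h4
    simp only [Prod.fst_add, Prod.snd_add, h3, h4, Pi.add_apply, h1, h2, smul_add]
  zero_mem' n := by
    filter_upwards [wave_zero (𝔥 := 𝔥) n] with K h
    simp only [Prod.fst_zero, Prod.snd_zero, h, Pi.zero_apply, smul_zero]
  smul_mem' c p hp n := by
    filter_upwards [hp n, wave_smul c p.1 n, wave_smul c p.2 n] with K h1 h2 h3
    simp only [Prod.smul_fst, Prod.smul_snd, h2, h3, Pi.smul_apply, h1]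
    rw [smul_comm]

/-- The free field Hamiltonian `1 ⊗ H_f` on its maximal domain. -/
def fieldHamiltonian : Fock 𝔥 →ₗ.[ℂ] Fock 𝔥 := fieldGraph.toLinearPMap

theorem fieldHamiltonian_graph : (fieldHamiltonian (𝔥 := 𝔥)).graph = fieldGraph := by
  refine Submodule.toLinearPMap_graph_eq _ ?_
  rintro ⟨ψ, χ⟩ h (rfl : ψ = 0)
  refine Fock_ext fun n => ?_
  filter_upwards [h n, wave_zero (𝔥 := 𝔥) n] with K h1 h2
  rw [h1, h2, Pi.zero_apply, smul_zero]

/-- Graph of `A ⊗ 1`: all `(ψ, χ)` such that almost everywhere `ψₙ(k₁,…,kₙ) ∈ dom A` and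
`χₙ(k₁,…,kₙ) = A ψₙ(k₁,…,kₙ)`. -/
def atomGraph (A : 𝔥 →ₗ.[ℂ] 𝔥) : Submodule ℂ (Fock 𝔥 × Fock 𝔥) where
  carrier := {p | ∀ n, ∀ᵐ K : Fin n → R3, (wave p.1 n K, wave p.2 n K) ∈ A.graph}
  add_mem' {p q} hp hq n := by
    filter_upwards [hp n, hq n, wave_add p.1 q.1 n, wave_add p.2 q.2 n] with K h1 h2 h3 h4
    rw [Prod.fst_add, Prod.snd_add, h3, h4]
    exact A.graph.add_mem h1 h2
  zero_mem' n := by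
    filter_upwards [wave_zero (𝔥 := 𝔥) n] with K h
    rw [Prod.fst_zero, Prod.snd_zero, h]
    exact A.graph.zero_mem
  smul_mem' c p hp n := by
    filter_upwards [hp n, wave_smul c p.1 n, wave_smul c p.2 n] with K h1 h2 h3
    rw [Prod.smul_fst, Prod.smul_snd, h2, h3]
    exact A.graph.smul_mem c h1

/-- The operator `A ⊗ 1`, acting fibrewise on `⨁ₙ L²ₛ((ℝ³)ⁿ; 𝔥)` on its maximal domain. -/
def atomOperator (A : 𝔥 →ₗ.[ℂ] 𝔥) : Fock 𝔥 →ₗ.[ℂ] Fock 𝔥 := (atomGraph A).toLinearPMap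

theorem atomOperator_graph (A : 𝔥 →ₗ.[ℂ] 𝔥) : (atomOperator A).graph = atomGraph A := by
  refine Submodule.toLinearPMap_graph_eq _ ?_
  rintro ⟨ψ, χ⟩ h (rfl : ψ = 0)
  refine Fock_ext fun n => ?_
  filter_upwards [h n, wave_zero (𝔥 := 𝔥) n] with K h1 h2
  rw [h2]
  exact A.graph_fst_eq_zero_snd h1 (by rw [h2]; rfl)

theorem ae_ae_cons {n : ℕ} {p : (Fin (n + 1) → R3) → Prop} (h : ∀ᵐ X, p X) :
    ∀ᵐ K : Fin n → R3, ∀ᵐ k : R3, p (Fin.cons k K) := by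
  have h1 := (volume_preserving_piFinSuccAbove (fun _ : Fin (n + 1) => R3) 0).symm
  have h2 := h1.comp (Measure.measurePreserving_swap
    (μ := (volume : Measure (Fin n → R3))) (ν := (volume : Measure R3)))
  have h3 := Measure.ae_ae_of_ae_prod (h2.quasiMeasurePreserving.ae h)
  filter_upwards [h3] with K hK
  filter_upwards [hK] with k hk
  simpa [MeasurableEquiv.piFinSuccAbove, Fin.insertNthEquiv, Fin.insertNth_zero'] using hk

variable [CompleteSpace 𝔥]

/-- Graph of the annihilation operator `a(G)`: all `(ψ, χ)` with
`χₙ(k₁,…,kₙ) = √(n+1) ∫ G(k)^* ψₙ₊₁(k, k₁,…,kₙ) dk`. The integrability of the integrand, required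
for almost every `(k₁,…,kₙ)`, is automatic if `∫ ‖G(k)‖² dk < ∞`. -/
def annihilationGraph (G : R3 → 𝔥 →L[ℂ] 𝔥) : Submodule ℂ (Fock 𝔥 × Fock 𝔥) where
  carrier := {p | ∀ n, ∀ᵐ K : Fin n → R3,
    Integrable (fun k : R3 => (G k).adjoint (wave p.1 (n + 1) (Fin.cons k K))) ∧
    wave p.2 n K =
      ((√((n : ℝ) + 1) : ℝ) : ℂ) • ∫ k : R3, (G k).adjoint (wave p.1 (n + 1) (Fin.cons k K))}
  add_mem' {p q} hp hq n := by
    filter_upwards [hp n, hq n, ae_ae_cons (wave_add p.1 q.1 (n + 1)), wave_add p.2 q.2 n]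
      with K h1 h2 h3 h4
    have h5 : (fun k : R3 => (G k).adjoint (wave (p + q).1 (n + 1) (Fin.cons k K))) =ᵐ[volume]
        fun k => (G k).adjoint (wave p.1 (n + 1) (Fin.cons k K)) +
          (G k).adjoint (wave q.1 (n + 1) (Fin.cons k K)) := by
      filter_upwards [h3] with k hk
      rw [Prod.fst_add, hk, Pi.add_apply, map_add]
    refine ⟨(h1.1.add h2.1).congr h5.symm, ?_⟩
    rw [integral_congr_ae h5, integral_add h1.1 h2.1, Prod.snd_add, h4, Pi.add_apply, h1.2, h2.2,
      smul_add]
  zero_mem' n := by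
    filter_upwards [ae_ae_cons (wave_zero (𝔥 := 𝔥) (n + 1)), wave_zero (𝔥 := 𝔥) n] with K h3 h4
    have h5 : (fun k : R3 => (G k).adjoint
        (wave (0 : Fock 𝔥 × Fock 𝔥).1 (n + 1) (Fin.cons k K))) =ᵐ[volume] fun _ => (0 : 𝔥) := by
      filter_upwards [h3] with k hk
      rw [Prod.fst_zero, hk, Pi.zero_apply, map_zero]
    refine ⟨(integrable_zero R3 𝔥 volume).congr h5.symm, ?_⟩
    rw [integral_congr_ae h5, integral_zero, Prod.snd_zero, h4, Pi.zero_apply, smul_zero]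
  smul_mem' c p hp n := by
    filter_upwards [hp n, ae_ae_cons (wave_smul c p.1 (n + 1)), wave_smul c p.2 n] with K h1 h3 h4
    have h5 : (fun k : R3 => (G k).adjoint (wave (c • p).1 (n + 1) (Fin.cons k K))) =ᵐ[volume]
        fun k => c • (G k).adjoint (wave p.1 (n + 1) (Fin.cons k K)) := by
      filter_upwards [h3] with k hk
      rw [Prod.smul_fst, hk, Pi.smul_apply, map_smul]
    refine ⟨(h1.1.smul c).congr h5.symm, ?_⟩
    rw [integral_congr_ae h5, integral_smul, Prod.smul_snd, h4, Pi.smul_apply, h1.2, smul_comm]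

/-- The annihilation operator `a(G)` on its maximal domain. -/
def annihilation (G : R3 → 𝔥 →L[ℂ] 𝔥) : Fock 𝔥 →ₗ.[ℂ] Fock 𝔥 :=
  (annihilationGraph G).toLinearPMap

theorem annihilation_graph (G : R3 → 𝔥 →L[ℂ] 𝔥) :
    (annihilation G).graph = annihilationGraph G := by
  refine Submodule.toLinearPMap_graph_eq _ ?_
  rintro ⟨ψ, χ⟩ h (rfl : ψ = 0)
  refine Fock_ext fun n => ?_
  filter_upwards [h n, ((annihilationGraph G).zero_mem : _) n, wave_zero (𝔥 := 𝔥) n]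
    with K h1 h2 h3
  exact h1.2.trans h2.2.symm

/-- The creation operator `a^*(G) = a(G)^*`. -/
def creation (G : R3 → 𝔥 →L[ℂ] 𝔥) : Fock 𝔥 →ₗ.[ℂ] Fock 𝔥 := (annihilation G).adjoint

/-- The field operator `φ(G)`, the closure of `a(G) + a^*(G)`. -/
def fieldOperator (G : R3 → 𝔥 →L[ℂ] 𝔥) : Fock 𝔥 →ₗ.[ℂ] Fock 𝔥 :=
  (annihilation G + creation G).closure

/-- The Hamiltonian `H(lam) = H_at ⊗ 1 + 1 ⊗ H_f + lam φ(G)`, on the intersection of the domains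
of the three summands. -/
def hamiltonian (Hat : 𝔥 →ₗ.[ℂ] 𝔥) (G : R3 → 𝔥 →L[ℂ] 𝔥) (lam : ℝ) : Fock 𝔥 →ₗ.[ℂ] Fock 𝔥 :=
  atomOperator Hat + fieldHamiltonian + (lam : ℂ) • fieldOperator G

/-- The ground state energy `E(lam) = inf σ(H(lam))`. -/
def groundEnergy (Hat : 𝔥 →ₗ.[ℂ] 𝔥) (G : R3 → 𝔥 →L[ℂ] 𝔥) (lam : ℝ) : ℝ :=
  infSpectrum (hamiltonian Hat G lam)

end Ops

end SpinBoson

end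

/-! Operators are handled through their graphs: `(x, y + z • x) ∈ A.graph` encodes `(A - z) x = y`.
A self-adjoint operator is used only through symmetry, lower form bounds and solvability of this
equation. For a symmetric operator with a form bound and one solvable real point below it, the
infimum of the spectrum is the best form bound (`exists_isGLB_realSpectrum`). Spectral questions
about `H(λ)` thereby become questions about expectation values.

Part (a). Write `c = ∫ ‖G(k)‖² |k|⁻¹ dk` and let `q` be the field energy of `ψ`. A weighted
Cauchy-Schwarz inequality gives `‖a(G)ψ‖² ≤ c q`, so the interaction form `2 λ Re⟨ψ, a(G)ψ⟩` is at
most `q + λ² c ‖ψ‖²` in absolute value. The free field energy absorbs `q`, whence `H(λ) ≥ E_at - λ²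
c`. A Neumann series far below this bound supplies the solvable point. The trial vector `φ_at ⊗ Ω`
has energy exactly `E_at`, because `φ(G)` changes the photon number by one. Thus `E_at - λ² c ≤ E(λ)
≤ E_at`.

Part (b). Let `ψ` be a ground state. Commuting `a(k)` through the eigenvalue equation yields the
pull-through formula `(H - E + |k|) a(k)ψ = -λ G(k)ψ`. Since `H ≥ E`, it follows that `‖a(k)ψ‖ ≤ |λ|
‖G(k)‖ |k|⁻¹ ‖ψ‖`. Integrating the square bounds the photon number, hence the part of `ψ` outside
the vacuum sector (`Admissible.photonNumber_le`). As `a(k)ψ` is not known to lie in the domain of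
`H`, the formula is used weakly, tested against the resolvent (`Admissible.norm_le_of_solution`).
The zero-photon component solves `(H_at - E) ψ₀ = -λ (a(G)ψ)₀`; projecting off `φ_at` and using the
gap of `H_at` bounds its remaining part (`Admissible.vacuum_estimate`). Together `ψ` is within
`O(|λ|) ‖ψ‖` of a multiple of `φ_at ⊗ Ω`, and dividing by the scalar product with this vector gives
the claim.

Negative `λ` are reached by conjugation with the parity `(-1)^N`, which turns `H(λ)` into `H(-λ)`.
-/

noncomputable section

namespace SpinBoson

/-! ### Semibounded symmetric operators -/

section Semibounded

variable {E : Type*} [NormedAddCommGroup E] [InnerProductSpace ℂ E]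

/-- Symmetry of an operator, expressed through its graph. -/
def SymmetricOp (A : E →ₗ.[ℂ] E) : Prop :=
  ∀ ⦃x y u v : E⦄, (x, y) ∈ A.graph → (u, v) ∈ A.graph → inner ℂ y u = inner ℂ x v

/-- The quadratic form of `A` is bounded below by `m`. -/
def FormBound (A : E →ₗ.[ℂ] E) (m : ℝ) : Prop :=
  ∀ ⦃x y : E⦄, (x, y) ∈ A.graph → m * ‖x‖ ^ 2 ≤ (inner ℂ x y).re

/-- `A - z` maps its domain onto the whole space. -/
def ShiftSurjective (A : E →ₗ.[ℂ] E) (z : ℝ) : Prop :=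
  ∀ y : E, ∃ x : E, (x, y + (z : ℂ) • x) ∈ A.graph

theorem inner_self_re (x : E) : (inner ℂ x x).re = ‖x‖ ^ 2 := by
  have := inner_self_eq_norm_sq (𝕜 := ℂ) x
  simpa using this

theorem inner_shift_re (x y : E) (z : ℝ) :
    (inner ℂ x (y + (z : ℂ) • x)).re = (inner ℂ x y).re + z * ‖x‖ ^ 2 := by
  rw [inner_add_right, inner_smul_right, Complex.add_re, Complex.re_ofReal_mul, inner_self_re]

variable {A : E →ₗ.[ℂ] E} {m z : ℝ}

theorem FormBound.shift (h : FormBound A m) {x y : E} (hx : (x, y + (z : ℂ) • x) ∈ A.graph) :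
    (m - z) * ‖x‖ ^ 2 ≤ (inner ℂ x y).re := by
  have := h hx
  rw [inner_shift_re] at this
  linarith

theorem FormBound.norm_le (h : FormBound A m) {x y : E} (hx : (x, y + (z : ℂ) • x) ∈ A.graph) :
    (m - z) * ‖x‖ ≤ ‖y‖ := by
  have h1 := h.shift hx
  have h2 : (inner ℂ x y).re ≤ ‖x‖ * ‖y‖ := re_inner_le_norm (𝕜 := ℂ) x y
  rcases (norm_nonneg x).eq_or_lt with h0 | h0
  · rw [← h0, mul_zero]; exact norm_nonneg y
  · have : ‖x‖ * ((m - z) * ‖x‖) ≤ ‖x‖ * ‖y‖ := by nlinarith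
    exact le_of_mul_le_mul_left this h0

theorem sub_mem_graph_shift {x x' y y' : E} {z : ℂ} (hx : (x, y + z • x) ∈ A.graph)
    (hx' : (x', y' + z • x') ∈ A.graph) : (x - x', (y - y') + z • (x - x')) ∈ A.graph := by
  have := A.graph.sub_mem hx hx'
  rw [Prod.mk_sub_mk] at this
  convert this using 2
  rw [smul_sub]; abel

theorem FormBound.shift_injective (h : FormBound A m) (hz : z < m) {x x' y : E}
    (hx : (x, y + (z : ℂ) • x) ∈ A.graph) (hx' : (x', y + (z : ℂ) • x') ∈ A.graph) : x = x' := by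
  have h1 := h.norm_le (sub_mem_graph_shift hx hx')
  rw [sub_self, norm_zero] at h1
  have h2 : ‖x - x'‖ ≤ 0 := by
    by_contra hc
    have : 0 < (m - z) * ‖x - x'‖ := mul_pos (sub_pos.2 hz) (not_le.1 hc)
    linarith
  exact sub_eq_zero.1 (norm_le_zero_iff.1 h2)

/-- Below a form bound solutions are unique, so the solution map is automatically linear, with norm
at most `(m - z)⁻¹`. -/
theorem ShiftSurjective.exists_resolvent (h : FormBound A m) (hz : z < m)
    (hs : ShiftSurjective A z) :
    ∃ R : E →L[ℂ] E, (∀ y, (R y, y + (z : ℂ) • R y) ∈ A.graph) ∧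
      ∀ x y, (x, y + (z : ℂ) • x) ∈ A.graph → R y = x := by
  choose r hr using hs
  have huniq : ∀ x y, (x, y + (z : ℂ) • x) ∈ A.graph → r y = x := fun x y hx =>
    h.shift_injective hz (hr y) hx
  let R₀ : E →ₗ[ℂ] E :=
    { toFun := r
      map_add' := fun y y' => huniq _ _ (by
        have := A.graph.add_mem (hr y) (hr y')
        rw [Prod.mk_add_mk] at this
        convert this using 2
        rw [smul_add]; abel)
      map_smul' := fun c y => huniq _ _ (by
        have := A.graph.smul_mem c (hr y)
        rw [Prod.smul_mk] at this
        rwa [smul_add, smul_comm] at this) }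
  refine ⟨R₀.mkContinuous (m - z)⁻¹ fun y => ?_, hr, huniq⟩
  rw [inv_mul_eq_div, le_div_iff₀ (sub_pos.2 hz), mul_comm]
  exact h.norm_le (hr y)

theorem ShiftSurjective.mem_resolventSet (h : FormBound A m) (hz : z < m)
    (hs : ShiftSurjective A z) : (z : ℂ) ∈ resolventSet A := by
  obtain ⟨R, h1, h2⟩ := hs.exists_resolvent h hz
  refine ⟨R, h1, fun x => h2 _ _ ?_⟩
  rw [sub_add_cancel]
  exact A.mem_graph x

theorem shiftSurjective_of_mem_resolventSet (h : (z : ℂ) ∈ resolventSet A) :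
    ShiftSurjective A z := by
  obtain ⟨R, h1, -⟩ := h
  exact fun y => ⟨R y, h1 y⟩

/-- With `R` the inverse of `A - z`, one has `A - w = B (A - z)` on the domain, where `B = 1 - (w -
z) R`. The form of `R` satisfies `0 ≤ ⟨y, R y⟩ ≤ (m - z)⁻¹ ‖y‖²` in real parts, so `B` is coercive
and hence invertible. One solvable point thus yields the whole half-line below `m` in a single step.
-/
theorem ShiftSurjective.of_formBound [CompleteSpace E] (h : FormBound A m) {w : ℝ} (hz : z < m)
    (hw : w < m) (hs : ShiftSurjective A z) : ShiftSurjective A w := by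
  obtain ⟨R, h1, h2⟩ := hs.exists_resolvent h hz
  have hmz : 0 < m - z := sub_pos.2 hz
  have hmw : 0 < m - w := sub_pos.2 hw
  -- The minimum of `1 - (w - z) t` over `0 ≤ t ≤ (m - z)⁻¹`; the two entries are the values at the
  -- endpoints.
  set c : ℝ := min 1 ((m - w) / (m - z)) with hc
  have hcpos : 0 < c := lt_min one_pos (div_pos hmw hmz)
  set B : E →L[ℂ] E := 1 - ((w - z : ℝ) : ℂ) • R with hB
  have hunit : IsUnit B := by
    refine ContinuousLinearMap.isUnit_of_forall_le_norm_inner_map (𝕜 := ℂ) B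
      (c := ⟨c, hcpos.le⟩) hcpos fun y => ?_
    have e1 : (inner ℂ y (B y)).re = ‖y‖ ^ 2 - (w - z) * (inner ℂ y (R y)).re := by
      rw [hB]
      simp only [sub_apply, one_apply_eq_self,
        smul_apply, inner_sub_right, inner_smul_right, Complex.sub_re,
        Complex.re_ofReal_mul, inner_self_re]
    have e2 : 0 ≤ (inner ℂ y (R y)).re := by
      have := h.shift (h1 y)
      have e : (inner ℂ y (R y)).re = (inner ℂ (R y) y).re := inner_re_symm (𝕜 := ℂ) _ _
      rw [e]
      exact le_trans (by positivity) this
    have e3 : (m - z) * (inner ℂ y (R y)).re ≤ ‖y‖ ^ 2 := by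
      have a1 : (inner ℂ y (R y)).re ≤ ‖y‖ * ‖R y‖ := re_inner_le_norm (𝕜 := ℂ) _ _
      have a2 := h.norm_le (h1 y)
      calc (m - z) * (inner ℂ y (R y)).re ≤ (m - z) * (‖y‖ * ‖R y‖) := by gcongr
        _ = ‖y‖ * ((m - z) * ‖R y‖) := by ring
        _ ≤ ‖y‖ * ‖y‖ := by gcongr
        _ = ‖y‖ ^ 2 := by ring
    have e4 : c * ‖y‖ ^ 2 ≤ (inner ℂ y (B y)).re := by
      rw [e1]
      rcases le_total w z with hwz | hwz
      · have : c ≤ 1 := min_le_left _ _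
        nlinarith [mul_nonneg (sub_nonneg.2 hwz) e2, sq_nonneg ‖y‖]
      · have hc2 : c ≤ (m - w) / (m - z) := min_le_right _ _
        have : (m - z) * (c * ‖y‖ ^ 2) ≤ (m - z) * (‖y‖ ^ 2 - (w - z) * (inner ℂ y (R y)).re) := by
          rw [le_div_iff₀ hmz] at hc2
          nlinarith [mul_le_mul_of_nonneg_left e3 (sub_nonneg.2 hwz),
            mul_le_mul_of_nonneg_right hc2 (sq_nonneg ‖y‖)]
        exact le_of_mul_le_mul_left this hmz
    calc ‖y‖ ^ 2 * c = c * ‖y‖ ^ 2 := mul_comm _ _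
      _ ≤ (inner ℂ y (B y)).re := e4
      _ = (inner ℂ (B y) y).re := inner_re_symm (𝕜 := ℂ) _ _
      _ ≤ ‖inner ℂ (B y) y‖ := Complex.re_le_norm _
  intro y
  obtain ⟨u, hu⟩ := hunit
  set x := (↑u⁻¹ : E →L[ℂ] E) y with hx
  have hBx : B x = y := by
    rw [hx, ← hu, ← mul_apply_eq_comp, Units.mul_inv, one_apply_eq_self]
  refine ⟨R x, ?_⟩
  convert h1 x using 2
  rw [← hBx, hB]
  simp only [sub_apply, one_apply_eq_self,
        smul_apply, Complex.ofReal_sub, sub_smul]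
  abel

/-- A point of the resolvent set that is a form bound is not optimal as a form bound. -/
theorem FormBound.exists_gt (hsym : SymmetricOp A) (h : FormBound A m)
    (hm : (m : ℂ) ∈ resolventSet A) : ∃ m' > m, FormBound A m' := by
  obtain ⟨R, h1, h2⟩ := hm
  have h2' : ∀ x y, (x, y + (m : ℂ) • x) ∈ A.graph → R y = x := by
    intro x y hx
    obtain ⟨x', hx1, hx2⟩ := (LinearPMap.mem_graph_iff A).1 hx
    have := h2 x'
    simp only at hx1 hx2
    rw [hx2, hx1] at this
    simpa using this
  have hRs : ∀ u v, inner ℂ (R u) v = inner ℂ u (R v) := by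
    intro u v
    have := hsym (h1 u) (h1 v)
    simp only [inner_add_left, inner_add_right, inner_smul_left, inner_smul_right,
      Complex.conj_ofReal] at this
    exact (add_right_cancel this).symm
  have hRp : ∀ u, 0 ≤ (inner ℂ (R u) u).re := by
    intro u
    have := h.shift (h1 u)
    simpa using this
  -- The summand `1` keeps `M` positive when `R = 0`; the bound improves by `M⁻¹`.
  set M : ℝ := ‖R‖ + 1 with hM
  have hMpos : 0 < M := by positivity
  refine ⟨m + M⁻¹, by simpa using hMpos, fun x y hxy => ?_⟩
  set u : E := y - (m : ℂ) • x with hu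
  have hyu : y = u + (m : ℂ) • x := by rw [hu]; abel
  have hRu : R u = x := h2' x u (by rwa [← hyu])
  rw [hyu, inner_shift_re]
  -- Completing the square: positivity of `R` at `u - M⁻¹ x`, with `R u = x`, reads `⟨x, u⟩ ≥ 2 M⁻¹
  -- ‖x‖² - M⁻² ⟨R x, x⟩` in real parts, and `R ≤ M` makes the right side at least `M⁻¹ ‖x‖²`.
  have k1 := hRp (u - ((M⁻¹ : ℝ) : ℂ) • x)
  have k2 : (inner ℂ (R x) x).re ≤ M * ‖x‖ ^ 2 := by
    calc (inner ℂ (R x) x).re ≤ ‖R x‖ * ‖x‖ := re_inner_le_norm (𝕜 := ℂ) _ _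
      _ ≤ (‖R‖ * ‖x‖) * ‖x‖ := by gcongr; exact R.le_opNorm x
      _ = ‖R‖ * ‖x‖ ^ 2 := by ring
      _ ≤ M * ‖x‖ ^ 2 := by gcongr; linarith
  have k3 : (inner ℂ (R (u - ((M⁻¹ : ℝ) : ℂ) • x)) (u - ((M⁻¹ : ℝ) : ℂ) • x)).re =
      (inner ℂ x u).re - 2 * M⁻¹ * ‖x‖ ^ 2 + M⁻¹ ^ 2 * (inner ℂ (R x) x).re := by
    rw [map_sub, map_smul, hRu]
    have e : inner ℂ (R x) u = inner ℂ x x := by rw [hRs, hRu]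
    simp only [inner_sub_left, inner_sub_right, inner_smul_left, inner_smul_right,
      Complex.conj_ofReal, e, Complex.sub_re, Complex.re_ofReal_mul, inner_self_re]
    ring
  rw [k3] at k1
  have k4 : M⁻¹ ^ 2 * (inner ℂ (R x) x).re ≤ M⁻¹ * ‖x‖ ^ 2 := by
    calc M⁻¹ ^ 2 * (inner ℂ (R x) x).re ≤ M⁻¹ ^ 2 * (M * ‖x‖ ^ 2) := by gcongr
      _ = M⁻¹ * ‖x‖ ^ 2 := by field_simp
  linarith

/-- For a symmetric operator which is bounded below and has a real point below the form bound in
its resolvent set, the infimum of the spectrum is the optimal form bound. -/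
theorem exists_isGLB_realSpectrum [CompleteSpace E] (hsym : SymmetricOp A) (h : FormBound A m)
    (hz : z < m) (hs : ShiftSurjective A z) {x₀ y₀ : E} (hx₀ : (x₀, y₀) ∈ A.graph) (h0 : ‖x₀‖ = 1) :
    ∃ e, IsGLB (realSpectrum A) e ∧ FormBound A e ∧ m ≤ e ∧ e ≤ (inner ℂ x₀ y₀).re ∧
      ∀ w < e, ShiftSurjective A w := by
  -- The infimum of the spectrum will be `sSup S`. Points below it are in the resolvent set by
  -- `ShiftSurjective.of_formBound`, while the supremum itself is not, since `FormBound.exists_gt`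
  -- would improve it.
  set S : Set ℝ := {e | FormBound A e} with hS
  have hmS : m ∈ S := h
  have hbdd : ∀ e ∈ S, e ≤ (inner ℂ x₀ y₀).re := fun e he => by
    have := he hx₀
    rwa [h0, one_pow, mul_one] at this
  have hbdd' : BddAbove S := ⟨_, hbdd⟩
  have hmem : FormBound A (sSup S) := by
    intro x y hxy
    rcases (sq_nonneg ‖x‖).eq_or_lt with hx | hx
    · rw [← hx, mul_zero]
      have := h hxy
      rwa [← hx, mul_zero] at this
    · rw [← le_div_iff₀ hx]
      refine csSup_le ⟨m, hmS⟩ fun e he => ?_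
      rw [le_div_iff₀ hx]
      exact he hxy
  have hle : m ≤ sSup S := le_csSup hbdd' hmS
  have hsurj : ∀ w < sSup S, ShiftSurjective A w := fun w hw =>
    hs.of_formBound hmem (hz.trans_le hle) hw
  refine ⟨sSup S, ⟨?_, ?_⟩, hmem, hle, csSup_le ⟨m, hmS⟩ hbdd, hsurj⟩
  · intro w hw
    by_contra hc
    exact hw ((hsurj w (not_le.1 hc)).mem_resolventSet hmem (not_le.1 hc))
  · intro b hb
    refine hb ?_
    intro hc
    obtain ⟨m', h1, h2⟩ := hmem.exists_gt hsym hc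
    exact absurd (le_csSup hbdd' h2) (not_le.2 h1)

end Semibounded

/-! ### Self-adjoint operators with an isolated simple lowest eigenvalue -/

section SelfAdjoint

variable {E : Type*} [NormedAddCommGroup E] [InnerProductSpace ℂ E] {A : E →ₗ.[ℂ] E} {z : ℝ}

theorem resolvent_apply_eq {z : ℂ} {R : E →L[ℂ] E} (hR : ∀ x : A.domain, R (A x - z • (x : E)) = x)
    {x y : E} (hx : (x, y + z • x) ∈ A.graph) : R y = x := by
  obtain ⟨x', hx1, hx2⟩ := (LinearPMap.mem_graph_iff A).1 hx
  have := hR x'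
  simp only at hx1 hx2
  rw [hx2, hx1] at this
  simpa using this

theorem SymmetricOp.resolvent (hsym : SymmetricOp A) {R : E →L[ℂ] E}
    (h1 : ∀ y, (R y, y + (z : ℂ) • R y) ∈ A.graph) (u v : E) :
    inner ℂ (R u) v = inner ℂ u (R v) := by
  have := hsym (h1 u) (h1 v)
  simp only [inner_add_left, inner_add_right, inner_smul_left, inner_smul_right,
    Complex.conj_ofReal] at this
  exact (add_right_cancel this).symm

/-- Spectral mapping for the resolvent. -/
theorem notMem_spectrum_resolvent {R : E →L[ℂ] E}
    (h1 : ∀ y, (R y, y + (z : ℂ) • R y) ∈ A.graph)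
    (h2 : ∀ x : A.domain, R (A x - (z : ℂ) • (x : E)) = x) {μ : ℝ} (hμ : μ ≠ 0)
    (h : z + μ⁻¹ ∉ realSpectrum A) : μ ∉ _root_.spectrum ℝ R := by
  have h' : ((z + μ⁻¹ : ℝ) : ℂ) ∈ resolventSet A := not_not.1 h
  obtain ⟨R', h1', h2'⟩ := h'
  have hμ' : (μ : ℂ) ≠ 0 := Complex.ofReal_ne_zero.2 hμ
  have e1 : ∀ y, R y + (μ : ℂ)⁻¹ • R (R' y) = R' y := by
    intro y
    have : R (y + (μ : ℂ)⁻¹ • R' y) = R' y := by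
      refine resolvent_apply_eq h2 ?_
      convert h1' y using 2
      push_cast
      rw [add_smul]; abel
    rwa [map_add, map_smul] at this
  have e2 : ∀ y, R' y - (μ : ℂ)⁻¹ • R' (R y) = R y := by
    intro y
    have : R' (y - (μ : ℂ)⁻¹ • R y) = R y := by
      refine resolvent_apply_eq h2' ?_
      convert h1 y using 2
      push_cast
      rw [add_smul]; abel
    rwa [map_sub, map_smul] at this
  rw [_root_.spectrum.mem_iff, not_not]
  refine ⟨⟨algebraMap ℝ (E →L[ℂ] E) μ - R,
    -- With `R'` the resolvent at `z + μ⁻¹`, the identities `e1` and `e2` are the resolvent equation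
    -- with the factors in either order; they make this a two-sided inverse of `μ - R`.
    (μ : ℂ)⁻¹ • (1 + (μ : ℂ)⁻¹ • R'), ?_, ?_⟩, rfl⟩
  · ext y
    have e : y = y + (μ : ℂ)⁻¹ • (R' y - (R y + (μ : ℂ)⁻¹ • R (R' y))) := by
      rw [e1 y, sub_self, smul_zero, add_zero]
    simp only [mul_apply_eq_comp, sub_apply, one_apply_eq_self, smul_apply, add_apply,
      Algebra.algebraMap_eq_smul_one, map_smul, map_add, ← Complex.coe_smul]
    conv_rhs => rw [e]
    match_scalars <;> field_simp
  · ext y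
    have e : y = y + (μ : ℂ)⁻¹ • ((R' y - (μ : ℂ)⁻¹ • R' (R y)) - R y) := by
      rw [e2 y, sub_self, smul_zero, add_zero]
    simp only [mul_apply_eq_comp, sub_apply, one_apply_eq_self, smul_apply, add_apply,
      Algebra.algebraMap_eq_smul_one, map_smul, map_sub, ← Complex.coe_smul]
    conv_rhs => rw [e]
    match_scalars <;> field_simp

variable [CompleteSpace E]

theorem symmetricOp_of_isSelfAdjoint (hA : IsSelfAdjoint A) : SymmetricOp A := by
  intro x y x' y' hx hx'
  obtain ⟨u, rfl, rfl⟩ := (LinearPMap.mem_graph_iff A).1 hx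
  obtain ⟨v, rfl, rfl⟩ := (LinearPMap.mem_graph_iff A).1 hx'
  have h := LinearPMap.adjoint_isFormalAdjoint hA.dense_domain
  rw [LinearPMap.isSelfAdjoint_def.1 hA] at h
  exact h u v

theorem isSelfAdjoint_resolvent (hsym : SymmetricOp A) {R : E →L[ℂ] E}
    (h1 : ∀ y, (R y, y + (z : ℂ) • R y) ∈ A.graph) : IsSelfAdjoint R := by
  rw [ContinuousLinearMap.isSelfAdjoint_iff_isSymmetric]
  exact fun u v => hsym.resolvent h1 u v

theorem cfc_inner_nonneg (R : E →L[ℂ] E) {f : ℝ → ℝ}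
    (hf : ∀ t ∈ _root_.spectrum ℝ R, 0 ≤ f t) (y : E) : 0 ≤ (inner ℂ (cfc f R y) y).re := by
  have h : 0 ≤ cfc f R := cfc_nonneg hf
  rw [ContinuousLinearMap.nonneg_iff_isPositive] at h
  exact h.re_inner_nonneg_left y

/-- The spectral theorem is only applied to a bounded resolvent. For `z < e` a nonzero spectral
value `t` of `R = (A - z)⁻¹` makes `z + t⁻¹` a spectral value of `A`, so `t > 0`. Hence `R ≥ 0`, and
with `u = (A - z) x` the inequality `⟨R u, u⟩ ≥ 0` is the form bound `z`. Finally `z` increases to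
`e`. -/
theorem formBound_of_isSelfAdjoint (hA : IsSelfAdjoint A) {e : ℝ}
    (he : e ∈ lowerBounds (realSpectrum A)) :
    FormBound A e := by
  have hsym := symmetricOp_of_isSelfAdjoint hA
  have key : ∀ z < e, FormBound A z := by
    intro z hz x y hxy
    have hzr : (z : ℂ) ∈ resolventSet A := by
      by_contra hc
      exact absurd (he hc) (not_le.2 hz)
    obtain ⟨R, h1, h2⟩ := hzr
    have hsa := isSelfAdjoint_resolvent hsym h1
    have hspec : ∀ t ∈ _root_.spectrum ℝ R, 0 ≤ id t := by
      intro t ht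
      rcases eq_or_ne t 0 with h0 | h0
      · exact h0.ge
      by_contra hc
      refine notMem_spectrum_resolvent h1 h2 h0 (fun hm => ?_) ht
      have := he hm
      have : t⁻¹ < 0 := inv_lt_zero.2 (not_le.1 hc)
      linarith
    set u : E := y - (z : ℂ) • x with hu
    have hyu : y = u + (z : ℂ) • x := by rw [hu]; abel
    have hRu : R u = x := resolvent_apply_eq h2 (by rwa [← hyu])
    have := cfc_inner_nonneg R hspec u
    rw [cfc_id ℝ R, hRu] at this
    rw [hyu, inner_shift_re]
    linarith
  intro x y hxy
  rcases (sq_nonneg ‖x‖).eq_or_lt with hx | hx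
  · have := key (e - 1) (by linarith) hxy
    rw [← hx, mul_zero] at this ⊢
    exact this
  · rw [← le_div_iff₀ hx]
    refine le_of_forall_lt fun z hz => ?_
    obtain ⟨w, hw1, hw2⟩ := exists_between hz
    have := key w hw2 hxy
    rw [← le_div_iff₀ hx] at this
    linarith

/-- The resolvent `R` at `e - 1` has spectrum in `{1} ∪ [0, b]` with `b < 1`, so a continuous
function of `R` is the spectral projection `Q` at `1`. By simplicity its range is spanned by `φ`. If
`x ⟂ φ`, then `u = (A - z) x ⟂ φ` and `Q u = 0`. On the rest of the spectrum `t ≥ (e' - z) t²`,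
which gives `⟨R u, u⟩ ≥ (e' - z) ‖R u‖²`, the asserted bound because `R u = x`. -/
theorem gap_of_isSelfAdjoint (hA : IsSelfAdjoint A) {e e' : ℝ}
    (he : e ∈ lowerBounds (realSpectrum A)) (hee' : e < e')
    (hgap : ∀ x ∈ realSpectrum A \ {e}, e' ≤ x) (hsimple : IsSimpleEigenvalue A e)
    {φ : E} (hφ : IsEigenvector A e φ) {x y : E} (hxy : (x, y) ∈ A.graph)
    (hx : inner ℂ φ x = 0) : e' * ‖x‖ ^ 2 ≤ (inner ℂ x y).re := by
  have hsym := symmetricOp_of_isSelfAdjoint hA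
  set z : ℝ := e - 1 with hz
  have hzr : (z : ℂ) ∈ resolventSet A := by
    by_contra hc
    have := he hc
    linarith
  obtain ⟨R, h1, h2⟩ := hzr
  have hsa := isSelfAdjoint_resolvent hsym h1
  have hd : 1 < e' - z := by linarith
  set b : ℝ := (e' - z)⁻¹ with hb
  have hb0 : 0 < b := inv_pos.2 (by linarith)
  have hb1 : b < 1 := inv_lt_one_of_one_lt₀ hd
  have hspec : ∀ t ∈ _root_.spectrum ℝ R, t = 1 ∨ (0 ≤ t ∧ t ≤ b) := by
    intro t ht
    rcases eq_or_ne t 0 with h0 | h0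
    · exact Or.inr ⟨h0.ge, h0.le.trans hb0.le⟩
    have hm : z + t⁻¹ ∈ realSpectrum A := by
      by_contra hc
      exact notMem_spectrum_resolvent h1 h2 h0 hc ht
    rcases eq_or_ne (z + t⁻¹) e with h3 | h3
    · left
      have : t⁻¹ = 1 := by linarith
      exact inv_eq_one.1 this
    · right
      have h4 := hgap _ ⟨hm, h3⟩
      have h5 : e' - z ≤ t⁻¹ := by linarith
      have h6 : 0 < t := inv_pos.1 (by linarith)
      exact ⟨h6.le, by rw [hb]; exact (le_inv_comm₀ (by linarith) h6).1 h5⟩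
  -- the spectral projection onto the eigenvalue `1` of `R`
  set f : ℝ → ℝ := fun t => max 0 ((t - b) / (1 - b)) with hf
  have hfc : Continuous f := by fun_prop
  have hf1 : f 1 = 1 := by
    simp only [hf]; rw [div_self (by linarith)]; norm_num
  have hf0 : ∀ t ≤ b, f t = 0 := fun t ht => by
    simp only [hf]
    exact max_eq_left (div_nonpos_of_nonpos_of_nonneg (by linarith) (by linarith))
  set Q := cfc f R with hQ
  have hRφ : R φ = φ := by
    refine resolvent_apply_eq h2 ?_
    have : (φ, (e : ℂ) • φ) ∈ A.graph := hφ.2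
    convert this using 2
    rw [hz]; push_cast; rw [sub_smul, one_smul]; abel
  have hRQ : R * Q = Q := by
    conv_lhs => rw [hQ, ← cfc_id ℝ R hsa]
    rw [cfc_id ℝ R hsa]
    nth_rw 1 [← cfc_id ℝ R hsa]
    rw [hQ, ← cfc_mul id f R (by fun_prop) hfc.continuousOn]
    refine cfc_congr fun t ht => ?_
    rcases hspec t ht with rfl | ⟨-, h⟩
    · simp
    · simp [hf0 t h]
  have hQφ : Q φ = φ := by
    -- A continuous version of `(t - 1)⁻¹`, truncated away from the pole. On the spectrum `1 - f t =
    -- h t * (t - 1)`, so `1 - Q` factors through `R - 1`, which kills `φ`.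
    set h : ℝ → ℝ := fun t => (min t b - 1)⁻¹ with hh
    have hhc : Continuous h := by
      refine Continuous.inv₀ (by fun_prop) fun t => ?_
      have := min_le_right t b
      linarith
    have e1 : 1 - Q = cfc h R * (R - 1) := by
      have a1 : (1 : E →L[ℂ] E) - Q = cfc (fun t => 1 - f t) R := by
        rw [cfc_sub (fun _ => (1 : ℝ)) f R continuousOn_const hfc.continuousOn, cfc_const_one ℝ R]
      have a2 : R - 1 = cfc (fun t : ℝ => t - 1) R := by
        rw [cfc_sub (fun t => t) (fun _ => (1 : ℝ)) R continuousOn_id continuousOn_const,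
          cfc_const_one ℝ R, cfc_id' ℝ R]
      rw [a1, a2, ← cfc_mul h _ R hhc.continuousOn (by fun_prop)]
      refine cfc_congr fun t ht => ?_
      rcases hspec t ht with rfl | ⟨-, h'⟩
      · simp [hf1]
      · simp only [hf0 t h', hh, min_eq_left h']
        rw [inv_mul_cancel₀ (by linarith)]; simp
    have e2 := congrArg (fun T : E →L[ℂ] E => T φ) e1
    simp only [mul_apply_eq_comp, sub_apply, one_apply_eq_self, hRφ, sub_self, map_zero] at e2
    exact (sub_eq_zero.1 e2).symm
  have hQsa : IsSelfAdjoint Q := cfc_predicate f R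
  have hQsym : ∀ u v, inner ℂ (Q u) v = inner ℂ u (Q v) :=
    fun u v => (ContinuousLinearMap.isSelfAdjoint_iff_isSymmetric.1 hQsa) u v
  set u : E := y - (z : ℂ) • x with hu
  have hyu : y = u + (z : ℂ) • x := by rw [hu]; abel
  have hRu : R u = x := resolvent_apply_eq h2 (by rwa [← hyu])
  have hφu : inner ℂ φ u = 0 := by
    rw [← hRφ, hsym.resolvent h1, hRu, hx]
  have hQu : Q u = 0 := by
    have hmem : Q u ∈ eigenspace A e := by
      have h3 := h1 (Q u)
      have h4 : R (Q u) = Q u := congrArg (fun T : E →L[ℂ] E => T u) hRQ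
      rw [h4] at h3
      change (Q u, (e : ℂ) • Q u) ∈ A.graph
      convert h3 using 2
      rw [hz]; push_cast; rw [sub_smul, one_smul]; abel
    obtain ⟨c, hc⟩ := (finrank_eq_one_iff_of_nonzero' (⟨φ, hφ.2⟩ : eigenspace A e)
      (by simpa using hφ.1)).1 hsimple ⟨Q u, hmem⟩
    have hc' : c • φ = Q u := congrArg Subtype.val hc
    have h5 : inner ℂ φ (Q u) = 0 := by rw [← hQsym, hQφ, hφu]
    rw [← hc', inner_smul_right, mul_eq_zero] at h5
    rcases h5 with h5 | h5
    · rw [← hc', h5, zero_smul]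
    · exact absurd (inner_self_eq_zero.1 h5) hφ.1
  -- The factor `1 - f t` removes the point `t = 1`, where the quadratic polynomial is negative; it
  -- acts trivially on `u` because `Q u = 0`.
  have hpos := cfc_inner_nonneg R (f := fun t => (t - (e' - z) * (t * t)) * (1 - f t)) (by
    intro t ht
    rcases hspec t ht with rfl | ⟨h3, h4⟩
    · simp [hf1]
    · rw [hf0 t h4]
      have : (e' - z) * t ≤ 1 := by
        calc (e' - z) * t ≤ (e' - z) * b := by gcongr
          _ = 1 := mul_inv_cancel₀ (by linarith)
      nlinarith) u
  have hval : cfc (fun t => (t - (e' - z) * (t * t)) * (1 - f t)) R u =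
      x - ((e' - z : ℝ) : ℂ) • R x := by
    have a1 : (1 : E →L[ℂ] E) - Q = cfc (fun t => 1 - f t) R := by
      rw [cfc_sub (fun _ => (1 : ℝ)) f R continuousOn_const hfc.continuousOn, cfc_const_one ℝ R]
    rw [cfc_mul (fun t => t - (e' - z) * (t * t)) (fun t => 1 - f t) R (by fun_prop)
      (by fun_prop), cfc_sub (fun t => t) (fun t => (e' - z) * (t * t)) R (by fun_prop)
      (by fun_prop), cfc_const_mul (e' - z) (fun t => t * t) R (by fun_prop),
      cfc_mul (fun t => t) (fun t => t) R (by fun_prop) (by fun_prop), cfc_id' ℝ R, ← a1]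
    simp only [mul_apply_eq_comp, sub_apply, one_apply_eq_self, smul_apply, hQu, sub_zero, hRu]
    rw [Complex.coe_smul]
  rw [hval, inner_sub_left, inner_smul_left, Complex.conj_ofReal, Complex.sub_re,
    Complex.re_ofReal_mul, hsym.resolvent h1, hRu, inner_self_re] at hpos
  rw [hyu, inner_shift_re]
  linarith

end SelfAdjoint

/-! ### Measurability of operator-valued functions -/

section Measurability

variable {α : Type*} [MeasurableSpace α] {μ : Measure α}
variable {E : Type*} [NormedAddCommGroup E] [InnerProductSpace ℂ E]

/-- Measurability of `F` in operator norm is not available. For a simple function the composition is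
a finite sum of indicators of the maps `a ↦ F a x`, and continuity of each `F a` passes to the
limit. -/
theorem aestronglyMeasurable_clm_apply {F : α → E →L[ℂ] E}
    (hF : ∀ x, AEStronglyMeasurable (fun a => F a x) μ) {f : α → E}
    (hf : AEStronglyMeasurable f μ) : AEStronglyMeasurable (fun a => F a (f a)) μ := by
  have key : ∀ s : SimpleFunc α E, AEStronglyMeasurable (fun a => F a (s a)) μ := by
    intro s
    have : (fun a => F a (s a)) =
        fun a => ∑ x ∈ s.range, (s ⁻¹' {x}).indicator (fun a => F a x) a := by
      funext a
      rw [Finset.sum_eq_single (s a)]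
      · rw [Set.indicator_of_mem (by simp)]
      · intro x _ hx
        exact Set.indicator_of_notMem (by simpa using hx.symm) _
      · intro h
        exact absurd (s.mem_range_self a) h
    rw [this]
    exact Finset.aestronglyMeasurable_fun_sum _ fun x _ => (hF x).indicator (s.measurableSet_fiber x)
  have hg := hf.stronglyMeasurable_mk
  have h1 : AEStronglyMeasurable (fun a => F a (hf.mk f a)) μ :=
    aestronglyMeasurable_of_tendsto_ae atTop (fun n => key (hg.approx n))
      (Eventually.of_forall fun a => ((F a).continuous.tendsto _).comp (hg.tendsto_approx a))
  refine h1.congr ?_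
  filter_upwards [hf.ae_eq_mk] with a ha
  rw [← ha]

variable [CompleteSpace E] [TopologicalSpace.SeparableSpace E]

/-- In a separable Hilbert space weak measurability implies strong measurability. -/
theorem aestronglyMeasurable_of_inner {f : α → E}
    (hf : ∀ x, AEStronglyMeasurable (fun a => inner ℂ x (f a)) μ) : AEStronglyMeasurable f μ := by
  obtain ⟨w, b, -⟩ := exists_hilbertBasis ℂ E
  have hw : Countable w := by
    refine Pairwise.countable_of_isOpen_disjoint (s := fun i : w => Metric.ball (b i) (1 / 2))
      (fun i j hij => Metric.ball_disjoint_ball ?_) (fun _ => Metric.isOpen_ball)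
      (fun i => ⟨b i, Metric.mem_ball_self (by norm_num)⟩)
    have h0 : inner ℂ (b i) (b j) = 0 := b.orthonormal.2 hij
    have h1 : ‖b i - b j‖ ^ 2 = 2 := by
      rw [@norm_sub_sq ℂ, h0, b.orthonormal.1, b.orthonormal.1]
      norm_num
    rw [dist_eq_norm]
    nlinarith [norm_nonneg (b i - b j)]
  -- Countability of the basis makes `atTop` on its finite subsets countably generated, as the
  -- measurability of a limit requires.
  refine aestronglyMeasurable_of_tendsto_ae (u := atTop)
    (f := fun (s : Finset w) a => ∑ i ∈ s, inner ℂ (b i) (f a) • b i)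
    (fun s => ?_) (Eventually.of_forall fun a => ?_)
  · exact Finset.aestronglyMeasurable_fun_sum _ fun i _ => (hf _).smul_const _
  · have := b.hasSum_repr (f a)
    simp only [HilbertBasis.repr_apply_apply] at this
    exact this

/-- Strong measurability of `F` gives only weak measurability of its adjoint, through `⟨x, F* f⟩ =
⟨F x, f⟩`. Separability then upgrades weak to strong. -/
theorem aestronglyMeasurable_adjoint_apply {F : α → E →L[ℂ] E}
    (hF : ∀ x, AEStronglyMeasurable (fun a => F a x) μ) {f : α → E}
    (hf : AEStronglyMeasurable f μ) :
    AEStronglyMeasurable (fun a => (F a).adjoint (f a)) μ := by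
  refine aestronglyMeasurable_of_inner fun x => ?_
  simp only [ContinuousLinearMap.adjoint_inner_right]
  exact (hF x).inner hf

end Measurability

/-! ### Squared norms as lower integrals. -/

section SquareIntegrable

variable {E : Type*} [NormedAddCommGroup E] {α : Type*} [MeasurableSpace α] {μ : Measure α}

theorem enorm_sq_of_memLp (f : Lp E 2 μ) :
    ENNReal.ofReal (‖f‖ ^ 2) = ∫⁻ a, ‖f a‖ₑ ^ 2 ∂μ := by
  rw [ENNReal.ofReal_pow (norm_nonneg _), ofReal_norm, Lp.enorm_def,
    eLpNorm_eq_lintegral_rpow_enorm_toReal (by norm_num) (by norm_num)]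
  simp only [ENNReal.toReal_ofNat, one_div, ENNReal.rpow_ofNat]
  rw [← ENNReal.rpow_natCast, ← ENNReal.rpow_mul]
  norm_num

theorem memLp_two_of_lintegral {f : α → E}
    (hf : AEStronglyMeasurable f μ) (h : ∫⁻ a, ‖f a‖ₑ ^ 2 ∂μ ≠ ⊤) : MemLp f 2 μ := by
  refine ⟨hf, ?_⟩
  rw [eLpNorm_eq_lintegral_rpow_enorm_toReal (by norm_num) (by norm_num)]
  simp only [ENNReal.toReal_ofNat, one_div, ENNReal.rpow_ofNat]
  exact ENNReal.rpow_lt_top_of_nonneg (by norm_num) h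

theorem lintegral_sq_ne_top_of_memLp {f : α → E}
    (hf : MemLp f 2 μ) : ∫⁻ a, ‖f a‖ₑ ^ 2 ∂μ ≠ ⊤ := by
  have h1 : ∫⁻ a, ‖f a‖ₑ ^ 2 ∂μ = ∫⁻ a, ‖hf.toLp f a‖ₑ ^ 2 ∂μ := by
    refine lintegral_congr_ae ?_
    filter_upwards [hf.coeFn_toLp] with a h1
    rw [h1]
  rw [h1, ← enorm_sq_of_memLp]
  exact ENNReal.ofReal_ne_top

end SquareIntegrable

/-! ### Vectors of the Fock space -/

section FockTools

variable {𝔥 : Type*} [NormedAddCommGroup 𝔥] [InnerProductSpace ℂ 𝔥]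

theorem wave_aestronglyMeasurable (ψ : Fock 𝔥) (n : ℕ) :
    AEStronglyMeasurable (wave ψ n) volume :=
  Lp.aestronglyMeasurable _

theorem wave_memLp (ψ : Fock 𝔥) (n : ℕ) : MemLp (wave ψ n) 2 volume :=
  Lp.memLp _

theorem wave_perm (ψ : Fock 𝔥) (n : ℕ) (π : Equiv.Perm (Fin n)) :
    (fun K => wave ψ n (fun i => K (π i))) =ᵐ[volume] wave ψ n :=
  (ψ n).2 π

theorem wave_sub (ψ χ : Fock 𝔥) (n : ℕ) : wave (ψ - χ) n =ᵐ[volume] wave ψ n - wave χ n :=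
  Lp.coeFn_sub _ _

theorem hasSum_norm_sq (ψ : Fock 𝔥) : HasSum (fun n => ‖ψ n‖ ^ 2) (‖ψ‖ ^ 2) := by
  have := lp.hasSum_norm (p := 2) (by norm_num) ψ
  simpa using this

/-- The squared norm as a sum of integrals. -/
theorem ofReal_norm_sq (ψ : Fock 𝔥) :
    ENNReal.ofReal (‖ψ‖ ^ 2) = ∑' n, ∫⁻ K, ‖wave ψ n K‖ₑ ^ 2 := by
  rw [← (hasSum_norm_sq ψ).tsum_eq, ENNReal.ofReal_tsum_of_nonneg (fun n => by positivity)
    (hasSum_norm_sq ψ).summable]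
  exact tsum_congr fun n => enorm_sq_of_memLp _

theorem hasSum_inner_wave (ψ χ : Fock 𝔥) :
    HasSum (fun n => ∫ K, inner ℂ (wave ψ n K) (wave χ n K)) (inner ℂ ψ χ) :=
  lp.hasSum_inner ψ χ

theorem integrable_inner_of_memLp {α : Type*} [MeasurableSpace α] {μ : Measure α} {f g : α → 𝔥}
    (hf : MemLp f 2 μ) (hg : MemLp g 2 μ) : Integrable (fun a => inner ℂ (f a) (g a)) μ := by
  have := L2.integrable_inner (𝕜 := ℂ) hf.toLp hg.toLp
  refine this.congr ?_
  filter_upwards [hf.coeFn_toLp, hg.coeFn_toLp] with a h1 h2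
  rw [h1, h2]

/-- A square integrable family of symmetric functions defines a vector of the Fock space. -/
theorem exists_fock (f : ∀ n, (Fin n → R3) → 𝔥) (hm : ∀ n, AEStronglyMeasurable (f n) volume)
    (hsym : ∀ n (π : Equiv.Perm (Fin n)), (fun K => f n (fun i => K (π i))) =ᵐ[volume] f n)
    (hfin : ∑' n, ∫⁻ K, ‖f n K‖ₑ ^ 2 ≠ ⊤) : ∃ ψ : Fock 𝔥, ∀ n, wave ψ n =ᵐ[volume] f n := by
  have h2 : ∀ n, MemLp (f n) 2 volume := fun n =>
    memLp_two_of_lintegral (hm n) (ENNReal.ne_top_of_tsum_ne_top hfin n)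
  let g : ∀ n, L2s 𝔥 n := fun n => ⟨(h2 n).toLp, fun π => by
    have h3 := (h2 n).coeFn_toLp
    have h4 := (measurePreserving_perm π).quasiMeasurePreserving.ae h3
    filter_upwards [h3, h4, hsym n π] with K k1 k2 k3
    rw [k1, k2, k3]⟩
  have hg : Memℓp g 2 := by
    refine memℓp_gen ?_
    simp only [ENNReal.toReal_ofNat, Real.rpow_ofNat]
    have : ∀ n, ENNReal.ofReal (‖g n‖ ^ 2) = ∫⁻ K, ‖f n K‖ₑ ^ 2 := fun n => by
      rw [Submodule.coe_norm, enorm_sq_of_memLp]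
      refine lintegral_congr_ae ?_
      filter_upwards [(h2 n).coeFn_toLp] with K h1
      rw [h1]
    simp_rw [← this] at hfin
    have h5 := ENNReal.summable_toReal hfin
    refine h5.congr fun n => ?_
    rw [ENNReal.toReal_ofReal (by positivity)]
  exact ⟨⟨g, hg⟩, fun n => (h2 n).coeFn_toLp⟩

theorem norm_le_of_wave {ψ χ : Fock 𝔥} {C : ℝ} (hC : 0 ≤ C)
    (h : ∀ n, ∀ᵐ K, ‖wave χ n K‖ ≤ C * ‖wave ψ n K‖) : ‖χ‖ ≤ C * ‖ψ‖ := by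
  refine le_of_sq_le_sq ?_ (by positivity)
  rw [← ENNReal.ofReal_le_ofReal_iff (by positivity), mul_pow, ENNReal.ofReal_mul (by positivity),
    ofReal_norm_sq, ofReal_norm_sq, ← ENNReal.tsum_mul_left]
  refine ENNReal.tsum_le_tsum fun n => ?_
  rw [← lintegral_const_mul'' _ ((wave_aestronglyMeasurable ψ n).enorm.pow_const 2)]
  refine lintegral_mono_ae ?_
  filter_upwards [h n] with K hK
  rw [← ofReal_norm, ← ofReal_norm, ← ENNReal.ofReal_pow (by positivity),
    ← ENNReal.ofReal_pow (by positivity), ← ENNReal.ofReal_mul (by positivity), ← mul_pow]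
  exact ENNReal.ofReal_le_ofReal (by gcongr)

/-- Bounded operators that act fibrewise. -/
theorem exists_fibreOperator (B : ∀ n, (Fin n → R3) → 𝔥 →L[ℂ] 𝔥)
    (hm : ∀ n x, AEStronglyMeasurable (fun K => B n K x) volume)
    (hsym : ∀ n (π : Equiv.Perm (Fin n)) K, B n (fun i => K (π i)) = B n K)
    {C : ℝ} (hC : 0 ≤ C) (hB : ∀ n, ∀ᵐ K, ‖B n K‖ ≤ C) :
    ∃ T : Fock 𝔥 →L[ℂ] Fock 𝔥, ∀ ψ n, wave (T ψ) n =ᵐ[volume] fun K => B n K (wave ψ n K) := by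
  have hex : ∀ ψ : Fock 𝔥, ∃ χ : Fock 𝔥,
      ∀ n, wave χ n =ᵐ[volume] fun K => B n K (wave ψ n K) := by
    intro ψ
    refine exists_fock (fun n K => B n K (wave ψ n K))
      (fun n => aestronglyMeasurable_clm_apply (hm n) (wave_aestronglyMeasurable ψ n))
      (fun n π => ?_) ?_
    · filter_upwards [wave_perm ψ n π] with K hK
      rw [hsym, hK]
    · refine ne_top_of_le_ne_top (b := ENNReal.ofReal (C ^ 2) * ENNReal.ofReal (‖ψ‖ ^ 2))
        (ENNReal.mul_ne_top ENNReal.ofReal_ne_top ENNReal.ofReal_ne_top) ?_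
      rw [ofReal_norm_sq, ← ENNReal.tsum_mul_left]
      refine ENNReal.tsum_le_tsum fun n => ?_
      rw [← lintegral_const_mul'' _ ((wave_aestronglyMeasurable ψ n).enorm.pow_const 2)]
      refine lintegral_mono_ae ?_
      filter_upwards [hB n] with K hK
      rw [← ofReal_norm, ← ofReal_norm, ← ENNReal.ofReal_pow (by positivity),
        ← ENNReal.ofReal_pow (by positivity), ← ENNReal.ofReal_mul (by positivity), ← mul_pow]
      refine ENNReal.ofReal_le_ofReal ?_
      have := (B n K).le_of_opNorm_le hK (wave ψ n K)
      gcongr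
  choose t ht using hex
  let T₀ : Fock 𝔥 →ₗ[ℂ] Fock 𝔥 :=
    { toFun := t
      map_add' := fun ψ χ => Fock_ext fun n => by
        filter_upwards [ht (ψ + χ) n, ht ψ n, ht χ n, wave_add ψ χ n, wave_add (t ψ) (t χ) n]
          with K h1 h2 h3 h4 h5
        rw [h1, h5, h4, Pi.add_apply, Pi.add_apply, h2, h3, map_add]
      map_smul' := fun c ψ => Fock_ext fun n => by
        filter_upwards [ht (c • ψ) n, ht ψ n, wave_smul c ψ n, wave_smul c (t ψ) n]
          with K h1 h2 h3 h4
        rw [h1, RingHom.id_apply, h4, h3, Pi.smul_apply, Pi.smul_apply, h2, map_smul] }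
  refine ⟨T₀.mkContinuous C fun ψ => norm_le_of_wave hC fun n => ?_, ht⟩
  filter_upwards [hB n, ht ψ n] with K h1 h2
  change ‖wave (t ψ) n K‖ ≤ _
  rw [h2]
  exact (B n K).le_of_opNorm_le h1 _

end FockTools

/-! ### The free Hamiltonian -/

section Abstract

variable {E : Type*} [NormedAddCommGroup E] [InnerProductSpace ℂ E]

theorem mem_graph_add {A B : E →ₗ.[ℂ] E} {x y : E} :
    (x, y) ∈ (A + B).graph ↔ ∃ y₁ y₂, (x, y₁) ∈ A.graph ∧ (x, y₂) ∈ B.graph ∧ y = y₁ + y₂ := by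
  constructor
  · intro h
    obtain ⟨u, rfl, rfl⟩ := (LinearPMap.mem_graph_iff _).1 h
    exact ⟨A ⟨u, u.2.1⟩, B ⟨u, u.2.2⟩, A.mem_graph ⟨u, u.2.1⟩, B.mem_graph ⟨u, u.2.2⟩, rfl⟩
  · rintro ⟨y₁, y₂, h1, h2, rfl⟩
    obtain ⟨u, rfl, rfl⟩ := (LinearPMap.mem_graph_iff _).1 h1
    obtain ⟨v, hv, rfl⟩ := (LinearPMap.mem_graph_iff _).1 h2
    simp only at hv
    refine (LinearPMap.mem_graph_iff _).2 ⟨⟨u, u.2, hv ▸ v.2⟩, rfl, ?_⟩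
    rw [LinearPMap.add_apply]
    congr 2
    exact Subtype.ext hv.symm

theorem mem_graph_smul {A : E →ₗ.[ℂ] E} {c : ℂ} {x y : E} :
    (x, y) ∈ (c • A).graph ↔ ∃ y₁, (x, y₁) ∈ A.graph ∧ y = c • y₁ := by
  constructor
  · intro h
    obtain ⟨u, rfl, rfl⟩ := (LinearPMap.mem_graph_iff _).1 h
    exact ⟨A u, A.mem_graph u, rfl⟩
  · rintro ⟨y₁, h1, rfl⟩
    obtain ⟨u, rfl, rfl⟩ := (LinearPMap.mem_graph_iff _).1 h1
    exact (LinearPMap.mem_graph_iff _).2 ⟨u, rfl, rfl⟩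

/-- For `w` orthogonal to the domain solve `(A - z) x = w` and `(A - z) x' = x`. Symmetry gives `⟨x,
x⟩ = ⟨x', w⟩ = 0`, so `x = 0` and `w = 0`. -/
theorem ShiftSurjective.dense_domain [CompleteSpace E] {A : E →ₗ.[ℂ] E} {z : ℝ}
    (hsym : SymmetricOp A) (hs : ShiftSurjective A z) : Dense (A.domain : Set E) := by
  rw [Submodule.dense_iff_topologicalClosure_eq_top,
    Submodule.topologicalClosure_eq_top_iff, Submodule.eq_bot_iff]
  intro w hw
  obtain ⟨x, hx⟩ := hs w
  obtain ⟨x', hx'⟩ := hs x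
  have h1 : inner ℂ x' w = 0 :=
    (Submodule.mem_orthogonal _ _).1 hw x' (LinearPMap.mem_domain_of_mem_graph hx')
  have h2 := hsym hx' hx
  simp only [inner_add_left, inner_add_right, inner_smul_left, inner_smul_right,
    Complex.conj_ofReal, h1, zero_add] at h2
  have h3 : x = 0 := inner_self_eq_zero.1 (add_eq_right.1 h2)
  rw [h3, smul_zero, add_zero] at hx
  exact A.graph_fst_eq_zero_snd hx rfl

end Abstract

section Free

variable {𝔥 : Type*} [NormedAddCommGroup 𝔥] [InnerProductSpace ℂ 𝔥]

/-- The operator `Hat ⊗ 1 + 1 ⊗ H_f`. -/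
def freeHamiltonian (Hat : 𝔥 →ₗ.[ℂ] 𝔥) : Fock 𝔥 →ₗ.[ℂ] Fock 𝔥 :=
  atomOperator Hat + fieldHamiltonian

/-- The field energy `⟨ψ, H_f ψ⟩`, possibly infinite. -/
def fieldEnergy (ψ : Fock 𝔥) : ENNReal :=
  ∑' n, ∫⁻ K, ENNReal.ofReal (∑ i, ‖K i‖) * ‖wave ψ n K‖ₑ ^ 2

theorem mem_graph_freeHamiltonian {Hat : 𝔥 →ₗ.[ℂ] 𝔥} {ψ χ : Fock 𝔥} :
    (ψ, χ) ∈ (freeHamiltonian Hat).graph ↔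
      ∃ χ₁ χ₂, (ψ, χ₁) ∈ atomGraph Hat ∧ (ψ, χ₂) ∈ fieldGraph ∧ χ = χ₁ + χ₂ := by
  rw [freeHamiltonian, mem_graph_add, atomOperator_graph, fieldHamiltonian_graph]

theorem atomGraph_symmetric {Hat : 𝔥 →ₗ.[ℂ] 𝔥} (h : SymmetricOp Hat) {ψ χ ψ' χ' : Fock 𝔥}
    (h1 : (ψ, χ) ∈ atomGraph Hat) (h2 : (ψ', χ') ∈ atomGraph Hat) :
    inner ℂ χ ψ' = inner ℂ ψ χ' := by
  refine (hasSum_inner_wave χ ψ').unique ?_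
  convert hasSum_inner_wave ψ χ' using 2 with n
  refine integral_congr_ae ?_
  filter_upwards [h1 n, h2 n] with K k1 k2
  exact h k1 k2

theorem fieldGraph_symmetric {ψ χ ψ' χ' : Fock 𝔥}
    (h1 : (ψ, χ) ∈ fieldGraph) (h2 : (ψ', χ') ∈ fieldGraph) :
    inner ℂ χ ψ' = inner ℂ ψ χ' := by
  refine (hasSum_inner_wave χ ψ').unique ?_
  convert hasSum_inner_wave ψ χ' using 2 with n
  refine integral_congr_ae ?_
  filter_upwards [h1 n, h2 n] with K k1 k2
  rw [k1, k2, inner_smul_left, inner_smul_right, Complex.conj_ofReal]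

theorem freeHamiltonian_symmetric {Hat : 𝔥 →ₗ.[ℂ] 𝔥} (h : SymmetricOp Hat) :
    SymmetricOp (freeHamiltonian Hat) := by
  intro ψ χ ψ' χ' h1 h2
  obtain ⟨χ₁, χ₂, a1, a2, rfl⟩ := mem_graph_freeHamiltonian.1 h1
  obtain ⟨χ₁', χ₂', b1, b2, rfl⟩ := mem_graph_freeHamiltonian.1 h2
  rw [inner_add_left, inner_add_right, atomGraph_symmetric h a1 b1, fieldGraph_symmetric a2 b2]

theorem hasSum_re_inner_wave (ψ χ : Fock 𝔥) :
    HasSum (fun n => ∫ K, (inner ℂ (wave ψ n K) (wave χ n K)).re) (inner ℂ ψ χ).re := by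
  have h := (Complex.hasSum_re (hasSum_inner_wave ψ χ))
  convert h using 2 with n
  exact (integral_re (integrable_inner_of_memLp (wave_memLp ψ n) (wave_memLp χ n)))

theorem integrable_re_inner_wave (ψ χ : Fock 𝔥) (n : ℕ) :
    Integrable (fun K => (inner ℂ (wave ψ n K) (wave χ n K)).re) :=
  (integrable_inner_of_memLp (wave_memLp ψ n) (wave_memLp χ n)).re

theorem atomGraph_formBound {Hat : 𝔥 →ₗ.[ℂ] 𝔥} {e : ℝ} (h : FormBound Hat e) {ψ χ : Fock 𝔥}
    (h1 : (ψ, χ) ∈ atomGraph Hat) : e * ‖ψ‖ ^ 2 ≤ (inner ℂ ψ χ).re := by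
  rw [← inner_self_re]
  refine hasSum_le (fun n => ?_) ((hasSum_re_inner_wave ψ ψ).mul_left e) (hasSum_re_inner_wave ψ χ)
  rw [← integral_const_mul]
  refine integral_mono_ae ((integrable_re_inner_wave ψ ψ n).const_mul e)
    (integrable_re_inner_wave ψ χ n) ?_
  filter_upwards [h1 n] with K k1
  have := h k1
  rwa [← inner_self_re] at this

theorem fieldEnergy_eq {ψ χ : Fock 𝔥} (h1 : (ψ, χ) ∈ fieldGraph) :
    fieldEnergy ψ = ENNReal.ofReal (inner ℂ ψ χ).re := by
  have hpt : ∀ n, ∀ᵐ K, (inner ℂ (wave ψ n K) (wave χ n K)).re =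
      (∑ i, ‖K i‖) * ‖wave ψ n K‖ ^ 2 := fun n => by
    filter_upwards [h1 n] with K k1
    rw [k1, inner_smul_right, Complex.re_ofReal_mul, inner_self_re]
  have hnn : ∀ n, 0 ≤ᵐ[volume] fun K => (inner ℂ (wave ψ n K) (wave χ n K)).re := fun n => by
    filter_upwards [hpt n] with K k1
    rw [k1]
    exact mul_nonneg (Finset.sum_nonneg fun i _ => norm_nonneg _) (sq_nonneg _)
  rw [← (hasSum_re_inner_wave ψ χ).tsum_eq, ENNReal.ofReal_tsum_of_nonneg
    (fun n => integral_nonneg_of_ae (hnn n)) (hasSum_re_inner_wave ψ χ).summable, fieldEnergy]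
  refine tsum_congr fun n => ?_
  rw [ofReal_integral_eq_lintegral_ofReal (integrable_re_inner_wave ψ χ n) (hnn n)]
  refine lintegral_congr_ae ?_
  filter_upwards [hpt n] with K k1
  rw [k1, ENNReal.ofReal_mul (Finset.sum_nonneg fun i _ => norm_nonneg _),
    ENNReal.ofReal_pow (norm_nonneg _), ofReal_norm]

theorem fieldGraph_nonneg {ψ χ : Fock 𝔥} (h1 : (ψ, χ) ∈ fieldGraph) : 0 ≤ (inner ℂ ψ χ).re := by
  refine (hasSum_re_inner_wave ψ χ).nonneg fun n => integral_nonneg_of_ae ?_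
  filter_upwards [h1 n] with K k1
  rw [k1, inner_smul_right, Complex.re_ofReal_mul, inner_self_re]
  exact mul_nonneg (Finset.sum_nonneg fun i _ => norm_nonneg _) (sq_nonneg _)

theorem fieldEnergy_ne_top_of_mem {Hat : 𝔥 →ₗ.[ℂ] 𝔥} {ψ χ : Fock 𝔥}
    (h : (ψ, χ) ∈ (freeHamiltonian Hat).graph) : fieldEnergy ψ ≠ ⊤ := by
  obtain ⟨χ₁, χ₂, a1, a2, rfl⟩ := mem_graph_freeHamiltonian.1 h
  rw [fieldEnergy_eq a2]
  exact ENNReal.ofReal_ne_top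

/-- The field energy is kept on the left because it later has to absorb the interaction. -/
theorem freeHamiltonian_formBound_add {Hat : 𝔥 →ₗ.[ℂ] 𝔥} {e : ℝ} (h : FormBound Hat e)
    {ψ χ : Fock 𝔥} (h1 : (ψ, χ) ∈ (freeHamiltonian Hat).graph) :
    e * ‖ψ‖ ^ 2 + (fieldEnergy ψ).toReal ≤ (inner ℂ ψ χ).re := by
  obtain ⟨χ₁, χ₂, a1, a2, rfl⟩ := mem_graph_freeHamiltonian.1 h1
  rw [fieldEnergy_eq a2, ENNReal.toReal_ofReal (fieldGraph_nonneg a2), inner_add_right,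
    Complex.add_re]
  linarith [atomGraph_formBound h a1]

theorem freeHamiltonian_formBound {Hat : 𝔥 →ₗ.[ℂ] 𝔥} {e : ℝ} (h : FormBound Hat e) :
    FormBound (freeHamiltonian Hat) e := fun ψ χ h1 => by
  have h2 := freeHamiltonian_formBound_add h h1
  have h3 : 0 ≤ (fieldEnergy ψ).toReal := ENNReal.toReal_nonneg
  linarith

/-- The free Hamiltonian is inverted fibrewise. -/
theorem freeHamiltonian_shiftSurjective {Hat : 𝔥 →ₗ.[ℂ] 𝔥} {e : ℝ} (h : FormBound Hat e)
    (hs : ∀ z < e, ShiftSurjective Hat z) {z : ℝ} (hz : z < e) :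
    ShiftSurjective (freeHamiltonian Hat) z := by
  -- The family is defined for all real `t`, with the value `0` for `t ≥ e`, so that its dependence
  -- on `t` can be studied; only `t < e` matters.
  have hex : ∀ t : ℝ, ∃ R : 𝔥 →L[ℂ] 𝔥, t < e → ((∀ y, (R y, y + (t : ℂ) • R y) ∈ Hat.graph) ∧
      ∀ x y, (x, y + (t : ℂ) • x) ∈ Hat.graph → R y = x) := by
    intro t
    by_cases ht : t < e
    · obtain ⟨R, hR⟩ := (hs t ht).exists_resolvent h ht
      exact ⟨R, fun _ => hR⟩
    · exact ⟨0, fun h => absurd h ht⟩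
  choose R hR using hex
  have hbound : ∀ t < e, ∀ y, (e - t) * ‖R t y‖ ≤ ‖y‖ := fun t ht y => h.norm_le ((hR t ht).1 y)
  have hbound' : ∀ t < e, ‖R t‖ ≤ (e - t)⁻¹ := fun t ht => by
    refine (R t).opNorm_le_bound (inv_nonneg.2 (sub_pos.2 ht).le) fun y => ?_
    rw [inv_mul_eq_div, le_div_iff₀ (sub_pos.2 ht), mul_comm]
    exact hbound t ht y
  -- The resolvent equation gives strong continuity in `t`, hence measurability of the fibres `R (z
  -- - ∑ |kᵢ|)`.
  have hres : ∀ t < e, ∀ t' < e, ∀ y, R t y - R t' y = ((t - t' : ℝ) : ℂ) • R t (R t' y) := by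
    intro t ht t' ht' y
    have : R t (y + ((t' - t : ℝ) : ℂ) • R t' y) = R t' y := by
      refine (hR t ht).2 _ _ ?_
      convert (hR t' ht').1 y using 2
      push_cast
      rw [sub_smul]; abel
    rw [map_add, map_smul] at this
    rw [← neg_sub t' t, Complex.ofReal_neg, neg_smul]
    conv_lhs => rw [← this]
    rw [this]
    nth_rw 1 [← this]
    abel
  have hcont : ∀ y, ContinuousOn (fun t => R t y) (Set.Iio e) := by
    intro y t ht
    rw [ContinuousWithinAt, tendsto_iff_norm_sub_tendsto_zero]
    have ht' : t < e := ht
    refine squeeze_zero' (g := fun t' => |t - t'| * ((e - t)⁻¹ * ‖R t' y‖)) ?_ ?_ ?_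
    · exact Eventually.of_forall fun _ => norm_nonneg _
    · filter_upwards [self_mem_nhdsWithin] with t' ht''
      rw [← norm_neg, neg_sub, hres t ht t' ht'', norm_smul, Complex.norm_real, Real.norm_eq_abs]
      gcongr
      exact (R t).le_of_opNorm_le (hbound' t ht) _
    · refine Tendsto.zero_mul_isBoundedUnder_le ?_ ?_
      · refine Tendsto.mono_left ?_ nhdsWithin_le_nhds
        have : Continuous fun t' : ℝ => |t - t'| := by fun_prop
        simpa using this.tendsto t
      · refine ⟨(e - t)⁻¹ * (((e - t) / 2)⁻¹ * ‖y‖), ?_⟩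
        rw [eventually_map]
        have : ∀ᶠ t' in 𝓝[Set.Iio e] t, t' < t + (e - t) / 2 :=
          nhdsWithin_le_nhds (Iio_mem_nhds (by linarith))
        filter_upwards [this] with t' h'
        have ht'' : t' < e := by linarith
        have e1 : 0 < e - t := by linarith
        change ‖(e - t)⁻¹ * ‖R t' y‖‖ ≤ _
        rw [Real.norm_of_nonneg (by positivity)]
        gcongr
        refine ((R t').le_of_opNorm_le (hbound' t' ht'') y).trans ?_
        gcongr
        linarith
  have hsum : ∀ n (K : Fin n → R3), 0 ≤ ∑ i, ‖K i‖ := fun n K =>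
    Finset.sum_nonneg fun i _ => norm_nonneg _
  have hlt : ∀ n (K : Fin n → R3), z - ∑ i, ‖K i‖ < e := fun n K => by linarith [hsum n K]
  have hmeas : ∀ n x, AEStronglyMeasurable (fun K : Fin n → R3 => R (z - ∑ i, ‖K i‖) x) volume := by
    intro n x
    refine Continuous.aestronglyMeasurable ?_
    exact (hcont x).comp_continuous (by fun_prop) fun K => hlt n K
  have hsymm : ∀ n (π : Equiv.Perm (Fin n)) (K : Fin n → R3),
      ∑ i, ‖K (π i)‖ = ∑ i, ‖K i‖ := fun n π K => Equiv.sum_comp π fun i => ‖K i‖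
  -- With `ω = ∑ |kᵢ|`, the inverse of `H_at + ω - z` on a fibre is `R (z - ω)`. The operator `S`
  -- below is `H_f T`; it is bounded by `ω / (e - z + ω) ≤ 1`, so the range of `T` lies in the
  -- domain of `H_f`.
  obtain ⟨T, hT⟩ := exists_fibreOperator (𝔥 := 𝔥) (fun n K => R (z - ∑ i, ‖K i‖)) hmeas
    (fun n π K => by rw [hsymm]) (C := (e - z)⁻¹) (inv_nonneg.2 (sub_pos.2 hz).le)
    (fun n => Eventually.of_forall fun K => (hbound' _ (hlt n K)).trans (by
      have := hsum n K
      have := sub_pos.2 hz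
      gcongr; linarith))
  obtain ⟨S, hS⟩ := exists_fibreOperator (𝔥 := 𝔥)
    (fun n K => ((∑ i, ‖K i‖ : ℝ) : ℂ) • R (z - ∑ i, ‖K i‖))
    (fun n x => by
      refine AEStronglyMeasurable.smul (Continuous.aestronglyMeasurable (by fun_prop)) (hmeas n x))
    (fun n π K => by rw [hsymm]) (C := 1) zero_le_one
    (fun n => Eventually.of_forall fun K => by
      have h1 := hsum n K
      have h2 := sub_pos.2 hz
      rw [norm_smul, Complex.norm_real, Real.norm_eq_abs, abs_of_nonneg h1]
      calc (∑ i, ‖K i‖) * ‖R (z - ∑ i, ‖K i‖)‖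
          ≤ (∑ i, ‖K i‖) * (e - (z - ∑ i, ‖K i‖))⁻¹ := by gcongr; exact hbound' _ (hlt n K)
        _ ≤ 1 := by
          rw [← div_eq_mul_inv, div_le_one (by linarith)]
          linarith)
  intro y
  refine ⟨T y, mem_graph_freeHamiltonian.2 ⟨y + (z : ℂ) • T y - S y, S y, fun n => ?_, fun n => ?_,
    by abel⟩⟩
  · filter_upwards [hT y n, hS y n, wave_sub (y + (z : ℂ) • T y) (S y) n,
      wave_add y ((z : ℂ) • T y) n, wave_smul (z : ℂ) (T y) n] with K k1 k2 k3 k4 k5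
    rw [k3, Pi.sub_apply, k4, Pi.add_apply, k5, Pi.smul_apply, k2, k1]
    convert (hR _ (hlt n K)).1 (wave y n K) using 2
    rw [smul_apply, Complex.ofReal_sub, sub_smul]
    abel
  · filter_upwards [hT y n, hS y n] with K k1 k2
    rw [k1, k2, smul_apply]

end Free

/-! ### Splitting off one momentum -/

section Cons

theorem measurePreserving_cons (n : ℕ) :
    MeasurePreserving (fun p : R3 × (Fin n → R3) => (Fin.cons p.1 p.2 : Fin (n + 1) → R3))
      (volume.prod volume) volume := by
  have h1 := (volume_preserving_piFinSuccAbove (fun _ : Fin (n + 1) => R3) 0).symm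
  have h2 : (fun p : R3 × (Fin n → R3) => (Fin.cons p.1 p.2 : Fin (n + 1) → R3)) =
      (MeasurableEquiv.piFinSuccAbove (fun _ : Fin (n + 1) => R3) 0).symm := by
    funext p
    simp [MeasurableEquiv.piFinSuccAbove, Fin.insertNthEquiv, Fin.insertNth_zero']
  rw [h2]
  exact h1

theorem measurePreserving_snoc_cons (n : ℕ) :
    MeasurePreserving (fun p : (Fin n → R3) × R3 => (Fin.cons p.2 p.1 : Fin (n + 1) → R3))
      (volume.prod volume) volume :=
  (measurePreserving_cons n).comp Measure.measurePreserving_swap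

theorem measurePreserving_extract {n : ℕ} (i : Fin (n + 1)) :
    MeasurePreserving (fun X : Fin (n + 1) → R3 => (X i, fun j => X (i.succAbove j)))
      volume (volume.prod volume) :=
  volume_preserving_piFinSuccAbove (fun _ : Fin (n + 1) => R3) i

theorem quasiMeasurePreserving_eval {n : ℕ} (i : Fin (n + 1)) :
    Measure.QuasiMeasurePreserving (fun X : Fin (n + 1) → R3 => X i) volume volume :=
  Measure.quasiMeasurePreserving_fst.comp (measurePreserving_extract i).quasiMeasurePreserving

theorem quasiMeasurePreserving_remove {n : ℕ} (i : Fin (n + 1)) :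
    Measure.QuasiMeasurePreserving
      (fun X : Fin (n + 1) → R3 => fun j => X (i.succAbove j)) volume volume :=
  Measure.quasiMeasurePreserving_snd.comp (measurePreserving_extract i).quasiMeasurePreserving

theorem ae_ae_cons' {n : ℕ} {p : (Fin (n + 1) → R3) → Prop} (h : ∀ᵐ X, p X) :
    ∀ᵐ k : R3, ∀ᵐ K : Fin n → R3, p (Fin.cons k K) :=
  Measure.ae_ae_of_ae_prod ((measurePreserving_cons n).quasiMeasurePreserving.ae h)

theorem lintegral_cons {n : ℕ} {F : (Fin (n + 1) → R3) → ENNReal} (hF : AEMeasurable F) :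
    ∫⁻ X, F X = ∫⁻ K : Fin n → R3, ∫⁻ k : R3, F (Fin.cons k K) := by
  have h1 := measurePreserving_snoc_cons n
  rw [← h1.map_eq] at hF ⊢
  rw [lintegral_map' hF h1.measurable.aemeasurable]
  exact lintegral_prod _ (hF.comp_aemeasurable h1.measurable.aemeasurable)

theorem lintegral_cons' {n : ℕ} {F : (Fin (n + 1) → R3) → ENNReal} (hF : AEMeasurable F) :
    ∫⁻ X, F X = ∫⁻ k : R3, ∫⁻ K : Fin n → R3, F (Fin.cons k K) := by
  have h1 := measurePreserving_cons n
  rw [← h1.map_eq] at hF ⊢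
  rw [lintegral_map' hF h1.measurable.aemeasurable]
  exact lintegral_prod _ (hF.comp_aemeasurable h1.measurable.aemeasurable)

theorem enorm_sqrt_sq (n : ℕ) : ‖((√((n : ℝ) + 1) : ℝ) : ℂ)‖ₑ ^ 2 = (n + 1 : ENNReal) := by
  rw [← ofReal_norm, Complex.norm_real, Real.norm_of_nonneg (Real.sqrt_nonneg _),
    ← ENNReal.ofReal_pow (Real.sqrt_nonneg _), Real.sq_sqrt (by positivity),
    ENNReal.ofReal_add (by positivity) (by positivity)]
  simp

theorem ae_ne_zero : ∀ᵐ k : R3, k ≠ 0 := by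
  rw [ae_iff]
  simp

theorem ae_aestronglyMeasurable_slice {F : Type*} [NormedAddCommGroup F] {n : ℕ}
    {h : (Fin (n + 1) → R3) → F}
    (hh : AEStronglyMeasurable h volume) :
    ∀ᵐ K : Fin n → R3, AEStronglyMeasurable (fun k : R3 => h (Fin.cons k K)) volume :=
  (hh.comp_measurePreserving (measurePreserving_snoc_cons n)).prodMk_left

theorem ae_aestronglyMeasurable_slice' {F : Type*} [NormedAddCommGroup F] {n : ℕ}
    {h : (Fin (n + 1) → R3) → F}
    (hh : AEStronglyMeasurable h volume) :
    ∀ᵐ k : R3, AEStronglyMeasurable (fun K : Fin n → R3 => h (Fin.cons k K)) volume :=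
  (hh.comp_measurePreserving (measurePreserving_cons n)).prodMk_left

theorem cons_perm {n : ℕ} (π : Equiv.Perm (Fin n)) (k : R3) (K : Fin n → R3) :
    (Fin.cons k (fun i => K (π i)) : Fin (n + 1) → R3) =
      fun j => (Fin.cons k K : Fin (n + 1) → R3) (Equiv.Perm.decomposeFin.symm (0, π) j) := by
  funext j
  refine Fin.cases ?_ (fun j => ?_) j
  · simp
  · simp

theorem lintegral_eval_mul_perm {F : Type*} [NormedAddCommGroup F] {n : ℕ} (w : R3 → ENNReal)
    {h : (Fin (n + 1) → R3) → F}
    (hsym : ∀ π : Equiv.Perm (Fin (n + 1)), (fun K => h (fun i => K (π i))) =ᵐ[volume] h)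
    (hh : AEStronglyMeasurable h volume) (hw : Measurable w)
    (i : Fin (n + 1)) :
    ∫⁻ X, w (X i) * ‖h X‖ₑ ^ 2 = ∫⁻ X, w (X 0) * ‖h X‖ₑ ^ 2 := by
  -- The inverse of `i.cycleRange` sends `0` to `i`.
  have h1 := measurePreserving_perm (i.cycleRange.symm)
  have hm : AEMeasurable (fun X : Fin (n + 1) → R3 => w (X 0) * ‖h X‖ₑ ^ 2) :=
    (hw.comp (measurable_pi_apply 0)).aemeasurable.mul (hh.enorm.pow_const 2)
  conv_rhs => rw [← h1.map_eq]
  rw [lintegral_map' (by rwa [h1.map_eq]) h1.measurable.aemeasurable]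
  refine lintegral_congr_ae ?_
  filter_upwards [hsym i.cycleRange.symm] with X hX
  rw [hX]
  simp

/-- The field energy of a symmetric `(n+1)`-photon function is `n+1` times the energy of one
photon. -/
theorem lintegral_sum_norm_mul {F : Type*} [NormedAddCommGroup F] {n : ℕ}
    {h : (Fin (n + 1) → R3) → F}
    (hsym : ∀ π : Equiv.Perm (Fin (n + 1)), (fun K => h (fun i => K (π i))) =ᵐ[volume] h)
    (hh : AEStronglyMeasurable h volume) :
    ∫⁻ X, ENNReal.ofReal (∑ i, ‖X i‖) * ‖h X‖ₑ ^ 2 =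
      (n + 1 : ENNReal) * ∫⁻ X, ‖X 0‖ₑ * ‖h X‖ₑ ^ 2 := by
  have h1 : ∀ X : Fin (n + 1) → R3, ENNReal.ofReal (∑ i, ‖X i‖) * ‖h X‖ₑ ^ 2 =
      ∑ i, ‖X i‖ₑ * ‖h X‖ₑ ^ 2 := fun X => by
    rw [ENNReal.ofReal_sum_of_nonneg fun i _ => norm_nonneg _, Finset.sum_mul]
    simp only [ofReal_norm]
  simp_rw [h1]
  rw [lintegral_finsetSum' (f := fun i (X : Fin (n + 1) → R3) => ‖X i‖ₑ * ‖h X‖ₑ ^ 2) _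
    fun i _ => ((measurable_pi_apply i).enorm.aemeasurable).mul (hh.enorm.pow_const 2)]
  rw [Finset.sum_congr rfl fun i _ => lintegral_eval_mul_perm (fun k => ‖k‖ₑ) hsym hh
    measurable_enorm i]
  simp

theorem enorm_clm_apply_le {F : Type*} [NormedAddCommGroup F] [NormedSpace ℂ F]
    (T : F →L[ℂ] F) (x : F) : ‖T x‖ₑ ≤ ‖T‖ₑ * ‖x‖ₑ := by
  have h := T.le_opNorm x
  rw [← ofReal_norm, ← ofReal_norm, ← ofReal_norm, ← ENNReal.ofReal_mul (norm_nonneg _)]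
  exact ENNReal.ofReal_le_ofReal h

theorem sq_lintegral_mul_le {α : Type*} [MeasurableSpace α] {μ : Measure α} {f g : α → ENNReal}
    (hf : AEMeasurable f μ) (hg : AEMeasurable g μ) :
    (∫⁻ a, f a * g a ∂μ) ^ 2 ≤ (∫⁻ a, f a ^ 2 ∂μ) * ∫⁻ a, g a ^ 2 ∂μ := by
  have h := ENNReal.lintegral_mul_le_Lp_mul_Lq μ (p := 2) (q := 2)
    (by rw [Real.holderConjugate_iff]; norm_num) hf hg
  simp only [ENNReal.rpow_ofNat, Pi.mul_apply] at h
  calc (∫⁻ a, f a * g a ∂μ) ^ 2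
      ≤ ((∫⁻ a, f a ^ 2 ∂μ) ^ ((1 : ℝ) / 2) * (∫⁻ a, g a ^ 2 ∂μ) ^ ((1 : ℝ) / 2)) ^ 2 := by
        gcongr
    _ = (∫⁻ a, f a ^ 2 ∂μ) * ∫⁻ a, g a ^ 2 ∂μ := by
        rw [mul_pow, ← ENNReal.rpow_natCast, ← ENNReal.rpow_natCast, ← ENNReal.rpow_mul,
          ← ENNReal.rpow_mul]
        norm_num

/-- Cauchy-Schwarz after inserting `|k|^(-1/2) |k|^(1/2) = 1`, which fails only on the null set `k =
0`. -/
theorem sq_lintegral_mul_le_weight {f g : R3 → ENNReal}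
    (hf : AEMeasurable f) (hg : AEMeasurable g) :
    (∫⁻ k, f k * g k) ^ 2 ≤ (∫⁻ k, ‖k‖ₑ⁻¹ * f k ^ 2) * ∫⁻ k, ‖k‖ₑ * g k ^ 2 := by
  have h := sq_lintegral_mul_le (μ := (volume : Measure R3))
    (f := fun k => (‖k‖ₑ⁻¹) ^ ((1 : ℝ) / 2) * f k) (g := fun k => ‖k‖ₑ ^ ((1 : ℝ) / 2) * g k)
    ((measurable_enorm.inv.pow_const _).aemeasurable.mul hf)
    ((measurable_enorm.pow_const _).aemeasurable.mul hg)
  have hhalf : ∀ x : ENNReal, (x ^ ((1 : ℝ) / 2)) ^ 2 = x := fun x => by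
    rw [← ENNReal.rpow_natCast, ← ENNReal.rpow_mul]; norm_num
  simp only [mul_pow, hhalf] at h
  refine le_trans (le_of_eq ?_) h
  congr 1
  refine lintegral_congr_ae ?_
  filter_upwards [ae_ne_zero] with k hk
  have e : (‖k‖ₑ⁻¹) ^ ((1 : ℝ) / 2) * ‖k‖ₑ ^ ((1 : ℝ) / 2) = 1 := by
    rw [← ENNReal.mul_rpow_of_nonneg _ _ (by norm_num),
      ENNReal.inv_mul_cancel (by simpa using hk) enorm_ne_top, ENNReal.one_rpow]
  calc f k * g k = 1 * (f k * g k) := (one_mul _).symm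
    _ = _ := by rw [← e]; ring

end Cons

/-! ### The annihilation operator -/

section Annihilation

variable {𝔥 : Type*} [NormedAddCommGroup 𝔥] [InnerProductSpace ℂ 𝔥] [CompleteSpace 𝔥]
  {G : R3 → 𝔥 →L[ℂ] 𝔥}

/-- The action of the annihilation operator on `(n+1)`-photon functions. -/
def annFun (G : R3 → 𝔥 →L[ℂ] 𝔥) (n : ℕ) (h : (Fin (n + 1) → R3) → 𝔥) (K : Fin n → R3) : 𝔥 :=
  ((√((n : ℝ) + 1) : ℝ) : ℂ) • ∫ k : R3, (G k).adjoint (h (Fin.cons k K))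

/-- The squared weighted norm `∫ ‖G(k)‖² |k|⁻¹ dk`. -/
def couplingEnergy (G : R3 → 𝔥 →L[ℂ] 𝔥) : ENNReal := ∫⁻ k, ‖k‖ₑ⁻¹ * ‖G k‖ₑ ^ 2

/-- The squared norm `∫ ‖G(k)‖² dk`. -/
def couplingNorm (G : R3 → 𝔥 →L[ℂ] 𝔥) : ENNReal := ∫⁻ k, ‖G k‖ₑ ^ 2

theorem enorm_adjoint_apply_le (T : 𝔥 →L[ℂ] 𝔥) (x : 𝔥) : ‖T.adjoint x‖ₑ ≤ ‖T‖ₑ * ‖x‖ₑ := by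
  have h := T.adjoint.le_opNorm x
  rw [LinearIsometryEquiv.norm_map] at h
  rw [← ofReal_norm, ← ofReal_norm, ← ofReal_norm, ← ENNReal.ofReal_mul (norm_nonneg _)]
  exact ENNReal.ofReal_le_ofReal h

/-- The integrand in the definition of the annihilation operator is integrable. -/
theorem integrable_annihilation [TopologicalSpace.SeparableSpace 𝔥]
    (hG : ∀ x, AEStronglyMeasurable (fun k => G k x) volume)
    (hGn : AEMeasurable (fun k => ‖G k‖ₑ)) (h0 : couplingNorm G ≠ ⊤)
    {n : ℕ} {h : (Fin (n + 1) → R3) → 𝔥} (hh : MemLp h 2 volume) :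
    ∀ᵐ K : Fin n → R3, Integrable (fun k : R3 => (G k).adjoint (h (Fin.cons k K))) := by
  have h1 := lintegral_sq_ne_top_of_memLp hh
  have hm : AEMeasurable (fun X => ‖h X‖ₑ ^ 2) := hh.1.enorm.pow_const 2
  rw [lintegral_cons hm] at h1
  have h2 : AEMeasurable (fun K : Fin n → R3 => ∫⁻ k : R3, ‖h (Fin.cons k K)‖ₑ ^ 2) :=
    (hm.comp_quasiMeasurePreserving
      (measurePreserving_snoc_cons n).quasiMeasurePreserving).lintegral_prod_right'
  filter_upwards [ae_lt_top' h2 h1, ae_aestronglyMeasurable_slice hh.1] with K k1 k2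
  refine ⟨aestronglyMeasurable_adjoint_apply hG k2, ?_⟩
  calc ∫⁻ k, ‖(G k).adjoint (h (Fin.cons k K))‖ₑ
      ≤ ∫⁻ k, (‖G k‖ₑ ^ 2 + ‖h (Fin.cons k K)‖ₑ ^ 2) := by
        refine lintegral_mono fun k => (enorm_adjoint_apply_le _ _).trans ?_
        rcases le_total ‖G k‖ₑ ‖h (Fin.cons k K)‖ₑ with hc | hc
        · exact le_add_left ((mul_le_mul_left hc _).trans_eq (sq _).symm)
        · exact le_add_right ((mul_le_mul_right hc _).trans_eq (sq _).symm)
    _ = couplingNorm G + ∫⁻ k, ‖h (Fin.cons k K)‖ₑ ^ 2 := lintegral_add_left' (hGn.pow_const 2) _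
    _ < ⊤ := ENNReal.add_lt_top.2 ⟨h0.lt_top, k1⟩

theorem annFun_aestronglyMeasurable [TopologicalSpace.SeparableSpace 𝔥]
    (hG : ∀ x, AEStronglyMeasurable (fun k => G k x) volume)
    {n : ℕ} {h : (Fin (n + 1) → R3) → 𝔥} (hh : AEStronglyMeasurable h volume) :
    AEStronglyMeasurable (annFun G n h) volume := by
  refine AEStronglyMeasurable.const_smul ?_ _
  refine AEStronglyMeasurable.integral_prod_right'
    (f := fun p : (Fin n → R3) × R3 => (G p.2).adjoint (h (Fin.cons p.2 p.1))) ?_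
  exact aestronglyMeasurable_adjoint_apply (F := fun p : (Fin n → R3) × R3 => G p.2)
    (fun x => (hG x).comp_quasiMeasurePreserving Measure.quasiMeasurePreserving_snd)
    (hh.comp_measurePreserving (measurePreserving_snoc_cons n))

theorem annFun_perm {n : ℕ} {h : (Fin (n + 1) → R3) → 𝔥}
    (hsym : ∀ π : Equiv.Perm (Fin (n + 1)), (fun K => h (fun i => K (π i))) =ᵐ[volume] h)
    (π : Equiv.Perm (Fin n)) :
    (fun K => annFun G n h (fun i => K (π i))) =ᵐ[volume] annFun G n h := by
  filter_upwards [ae_ae_cons (hsym (Equiv.Perm.decomposeFin.symm (0, π)))] with K hK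
  rw [annFun, annFun]
  congr 1
  refine integral_congr_ae ?_
  filter_upwards [hK] with k hk
  rw [cons_perm, hk]

/-- Weighted Cauchy-Schwarz in the annihilated momentum. The prefactor `n + 1` is exactly what turns
the energy of one photon into the total energy of a symmetric function. -/
theorem lintegral_annFun_le (hGn : AEMeasurable (fun k => ‖G k‖ₑ))
    {n : ℕ} {h : (Fin (n + 1) → R3) → 𝔥} (hh : AEStronglyMeasurable h volume)
    (hsym : ∀ π : Equiv.Perm (Fin (n + 1)), (fun K => h (fun i => K (π i))) =ᵐ[volume] h) :
    ∫⁻ K, ‖annFun G n h K‖ₑ ^ 2 ≤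
      couplingEnergy G * ∫⁻ X, ENNReal.ofReal (∑ i, ‖X i‖) * ‖h X‖ₑ ^ 2 := by
  have hm : AEMeasurable (fun X : Fin (n + 1) → R3 => ‖X 0‖ₑ * ‖h X‖ₑ ^ 2) :=
    ((measurable_pi_apply 0).enorm.aemeasurable).mul (hh.enorm.pow_const 2)
  rw [lintegral_sum_norm_mul hsym hh, lintegral_cons hm]
  have hm2 : AEMeasurable (fun K : Fin n → R3 => ∫⁻ k : R3, ‖k‖ₑ * ‖h (Fin.cons k K)‖ₑ ^ 2) := by
    have := (hm.comp_quasiMeasurePreserving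
      (measurePreserving_snoc_cons n).quasiMeasurePreserving).lintegral_prod_right'
    simpa using this
  simp only [Fin.cons_zero]
  rw [← mul_assoc, ← lintegral_const_mul'' _ hm2]
  refine lintegral_mono_ae ?_
  filter_upwards [ae_aestronglyMeasurable_slice hh] with K hK
  rw [annFun, enorm_smul, mul_pow, enorm_sqrt_sq]
  calc (n + 1 : ENNReal) * ‖∫ k, (G k).adjoint (h (Fin.cons k K))‖ₑ ^ 2
      ≤ (n + 1 : ENNReal) * (∫⁻ k, ‖G k‖ₑ * ‖h (Fin.cons k K)‖ₑ) ^ 2 := by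
        gcongr
        refine (enorm_integral_le_lintegral_enorm _).trans (lintegral_mono fun k => ?_)
        exact enorm_adjoint_apply_le _ _
    _ ≤ (n + 1 : ENNReal) * (couplingEnergy G * ∫⁻ k, ‖k‖ₑ * ‖h (Fin.cons k K)‖ₑ ^ 2) := by
        gcongr
        exact sq_lintegral_mul_le_weight hGn hK.enorm
    _ = _ := by ring

/-- The annihilation operator is bounded by the square root of the field energy. -/
theorem exists_annihilation [TopologicalSpace.SeparableSpace 𝔥]
    (hG : ∀ x, AEStronglyMeasurable (fun k => G k x) volume)
    (hGn : AEMeasurable (fun k => ‖G k‖ₑ)) (h0 : couplingNorm G ≠ ⊤) (h1 : couplingEnergy G ≠ ⊤)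
    {ψ : Fock 𝔥} (hψ : fieldEnergy ψ ≠ ⊤) :
    ∃ χ, (ψ, χ) ∈ annihilationGraph G ∧
      ENNReal.ofReal (‖χ‖ ^ 2) ≤ couplingEnergy G * fieldEnergy ψ := by
  have hsum : ∑' n, ∫⁻ K, ‖annFun G n (wave ψ (n + 1)) K‖ₑ ^ 2 ≤
      couplingEnergy G * fieldEnergy ψ := by
    calc ∑' n, ∫⁻ K, ‖annFun G n (wave ψ (n + 1)) K‖ₑ ^ 2
        ≤ ∑' n, couplingEnergy G *
          ∫⁻ X, ENNReal.ofReal (∑ i, ‖X i‖) * ‖wave ψ (n + 1) X‖ₑ ^ 2 :=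
          ENNReal.tsum_le_tsum fun n =>
            lintegral_annFun_le hGn (wave_aestronglyMeasurable ψ _) (wave_perm ψ _)
      _ = couplingEnergy G *
          ∑' n, ∫⁻ X, ENNReal.ofReal (∑ i, ‖X i‖) * ‖wave ψ (n + 1) X‖ₑ ^ 2 :=
          ENNReal.tsum_mul_left
      _ ≤ couplingEnergy G * fieldEnergy ψ := by
          gcongr
          exact ENNReal.tsum_comp_le_tsum_of_injective (add_left_injective 1)
            (fun m => ∫⁻ X : Fin m → R3, ENNReal.ofReal (∑ i, ‖X i‖) * ‖wave ψ m X‖ₑ ^ 2)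
  obtain ⟨χ, hχ⟩ := exists_fock (fun n => annFun G n (wave ψ (n + 1)))
    (fun n => annFun_aestronglyMeasurable hG (wave_aestronglyMeasurable ψ _))
    (fun n π => annFun_perm (wave_perm ψ _) π)
    (ne_top_of_le_ne_top (ENNReal.mul_ne_top h1 hψ) hsum)
  refine ⟨χ, fun n => ?_, ?_⟩
  · filter_upwards [hχ n, integrable_annihilation hG hGn h0 (wave_memLp ψ (n + 1))] with K k1 k2
    exact ⟨k2, k1⟩
  · rw [ofReal_norm_sq]
    refine le_trans (le_of_eq ?_) hsum
    refine tsum_congr fun n => lintegral_congr_ae ?_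
    filter_upwards [hχ n] with K hK
    rw [hK]

end Annihilation

/-! ### The creation operator -/

section Creation

variable {𝔥 : Type*} [NormedAddCommGroup 𝔥] [InnerProductSpace ℂ 𝔥] {G : R3 → 𝔥 →L[ℂ] 𝔥}

/-- The term of the creation operator in which the `i`-th photon is created. -/
def creTerm (G : R3 → 𝔥 →L[ℂ] 𝔥) {n : ℕ} (f : (Fin n → R3) → 𝔥) (i : Fin (n + 1))
    (X : Fin (n + 1) → R3) : 𝔥 :=
  G (X i) (f (fun j => X (i.succAbove j)))

/-- The action of the creation operator on `n`-photon functions. -/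
def creFun (G : R3 → 𝔥 →L[ℂ] 𝔥) (n : ℕ) (f : (Fin n → R3) → 𝔥) (X : Fin (n + 1) → R3) : 𝔥 :=
  (((√((n : ℝ) + 1))⁻¹ : ℝ) : ℂ) • ∑ i, creTerm G f i X

/-- The action of the creation operator on families of functions. -/
def creFamily (G : R3 → 𝔥 →L[ℂ] 𝔥) (f : ∀ n, (Fin n → R3) → 𝔥) : ∀ n, (Fin n → R3) → 𝔥
  | 0 => 0
  | n + 1 => creFun G n (f n)

theorem creTerm_aestronglyMeasurable (hG : ∀ x, AEStronglyMeasurable (fun k => G k x) volume)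
    {n : ℕ} {f : (Fin n → R3) → 𝔥} (hf : AEStronglyMeasurable f volume) (i : Fin (n + 1)) :
    AEStronglyMeasurable (creTerm G f i) volume :=
  aestronglyMeasurable_clm_apply (F := fun X : Fin (n + 1) → R3 => G (X i))
    (fun x => (hG x).comp_quasiMeasurePreserving (quasiMeasurePreserving_eval i))
    (hf.comp_quasiMeasurePreserving (quasiMeasurePreserving_remove i))

theorem creFun_aestronglyMeasurable (hG : ∀ x, AEStronglyMeasurable (fun k => G k x) volume)
    {n : ℕ} {f : (Fin n → R3) → 𝔥} (hf : AEStronglyMeasurable f volume) :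
    AEStronglyMeasurable (creFun G n f) volume :=
  (Finset.aestronglyMeasurable_fun_sum _ fun i _ =>
    creTerm_aestronglyMeasurable hG hf i).const_smul _

/-- After deletion of one index, `σ` induces a permutation `τ` of the remaining ones. A symmetric
`f` absorbs `τ`, so permuting the momenta merely permutes the creation terms. -/
theorem exists_perm_succAbove {n : ℕ} (σ : Equiv.Perm (Fin (n + 1))) (i : Fin (n + 1)) :
    ∃ τ : Equiv.Perm (Fin n), ∀ j, σ (i.succAbove j) = (σ i).succAbove (τ j) := by
  have h : ∀ j, ∃ j', (σ i).succAbove j' = σ (i.succAbove j) := fun j =>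
    Fin.exists_succAbove_eq fun hc => Fin.succAbove_ne i j (σ.injective hc)
  choose t ht using h
  have hinj : Function.Injective t := fun a b hab => by
    have := ht a
    rw [hab, ht b] at this
    exact Fin.succAbove_right_injective (σ.injective this.symm)
  exact ⟨Equiv.ofBijective t (Finite.injective_iff_bijective.1 hinj), fun j => (ht j).symm⟩

theorem creFun_perm {n : ℕ} {f : (Fin n → R3) → 𝔥}
    (hsym : ∀ π : Equiv.Perm (Fin n), (fun K => f (fun i => K (π i))) =ᵐ[volume] f)
    (σ : Equiv.Perm (Fin (n + 1))) :
    (fun X => creFun G n f (fun i => X (σ i))) =ᵐ[volume] creFun G n f := by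
  have key : ∀ i, ∀ᵐ X : Fin (n + 1) → R3,
      creTerm G f i (fun j => X (σ j)) = creTerm G f (σ i) X := by
    intro i
    obtain ⟨τ, hτ⟩ := exists_perm_succAbove σ i
    filter_upwards [(quasiMeasurePreserving_remove (σ i)).ae (hsym τ)] with X hX
    simp only [creTerm, hτ]
    rw [hX]
  filter_upwards [ae_all_iff.2 key] with X hX
  rw [creFun, creFun]
  congr 1
  rw [← Equiv.sum_comp σ (fun i => creTerm G f i X)]
  exact Finset.sum_congr rfl fun i _ => hX i

theorem lintegral_creTerm (hGn : AEMeasurable (fun k => ‖G k‖ₑ))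
    {n : ℕ} {f : (Fin n → R3) → 𝔥} (hf : AEStronglyMeasurable f volume) (i : Fin (n + 1)) :
    ∫⁻ X, ‖creTerm G f i X‖ₑ ^ 2 ≤ couplingNorm G * ∫⁻ K, ‖f K‖ₑ ^ 2 := by
  have h1 := measurePreserving_extract i
  have hm : AEMeasurable (fun p : R3 × (Fin n → R3) => ‖G p.1‖ₑ ^ 2 * ‖f p.2‖ₑ ^ 2)
      (volume.prod volume) :=
    ((hGn.pow_const 2).comp_quasiMeasurePreserving Measure.quasiMeasurePreserving_fst).mul
      ((hf.enorm.pow_const 2).comp_quasiMeasurePreserving Measure.quasiMeasurePreserving_snd)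
  rw [couplingNorm, ← lintegral_prod_mul (hGn.pow_const 2) (hf.enorm.pow_const 2), ← h1.map_eq,
    lintegral_map' (by rwa [h1.map_eq]) h1.measurable.aemeasurable]
  refine lintegral_mono fun X => ?_
  rw [← mul_pow]
  gcongr
  exact enorm_clm_apply_le _ _

theorem creTerm_memLp (hG : ∀ x, AEStronglyMeasurable (fun k => G k x) volume)
    (hGn : AEMeasurable (fun k => ‖G k‖ₑ)) (h0 : couplingNorm G ≠ ⊤)
    {n : ℕ} {f : (Fin n → R3) → 𝔥} (hf : MemLp f 2 volume) (i : Fin (n + 1)) :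
    MemLp (creTerm G f i) 2 volume :=
  memLp_two_of_lintegral (creTerm_aestronglyMeasurable hG hf.1 i)
    (ne_top_of_le_ne_top (ENNReal.mul_ne_top h0 (lintegral_sq_ne_top_of_memLp hf))
      (lintegral_creTerm hGn hf.1 i))

theorem creFun_memLp (hG : ∀ x, AEStronglyMeasurable (fun k => G k x) volume)
    (hGn : AEMeasurable (fun k => ‖G k‖ₑ)) (h0 : couplingNorm G ≠ ⊤)
    {n : ℕ} {f : (Fin n → R3) → 𝔥} (hf : MemLp f 2 volume) :
    MemLp (creFun G n f) 2 volume :=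
  (memLp_finsetSum _ fun i _ => creTerm_memLp hG hGn h0 hf i).const_smul _

/-- Pointwise Cauchy-Schwarz estimate with the photon energies as weights. -/
theorem enorm_creFun_sq_le {n : ℕ} {f : (Fin n → R3) → 𝔥} {X : Fin (n + 1) → R3}
    (hX : ∀ i, X i ≠ 0) :
    ‖creFun G n f X‖ₑ ^ 2 ≤ (n + 1 : ENNReal)⁻¹ * ∑ i,
      ((‖X i‖ₑ + ENNReal.ofReal (∑ j, ‖X (i.succAbove j)‖)) *
        (‖X i‖ₑ⁻¹ * ‖G (X i)‖ₑ ^ 2 * ‖f (fun j => X (i.succAbove j))‖ₑ ^ 2)) := by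
  have hpos : ∀ i, 0 < ‖X i‖ := fun i => norm_pos_iff.2 (hX i)
  have hspos : 0 < ∑ i, ‖X i‖ := Finset.sum_pos (fun i _ => hpos i) Finset.univ_nonempty
  have hreal : ‖creFun G n f X‖ ^ 2 ≤ ((n : ℝ) + 1)⁻¹ * ∑ i, (∑ j, ‖X j‖) *
      (‖X i‖⁻¹ * ‖G (X i)‖ ^ 2 * ‖f (fun j => X (i.succAbove j))‖ ^ 2) := by
    have e1 : ‖creFun G n f X‖ ^ 2 = ((n : ℝ) + 1)⁻¹ * ‖∑ i, creTerm G f i X‖ ^ 2 := by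
      rw [creFun, norm_smul, mul_pow, Complex.norm_real, Real.norm_of_nonneg (by positivity),
        inv_pow, Real.sq_sqrt (by positivity)]
    rw [e1, ← Finset.mul_sum]
    gcongr
    have e2 : ‖∑ i, creTerm G f i X‖ ≤ ∑ i, ‖G (X i)‖ * ‖f (fun j => X (i.succAbove j))‖ :=
      (norm_sum_le _ _).trans (Finset.sum_le_sum fun i _ => (G (X i)).le_opNorm _)
    -- Cauchy-Schwarz in the form `(∑ aᵢ)² ≤ (∑ |Xᵢ|) ∑ aᵢ² / |Xᵢ|`. The total energy is afterwards
    -- split, in the `i`-th term, into `|Xᵢ|` and the energy of the other photons.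
    have e3 := Finset.sq_sum_div_le_sum_sq_div Finset.univ
      (fun i => ‖G (X i)‖ * ‖f (fun j => X (i.succAbove j))‖) (g := fun i => ‖X i‖)
      (fun i _ => hpos i)
    rw [div_le_iff₀ hspos] at e3
    calc ‖∑ i, creTerm G f i X‖ ^ 2
        ≤ (∑ i, ‖G (X i)‖ * ‖f (fun j => X (i.succAbove j))‖) ^ 2 := by gcongr
      _ ≤ _ := e3
      _ = _ := by
        rw [mul_comm]
        congr 1
        refine Finset.sum_congr rfl fun i _ => ?_
        rw [mul_pow, div_eq_inv_mul, mul_assoc]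
  rw [← ofReal_norm, ← ENNReal.ofReal_pow (norm_nonneg _)]
  refine (ENNReal.ofReal_le_ofReal hreal).trans (le_of_eq ?_)
  rw [ENNReal.ofReal_mul (by positivity), ENNReal.ofReal_inv_of_pos (by positivity),
    ENNReal.ofReal_add (by positivity) (by positivity), ENNReal.ofReal_natCast, ENNReal.ofReal_one,
    ENNReal.ofReal_sum_of_nonneg fun i _ => by positivity]
  congr 1
  refine Finset.sum_congr rfl fun i _ => ?_
  rw [Fin.sum_univ_succAbove _ i, ENNReal.ofReal_mul (by positivity),
    ENNReal.ofReal_add (by positivity) (by positivity), ENNReal.ofReal_mul (by positivity),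
    ENNReal.ofReal_mul (by positivity), ENNReal.ofReal_inv_of_pos (hpos i),
    ENNReal.ofReal_pow (by positivity), ENNReal.ofReal_pow (by positivity)]
  simp only [ofReal_norm]

/-- All `n + 1` terms have the same integral, which cancels `(n + 1)⁻¹`. The weight `(|k| + ω)
|k|⁻¹` splits into `1`, producing the norm of `G`, and `ω |k|⁻¹`, producing the field energy. No
commutator of `a(G)` with `a*(G)` is needed, which for operator-valued `G` has no simple form. -/
theorem lintegral_creFun_le (hGn : AEMeasurable (fun k => ‖G k‖ₑ))
    {n : ℕ} {f : (Fin n → R3) → 𝔥} (hf : AEStronglyMeasurable f volume) :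
    ∫⁻ X, ‖creFun G n f X‖ₑ ^ 2 ≤ couplingNorm G * (∫⁻ K, ‖f K‖ₑ ^ 2) +
      couplingEnergy G * ∫⁻ K, ENNReal.ofReal (∑ i, ‖K i‖) * ‖f K‖ₑ ^ 2 := by
  set Φ : R3 × (Fin n → R3) → ENNReal := fun p =>
    (‖p.1‖ₑ + ENNReal.ofReal (∑ j, ‖p.2 j‖)) * (‖p.1‖ₑ⁻¹ * ‖G p.1‖ₑ ^ 2 * ‖f p.2‖ₑ ^ 2) with hΦ
  have m1 : AEMeasurable (fun p : R3 × (Fin n → R3) => ‖G p.1‖ₑ ^ 2) (volume.prod volume) :=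
    (hGn.pow_const 2).comp_quasiMeasurePreserving Measure.quasiMeasurePreserving_fst
  have m2 : AEMeasurable (fun p : R3 × (Fin n → R3) => ‖f p.2‖ₑ ^ 2) (volume.prod volume) :=
    (hf.enorm.pow_const 2).comp_quasiMeasurePreserving Measure.quasiMeasurePreserving_snd
  have m3 : Measurable (fun K : Fin n → R3 => ENNReal.ofReal (∑ j, ‖K j‖)) := by fun_prop
  have mΦ : AEMeasurable Φ (volume.prod volume) :=
    (measurable_fst.enorm.add (m3.comp measurable_snd)).aemeasurable.mul
      ((measurable_fst.enorm.inv.aemeasurable.mul m1).mul m2)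
  have hne : ∀ᵐ X : Fin (n + 1) → R3, ∀ i, X i ≠ 0 :=
    ae_all_iff.2 fun i => (quasiMeasurePreserving_eval i).ae ae_ne_zero
  have hterm : ∀ i : Fin (n + 1), ∫⁻ X : Fin (n + 1) → R3, Φ (X i, fun j => X (i.succAbove j)) =
      ∫⁻ p, Φ p ∂(volume.prod volume) := fun i => by
    have h1 := measurePreserving_extract i
    rw [← h1.map_eq, lintegral_map' (by rwa [h1.map_eq]) h1.measurable.aemeasurable]
  have hΦint : ∫⁻ p, Φ p ∂(volume.prod volume) = couplingNorm G * (∫⁻ K, ‖f K‖ₑ ^ 2) +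
      couplingEnergy G * ∫⁻ K, ENNReal.ofReal (∑ i, ‖K i‖) * ‖f K‖ₑ ^ 2 := by
    rw [couplingNorm, couplingEnergy,
      ← lintegral_prod_mul (hGn.pow_const 2) (hf.enorm.pow_const 2),
      ← lintegral_prod_mul (f := fun k : R3 => ‖k‖ₑ⁻¹ * ‖G k‖ₑ ^ 2)
        (g := fun K : Fin n → R3 => ENNReal.ofReal (∑ i, ‖K i‖) * ‖f K‖ₑ ^ 2)
        (measurable_enorm.inv.aemeasurable.mul (hGn.pow_const 2))
        (m3.aemeasurable.mul (hf.enorm.pow_const 2)), ← lintegral_add_left'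
        (f := fun p : R3 × (Fin n → R3) => ‖G p.1‖ₑ ^ 2 * ‖f p.2‖ₑ ^ 2) (m1.mul m2)]
    refine lintegral_congr_ae ?_
    filter_upwards [Measure.quasiMeasurePreserving_fst.ae ae_ne_zero] with p hp
    have e : ‖p.1‖ₑ * ‖p.1‖ₑ⁻¹ = 1 := ENNReal.mul_inv_cancel (by simpa using hp) enorm_ne_top
    simp only [hΦ]
    rw [add_mul, ← mul_assoc, ← mul_assoc, e, one_mul]
    ring
  calc ∫⁻ X, ‖creFun G n f X‖ₑ ^ 2
      ≤ ∫⁻ X : Fin (n + 1) → R3, (n + 1 : ENNReal)⁻¹ * ∑ i, Φ (X i, fun j => X (i.succAbove j)) := by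
        refine lintegral_mono_ae ?_
        filter_upwards [hne] with X hX
        exact enorm_creFun_sq_le hX
    _ = (n + 1 : ENNReal)⁻¹ * ∑ i : Fin (n + 1), ∫⁻ p, Φ p ∂(volume.prod volume) := by
        have hm : ∀ i : Fin (n + 1), AEMeasurable
            (fun X : Fin (n + 1) → R3 => Φ (X i, fun j => X (i.succAbove j))) := fun i =>
          mΦ.comp_quasiMeasurePreserving (measurePreserving_extract i).quasiMeasurePreserving
        rw [lintegral_const_mul'' _ (Finset.aemeasurable_fun_sum _ fun i _ => hm i),
          lintegral_finsetSum' _ fun i _ => hm i]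
        simp only [hterm]
    _ = ∫⁻ p, Φ p ∂(volume.prod volume) := by
        rw [Finset.sum_const, Finset.card_univ, Fintype.card_fin, nsmul_eq_mul, ← mul_assoc]
        push_cast
        rw [ENNReal.inv_mul_cancel (by simp) (by finiteness), one_mul]
    _ = _ := hΦint

/-- The vector obtained by creating a photon. -/
theorem exists_creation_vector (hG : ∀ x, AEStronglyMeasurable (fun k => G k x) volume)
    (hGn : AEMeasurable (fun k => ‖G k‖ₑ)) (h0 : couplingNorm G ≠ ⊤) (h1 : couplingEnergy G ≠ ⊤)
    {ψ : Fock 𝔥} (hψ : fieldEnergy ψ ≠ ⊤) :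
    ∃ χ : Fock 𝔥, (∀ n, wave χ n =ᵐ[volume] creFamily G (wave ψ) n) ∧
      ENNReal.ofReal (‖χ‖ ^ 2) ≤
        couplingNorm G * ENNReal.ofReal (‖ψ‖ ^ 2) + couplingEnergy G * fieldEnergy ψ := by
  have hsum : ∑' n, ∫⁻ X, ‖creFamily G (wave ψ) n X‖ₑ ^ 2 ≤
      couplingNorm G * ENNReal.ofReal (‖ψ‖ ^ 2) + couplingEnergy G * fieldEnergy ψ := by
    rw [tsum_eq_zero_add' ENNReal.summable]
    simp only [creFamily, Pi.zero_apply, enorm_zero, ne_eq, OfNat.ofNat_ne_zero, not_false_eq_true,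
      zero_pow, lintegral_zero, zero_add]
    rw [ofReal_norm_sq, fieldEnergy, ← ENNReal.tsum_mul_left, ← ENNReal.tsum_mul_left,
      ← ENNReal.tsum_add]
    exact ENNReal.tsum_le_tsum fun n => lintegral_creFun_le hGn (wave_aestronglyMeasurable ψ n)
  obtain ⟨χ, hχ⟩ := exists_fock (creFamily G (wave ψ))
    (fun n => by
      cases n with
      | zero => exact aestronglyMeasurable_zero
      | succ n => exact creFun_aestronglyMeasurable hG (wave_aestronglyMeasurable ψ n))
    (fun n π => by
      cases n with
      | zero => exact Eventually.of_forall fun _ => rfl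
      | succ n => exact creFun_perm (wave_perm ψ n) π)
    (ne_top_of_le_ne_top (ENNReal.add_ne_top.2 ⟨ENNReal.mul_ne_top h0 ENNReal.ofReal_ne_top,
      ENNReal.mul_ne_top h1 hψ⟩) hsum)
  refine ⟨χ, hχ, ?_⟩
  rw [ofReal_norm_sq]
  refine le_trans (le_of_eq ?_) hsum
  refine tsum_congr fun n => lintegral_congr_ae ?_
  filter_upwards [hχ n] with K hK
  rw [hK]

variable [CompleteSpace 𝔥] [TopologicalSpace.SeparableSpace 𝔥]

/-- Creation and annihilation are adjoint to each other. -/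
theorem integral_inner_creFun (hG : ∀ x, AEStronglyMeasurable (fun k => G k x) volume)
    (hGn : AEMeasurable (fun k => ‖G k‖ₑ)) (h0 : couplingNorm G ≠ ⊤)
    {n : ℕ} {f : (Fin n → R3) → 𝔥} (hf : MemLp f 2 volume)
    {h : (Fin (n + 1) → R3) → 𝔥} (hh : MemLp h 2 volume)
    (hsym : ∀ π : Equiv.Perm (Fin (n + 1)), (fun K => h (fun i => K (π i))) =ᵐ[volume] h) :
    ∫ X, inner ℂ (creFun G n f X) (h X) = ∫ K, inner ℂ (f K) (annFun G n h K) := by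
  have hintegrable : ∀ i, Integrable (fun X => inner ℂ (creTerm G f i X) (h X)) := fun i =>
    integrable_inner_of_memLp (creTerm_memLp hG hGn h0 hf i) hh
  have hterm : ∀ i, ∫ X, inner ℂ (creTerm G f i X) (h X) =
      ∫ X, inner ℂ (creTerm G f 0 X) (h X) := by
    intro i
    -- This permutation takes `0` to `i` and `j.succ` to `i.succAbove j`, so it carries the creation
    -- term of index `0` to that of index `i`.
    have h1 := measurePreserving_perm (i.cycleRange.symm)
    conv_rhs => rw [← h1.map_eq]
    rw [integral_map h1.measurable.aemeasurable (by rw [h1.map_eq]; exact (hintegrable 0).1)]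
    refine integral_congr_ae ?_
    filter_upwards [hsym i.cycleRange.symm] with X hX
    rw [hX]
    congr 1
    simp [creTerm]
  have h2 := measurePreserving_snoc_cons n
  have hzero : ∫ X, inner ℂ (creTerm G f 0 X) (h X) =
      ∫ K, inner ℂ (f K) (∫ k : R3, (G k).adjoint (h (Fin.cons k K))) := by
    have hi := (h2.integrable_comp (hintegrable 0).1).2 (hintegrable 0)
    rw [← h2.map_eq, integral_map h2.measurable.aemeasurable
      (by rw [h2.map_eq]; exact (hintegrable 0).1)]
    refine (integral_prod _ hi).trans (integral_congr_ae ?_)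
    filter_upwards [integrable_annihilation hG hGn h0 hh] with K hK
    rw [← integral_inner hK]
    refine integral_congr_ae (Eventually.of_forall fun k => ?_)
    simp only [ContinuousLinearMap.adjoint_inner_right]
    simp [creTerm]
  have hs : (√((n : ℝ) + 1))⁻¹ * ((n : ℝ) + 1) = √((n : ℝ) + 1) := by
    have : (0 : ℝ) < √((n : ℝ) + 1) := Real.sqrt_pos.2 (by positivity)
    rw [inv_mul_eq_div, div_eq_iff this.ne', Real.mul_self_sqrt (by positivity)]
  calc ∫ X, inner ℂ (creFun G n f X) (h X)
      = ∫ X, (((√((n : ℝ) + 1))⁻¹ : ℝ) : ℂ) * ∑ i, inner ℂ (creTerm G f i X) (h X) := by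
        refine integral_congr_ae (Eventually.of_forall fun X => ?_)
        simp only [creFun, inner_smul_left, Complex.conj_ofReal, sum_inner]
    _ = (((√((n : ℝ) + 1))⁻¹ : ℝ) : ℂ) * ∑ i : Fin (n + 1),
          ∫ X, inner ℂ (creTerm G f 0 X) (h X) := by
        rw [integral_const_mul, integral_finsetSum _ fun i _ => hintegrable i]
        simp only [hterm]
    _ = ((√((n : ℝ) + 1) : ℝ) : ℂ) * ∫ X, inner ℂ (creTerm G f 0 X) (h X) := by
        rw [Finset.sum_const, Finset.card_univ, Fintype.card_fin, nsmul_eq_mul, ← mul_assoc]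
        congr 1
        conv_rhs => rw [← hs]
        push_cast
        ring
    _ = _ := by
        rw [hzero, ← integral_const_mul]
        refine integral_congr_ae (Eventually.of_forall fun K => ?_)
        simp only [annFun, inner_smul_right]

/-- The sums over photon numbers agree after a shift by one, since the created vector has no vacuum
component. Nothing is required of `ψ` beyond the created family being a Fock vector. -/
theorem inner_annihilation_eq (hG : ∀ x, AEStronglyMeasurable (fun k => G k x) volume)
    (hGn : AEMeasurable (fun k => ‖G k‖ₑ)) (h0 : couplingNorm G ≠ ⊤) {ψ χ η ζ : Fock 𝔥}
    (hχ : ∀ n, wave χ n =ᵐ[volume] creFamily G (wave ψ) n) (hη : (η, ζ) ∈ annihilationGraph G) :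
    inner ℂ ψ ζ = inner ℂ χ η := by
  refine (hasSum_inner_wave ψ ζ).unique ?_
  have h1 := hasSum_inner_wave χ η
  rw [← hasSum_nat_add_iff' 1] at h1
  have hzero : ∫ K, inner ℂ (wave χ 0 K) (wave η 0 K) = 0 := by
    refine integral_eq_zero_of_ae ?_
    filter_upwards [hχ 0] with K hK
    rw [hK]
    simp [creFamily]
  rw [Finset.sum_range_one, hzero, sub_zero] at h1
  have hcomp : ∀ n, ∫ K, inner ℂ (wave ψ n K) (wave ζ n K) =
      ∫ X, inner ℂ (wave χ (n + 1) X) (wave η (n + 1) X) := by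
    intro n
    calc ∫ K, inner ℂ (wave ψ n K) (wave ζ n K)
        = ∫ K, inner ℂ (wave ψ n K) (annFun G n (wave η (n + 1)) K) := by
          refine integral_congr_ae ?_
          filter_upwards [hη n] with K hK
          rw [hK.2]; rfl
      _ = ∫ X, inner ℂ (creFun G n (wave ψ n) X) (wave η (n + 1) X) :=
          (integral_inner_creFun hG hGn h0 (wave_memLp ψ n) (wave_memLp η (n + 1))
            (wave_perm η (n + 1))).symm
      _ = _ := by
          refine integral_congr_ae ?_
          filter_upwards [hχ (n + 1)] with K hK
          rw [hK]; rfl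
  have hfun : (fun n => ∫ K, inner ℂ (wave ψ n K) (wave ζ n K)) =
      fun n => ∫ X, inner ℂ (wave χ (n + 1) X) (wave η (n + 1) X) := by
    funext n
    exact hcomp n
  rw [hfun]
  exact h1

/-- On vectors of finite field energy the creation operator acts by the usual formula. -/
theorem mem_creation_graph (hG : ∀ x, AEStronglyMeasurable (fun k => G k x) volume)
    (hGn : AEMeasurable (fun k => ‖G k‖ₑ)) (h0 : couplingNorm G ≠ ⊤)
    (hdense : Dense ((annihilation G).domain : Set (Fock 𝔥))) {ψ χ : Fock 𝔥}
    (hχ : ∀ n, wave χ n =ᵐ[volume] creFamily G (wave ψ) n) : (ψ, χ) ∈ (creation G).graph := by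
  rw [creation, LinearPMap.adjoint_graph_eq_graph_adjoint hdense, Submodule.mem_adjoint_iff]
  intro η ζ hη
  rw [annihilation_graph] at hη
  rw [sub_eq_zero]
  rw [← inner_conj_symm, ← inner_conj_symm η, inner_annihilation_eq hG hGn h0 hχ hη]

end Creation

/-! ### The interacting Hamiltonian -/

theorem exists_add_eq_of_norm_le {E : Type*} [NormedAddCommGroup E] [NormedSpace ℂ E]
    [CompleteSpace E] (W : E →L[ℂ] E) (hW : ∀ y, ‖W y‖ ≤ 1 / 2 * ‖y‖) (y : E) :
    ∃ w, w + W w = y := by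
  have hWn : ‖-W‖ < 1 := by
    rw [norm_neg]
    exact (W.opNorm_le_bound (by norm_num) hW).trans_lt (by norm_num)
  obtain ⟨u, hu⟩ := isUnit_one_sub_of_norm_lt_one hWn
  rw [sub_neg_eq_add] at hu
  refine ⟨(↑u⁻¹ : E →L[ℂ] E) y, ?_⟩
  have : (1 + W) ((↑u⁻¹ : E →L[ℂ] E) y) = y := by
    rw [← hu, ← mul_apply_eq_comp, Units.mul_inv, one_apply_eq_self]
  simpa using this

/-! ### Vectors of the form `x ⊗ Ω`. -/

section Vacuum

variable {𝔥 : Type*} [NormedAddCommGroup 𝔥] [InnerProductSpace ℂ 𝔥]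

theorem wave_tensorVacuum_zero (x : 𝔥) : wave (tensorVacuum x) 0 =ᵐ[volume] fun _ => x := by
  have h : wave (tensorVacuum x) 0 =
      indicatorConstLp (μ := (volume : Measure (Fin 0 → R3))) 2 MeasurableSet.univ
        volume_univ_zero x := by
    rw [wave, tensorVacuum, lp.single_apply_self]
  rw [h]
  filter_upwards [indicatorConstLp_coeFn (p := 2) (s := Set.univ) (hs := MeasurableSet.univ)
    (hμs := volume_univ_zero) (c := x)] with K hK
  rw [hK]
  simp

theorem wave_tensorVacuum_succ (x : 𝔥) (n : ℕ) :
    wave (tensorVacuum x) (n + 1) =ᵐ[volume] 0 := by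
  have h : (tensorVacuum x) (n + 1) = 0 := by
    rw [tensorVacuum, lp.single_apply_ne _ _ _ (Nat.succ_ne_zero n)]
  rw [wave, h]
  exact Lp.coeFn_zero _ _ _

theorem volume_univ_fin_zero : volume (Set.univ : Set (Fin 0 → R3)) = 1 := by
  simp [volume_pi]

theorem integral_fin_zero {F : Type*} [NormedAddCommGroup F] [NormedSpace ℝ F] [CompleteSpace F]
    (f : (Fin 0 → R3) → F) : ∫ K, f K = f default := by
  have h : f = fun _ => f default := funext fun K => congrArg f (Subsingleton.elim _ _)
  rw [h, integral_const, measureReal_def, volume_univ_fin_zero]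
  simp

/-- The space `(ℝ³)⁰` is one point of mass one, so the zero-photon component may be treated as the
honest vector `wave ψ 0 default`. -/
theorem ae_fin_zero {p : (Fin 0 → R3) → Prop} (h : ∀ᵐ K, p K) : p default := by
  have : NeZero (volume : Measure (Fin 0 → R3)) := ⟨fun h0 => by
    have := volume_univ_fin_zero
    rw [h0] at this
    simp at this⟩
  obtain ⟨K, hK⟩ := h.exists
  rwa [Subsingleton.elim default K]

theorem wave_tensorVacuum_default (x : 𝔥) : wave (tensorVacuum x) 0 default = x :=
  ae_fin_zero (wave_tensorVacuum_zero x)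

/-- The scalar product with `x ⊗ Ω` only depends on the component without photons. -/
theorem inner_tensorVacuum (x : 𝔥) (ψ : Fock 𝔥) :
    inner ℂ (tensorVacuum x) ψ = inner ℂ x (wave ψ 0 default) := by
  refine (hasSum_inner_wave (tensorVacuum x) ψ).unique ?_
  have h0 : ∫ K, inner ℂ (wave (tensorVacuum x) 0 K) (wave ψ 0 K) =
      inner ℂ x (wave ψ 0 default) := by
    rw [integral_fin_zero, wave_tensorVacuum_default]
  rw [← h0]
  refine hasSum_single 0 fun n hn => ?_
  obtain ⟨m, rfl⟩ := Nat.exists_eq_succ_of_ne_zero hn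
  refine integral_eq_zero_of_ae ?_
  filter_upwards [wave_tensorVacuum_succ x m] with K hK
  rw [hK]
  simp

theorem norm_tensorVacuum (x : 𝔥) : ‖tensorVacuum x‖ = ‖x‖ := by
  have h : ‖tensorVacuum x‖ ^ 2 = ‖x‖ ^ 2 := by
    rw [← inner_self_re, inner_tensorVacuum, wave_tensorVacuum_default, inner_self_re]
  exact (sq_eq_sq₀ (norm_nonneg _) (norm_nonneg _)).1 h

theorem tensorVacuum_mem_free {Hat : 𝔥 →ₗ.[ℂ] 𝔥} {x y : 𝔥} (h : (x, y) ∈ Hat.graph) :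
    (tensorVacuum x, tensorVacuum y) ∈ (freeHamiltonian Hat).graph := by
  refine mem_graph_freeHamiltonian.2 ⟨tensorVacuum y, 0, fun n => ?_, fun n => ?_,
    (add_zero _).symm⟩
  · cases n with
    | zero =>
      filter_upwards [wave_tensorVacuum_zero x, wave_tensorVacuum_zero y] with K h1 h2
      rwa [h1, h2]
    | succ n =>
      filter_upwards [wave_tensorVacuum_succ x n, wave_tensorVacuum_succ y n] with K h1 h2
      rw [h1, h2]
      exact Hat.graph.zero_mem
  · cases n with
    | zero =>
      filter_upwards [wave_zero (𝔥 := 𝔥) 0] with K h1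
      rw [h1]
      simp
    | succ n =>
      filter_upwards [wave_tensorVacuum_succ x n, wave_zero (𝔥 := 𝔥) (n + 1)] with K h1 h2
      rw [h1, h2]
      simp

variable [CompleteSpace 𝔥]

theorem tensorVacuum_mem_annihilation (G : R3 → 𝔥 →L[ℂ] 𝔥) (x : 𝔥) :
    (tensorVacuum x, 0) ∈ annihilationGraph G := by
  intro n
  have h0 := ((annihilationGraph G).zero_mem : _) n
  filter_upwards [h0, ae_ae_cons (wave_tensorVacuum_succ x n),
    ae_ae_cons (wave_zero (𝔥 := 𝔥) (n + 1))] with K h1 h2 h3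
  have e : (fun k : R3 => (G k).adjoint (wave (tensorVacuum x) (n + 1) (Fin.cons k K)))
      =ᵐ[volume] fun k => (G k).adjoint (wave (0 : Fock 𝔥) (n + 1) (Fin.cons k K)) := by
    filter_upwards [h2, h3] with k k1 k2
    rw [k1, k2]
  refine ⟨h1.1.congr e.symm, ?_⟩
  rw [integral_congr_ae e]
  exact h1.2

end Vacuum

section Hamiltonian

variable {𝔥 : Type*} [NormedAddCommGroup 𝔥] [InnerProductSpace ℂ 𝔥] [CompleteSpace 𝔥]
  {Hat : 𝔥 →ₗ.[ℂ] 𝔥} {e : ℝ} {G : R3 → 𝔥 →L[ℂ] 𝔥}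

/-- The standing assumptions: `Hat` is self-adjoint and bounded below by `e`, and the coupling
satisfies `∫ ‖G(k)‖² (1 + |k|⁻¹) dk < ∞`. -/
structure Admissible (Hat : 𝔥 →ₗ.[ℂ] 𝔥) (e : ℝ) (G : R3 → 𝔥 →L[ℂ] 𝔥) : Prop where
  symmetric : SymmetricOp Hat
  formBound : FormBound Hat e
  surjective : ∀ z < e, ShiftSurjective Hat z
  measurable : ∀ x, AEStronglyMeasurable (fun k => G k x) volume
  measurable_norm : AEMeasurable (fun k => ‖G k‖ₑ)
  norm_ne_top : couplingNorm G ≠ ⊤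
  energy_ne_top : couplingEnergy G ≠ ⊤

/-- `(ψ, α + β)` describes the action of the field operator on `ψ`: `α` is the annihilation part
and `β` the creation part. -/
structure FieldAction (G : R3 → 𝔥 →L[ℂ] 𝔥) (ψ α β : Fock 𝔥) : Prop where
  ann : (ψ, α) ∈ annihilationGraph G
  cre : ∀ n, wave β n =ᵐ[volume] creFamily G (wave ψ) n

variable [TopologicalSpace.SeparableSpace 𝔥]

/-- The domain of `a(G)` contains the dense domain of the free Hamiltonian. Density ensures that
`creation G` is a genuine adjoint and not a default value. -/
theorem Admissible.dense_annihilation (S : Admissible Hat e G) :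
    Dense ((annihilation G).domain : Set (Fock 𝔥)) := by
  have h1 : Dense ((freeHamiltonian Hat).domain : Set (Fock 𝔥)) :=
    (freeHamiltonian_shiftSurjective S.formBound S.surjective (sub_one_lt e)).dense_domain
      (freeHamiltonian_symmetric S.symmetric)
  refine h1.mono fun ψ hψ => ?_
  obtain ⟨χ, hχ⟩ := LinearPMap.mem_domain_iff.1 hψ
  obtain ⟨α, hα, -⟩ := exists_annihilation S.measurable S.measurable_norm S.norm_ne_top
    S.energy_ne_top (fieldEnergy_ne_top_of_mem hχ)
  rw [← annihilation_graph] at hα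
  exact LinearPMap.mem_domain_of_mem_graph hα

theorem FieldAction.mem_graph (S : Admissible Hat e G) {ψ α β : Fock 𝔥} (h : FieldAction G ψ α β) :
    (ψ, α + β) ∈ (fieldOperator G).graph := by
  refine LinearPMap.le_graph_of_le (LinearPMap.le_closure _) ?_
  refine mem_graph_add.2 ⟨α, β, ?_, ?_, rfl⟩
  · rw [annihilation_graph]
    exact h.ann
  · exact mem_creation_graph S.measurable S.measurable_norm S.norm_ne_top S.dense_annihilation h.cre

theorem Admissible.exists_fieldAction (S : Admissible Hat e G) {ψ : Fock 𝔥}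
    (hψ : fieldEnergy ψ ≠ ⊤) : ∃ α β, FieldAction G ψ α β ∧
      ‖α‖ ^ 2 ≤ (couplingEnergy G).toReal * (fieldEnergy ψ).toReal ∧
      ‖β‖ ^ 2 ≤ (couplingNorm G).toReal * ‖ψ‖ ^ 2 +
        (couplingEnergy G).toReal * (fieldEnergy ψ).toReal := by
  obtain ⟨α, hα, hα'⟩ := exists_annihilation S.measurable S.measurable_norm S.norm_ne_top
    S.energy_ne_top hψ
  obtain ⟨β, hβ, hβ'⟩ := exists_creation_vector S.measurable S.measurable_norm S.norm_ne_top
    S.energy_ne_top hψ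
  refine ⟨α, β, ⟨hα, hβ⟩, ?_, ?_⟩
  · have h1 := ENNReal.toReal_mono (ENNReal.mul_ne_top S.energy_ne_top hψ) hα'
    rwa [ENNReal.toReal_ofReal (by positivity), ENNReal.toReal_mul] at h1
  · have h1 := ENNReal.toReal_mono (ENNReal.add_ne_top.2
      ⟨ENNReal.mul_ne_top S.norm_ne_top ENNReal.ofReal_ne_top,
        ENNReal.mul_ne_top S.energy_ne_top hψ⟩) hβ'
    rwa [ENNReal.toReal_ofReal (by positivity), ENNReal.toReal_add
      (ENNReal.mul_ne_top S.norm_ne_top ENNReal.ofReal_ne_top)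
      (ENNReal.mul_ne_top S.energy_ne_top hψ), ENNReal.toReal_mul, ENNReal.toReal_mul,
      ENNReal.toReal_ofReal (by positivity)] at h1

/-- The Hamiltonian is defined on the domain of the free Hamiltonian. -/
theorem Admissible.mem_graph_hamiltonian (S : Admissible Hat e G) {lam : ℝ} {ψ χ : Fock 𝔥} :
    (ψ, χ) ∈ (hamiltonian Hat G lam).graph ↔ ∃ χ₀ α β, (ψ, χ₀) ∈ (freeHamiltonian Hat).graph ∧
      FieldAction G ψ α β ∧ ‖α‖ ^ 2 ≤ (couplingEnergy G).toReal * (fieldEnergy ψ).toReal ∧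
      χ = χ₀ + (lam : ℂ) • (α + β) := by
  constructor
  · intro h
    obtain ⟨χ₀, γ, h1, h2, rfl⟩ := mem_graph_add.1 h
    obtain ⟨γ', h3, rfl⟩ := mem_graph_smul.1 h2
    have h4 : (ψ, χ₀) ∈ (freeHamiltonian Hat).graph := h1
    obtain ⟨α, β, h5, h6, -⟩ := S.exists_fieldAction (fieldEnergy_ne_top_of_mem h4)
    refine ⟨χ₀, α, β, h4, h5, h6, ?_⟩
    -- The closure is still a function, so on vectors of finite field energy it must act by the
    -- explicit formulas.
    rw [LinearPMap.mem_graph_snd_inj _ h3 (h5.mem_graph S) rfl]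
  · rintro ⟨χ₀, α, β, h1, h2, -, rfl⟩
    exact mem_graph_add.2 ⟨χ₀, _, h1, mem_graph_smul.2 ⟨_, h2.mem_graph S, rfl⟩, rfl⟩

theorem FieldAction.inner_ann (S : Admissible Hat e G) {ψ α β ψ' α' β' : Fock 𝔥}
    (h : FieldAction G ψ α β) (h' : FieldAction G ψ' α' β') :
    inner ℂ ψ α' = inner ℂ β ψ' :=
  inner_annihilation_eq S.measurable S.measurable_norm S.norm_ne_top h.cre h'.ann

theorem Admissible.symmetric_hamiltonian (S : Admissible Hat e G) (lam : ℝ) :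
    SymmetricOp (hamiltonian Hat G lam) := by
  intro ψ χ ψ' χ' h h'
  obtain ⟨χ₀, α, β, h1, h2, -, rfl⟩ := S.mem_graph_hamiltonian.1 h
  obtain ⟨χ₀', α', β', h1', h2', -, rfl⟩ := S.mem_graph_hamiltonian.1 h'
  have e1 := freeHamiltonian_symmetric S.symmetric h1 h1'
  have e2 : inner ℂ β ψ' = inner ℂ ψ α' := (h2.inner_ann S h2').symm
  have e3 : inner ℂ α ψ' = inner ℂ ψ β' := by
    rw [← inner_conj_symm, h2'.inner_ann S h2, inner_conj_symm]
  simp only [inner_add_left, inner_add_right, inner_smul_left, inner_smul_right,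
    Complex.conj_ofReal, e1, e2, e3]
  ring

/-- The interaction contributes `2 λ Re⟨ψ, a(G)ψ⟩`, at most `2 |λ| ‖ψ‖ √(c q) ≤ q + λ² c ‖ψ‖²` in
modulus, and the free form contains a spare `q`. -/
theorem Admissible.formBound_hamiltonian (S : Admissible Hat e G) (lam : ℝ) :
    FormBound (hamiltonian Hat G lam) (e - lam ^ 2 * (couplingEnergy G).toReal) := by
  intro ψ χ h
  obtain ⟨χ₀, α, β, h1, h2, h3, rfl⟩ := S.mem_graph_hamiltonian.1 h
  set c := (couplingEnergy G).toReal with hc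
  set q := (fieldEnergy ψ).toReal with hq
  have hc0 : 0 ≤ c := ENNReal.toReal_nonneg
  have hq0 : 0 ≤ q := ENNReal.toReal_nonneg
  have e1 : e * ‖ψ‖ ^ 2 + q ≤ (inner ℂ ψ χ₀).re := freeHamiltonian_formBound_add S.formBound h1
  have e2 : (inner ℂ ψ β).re = (inner ℂ ψ α).re := by
    rw [h2.inner_ann S h2]
    exact inner_re_symm (𝕜 := ℂ) _ _
  have e3 : |(inner ℂ ψ α).re| ≤ ‖ψ‖ * ‖α‖ :=
    (Complex.abs_re_le_norm _).trans (norm_inner_le_norm _ _)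
  have e4 : |2 * lam * (inner ℂ ψ α).re| ≤ q + lam ^ 2 * c * ‖ψ‖ ^ 2 := by
    refine abs_le_of_sq_le_sq ?_ (by positivity)
    have e5 : (inner ℂ ψ α).re ^ 2 ≤ ‖ψ‖ ^ 2 * (c * q) := by
      calc (inner ℂ ψ α).re ^ 2 = |(inner ℂ ψ α).re| ^ 2 := (sq_abs _).symm
        _ ≤ (‖ψ‖ * ‖α‖) ^ 2 := by gcongr
        _ = ‖ψ‖ ^ 2 * ‖α‖ ^ 2 := mul_pow _ _ _
        _ ≤ _ := by gcongr
    have e6 : (2 * lam * (inner ℂ ψ α).re) ^ 2 ≤ 4 * lam ^ 2 * (‖ψ‖ ^ 2 * (c * q)) := by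
      calc (2 * lam * (inner ℂ ψ α).re) ^ 2 = 4 * lam ^ 2 * (inner ℂ ψ α).re ^ 2 := by ring
        _ ≤ _ := by gcongr
    nlinarith [sq_nonneg (q - lam ^ 2 * c * ‖ψ‖ ^ 2)]
  rw [inner_add_right, inner_smul_right, inner_add_right, Complex.add_re, Complex.re_ofReal_mul,
    Complex.add_re, e2]
  have e7 := neg_le_of_abs_le e4
  linarith

/-- With `R` the free resolvent at `e - μ`, the range of `1 + λ φ(G) R` is contained in that of
`H(λ) - (e - μ)`. For large `μ` the perturbation has norm at most `1/2`, and a Neumann series gives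
surjectivity. -/
theorem Admissible.exists_shiftSurjective (S : Admissible Hat e G) (lam : ℝ) :
    ∃ z < e - lam ^ 2 * (couplingEnergy G).toReal,
      ShiftSurjective (hamiltonian Hat G lam) z := by
  set c := (couplingEnergy G).toReal with hc
  set d := (couplingNorm G).toReal with hd
  have hc0 : 0 ≤ c := ENNReal.toReal_nonneg
  have hd0 : 0 ≤ d := ENNReal.toReal_nonneg
  -- The estimates below give `‖λ φ(G) R y‖² ≤ 2 λ² (2 c + d) μ⁻¹ ‖y‖²`, and `8` makes this at most
  -- `‖y‖² / 4`. The summand `1` keeps `μ` positive and `e - μ` strictly below the form bound.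
  set μ : ℝ := 8 * lam ^ 2 * (2 * c + d) + 1 with hμ
  have hμ1 : 1 ≤ μ := by
    rw [hμ]
    nlinarith [mul_nonneg (sq_nonneg lam) hc0, mul_nonneg (sq_nonneg lam) hd0]
  have hμ0 : 0 < μ := by linarith
  have hze : e - μ < e := by linarith
  refine ⟨e - μ, ?_, ?_⟩
  · rw [hμ]
    nlinarith [mul_nonneg (sq_nonneg lam) hc0, mul_nonneg (sq_nonneg lam) hd0]
  obtain ⟨R, hR1, hR2⟩ := (freeHamiltonian_shiftSurjective S.formBound S.surjective
    hze).exists_resolvent (freeHamiltonian_formBound S.formBound) hze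
  have hdom : ∀ y, R y ∈ (fieldOperator G).domain := fun y => by
    obtain ⟨α, β, h, -⟩ := S.exists_fieldAction (fieldEnergy_ne_top_of_mem (hR1 y))
    exact LinearPMap.mem_domain_of_mem_graph (h.mem_graph S)
  let W₀ : Fock 𝔥 →ₗ[ℂ] Fock 𝔥 :=
    { toFun := fun y => (lam : ℂ) • fieldOperator G ⟨R y, hdom y⟩
      map_add' := fun y y' => by
        rw [← smul_add, ← LinearPMap.map_add]
        congr 2
        exact Subtype.ext (map_add R y y')
      map_smul' := fun a y => by
        have h : (⟨R (a • y), hdom (a • y)⟩ : (fieldOperator G).domain) = a • ⟨R y, hdom y⟩ :=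
          Subtype.ext (map_smul R a y)
        rw [RingHom.id_apply, h, LinearPMap.map_smul, smul_comm] }
  have hW : ∀ y, ‖W₀ y‖ ≤ 1 / 2 * ‖y‖ := by
    intro y
    obtain ⟨α, β, h, hα, hβ⟩ := S.exists_fieldAction (fieldEnergy_ne_top_of_mem (hR1 y))
    have hval : W₀ y = (lam : ℂ) • (α + β) := by
      change (lam : ℂ) • fieldOperator G ⟨R y, hdom y⟩ = _
      congr 1
      exact LinearPMap.mem_graph_snd_inj _ ((fieldOperator G).mem_graph ⟨R y, hdom y⟩)
        (h.mem_graph S) rfl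
    set q := (fieldEnergy (R y)).toReal with hq
    have hq0 : 0 ≤ q := ENNReal.toReal_nonneg
    have k1 := freeHamiltonian_formBound_add S.formBound (hR1 y)
    have k2 := (freeHamiltonian_formBound S.formBound).norm_le (hR1 y)
    rw [inner_shift_re] at k1
    have k3 : (inner ℂ (R y) y).re ≤ ‖R y‖ * ‖y‖ := re_inner_le_norm (𝕜 := ℂ) _ _
    have k4 : μ * ‖R y‖ ≤ ‖y‖ := by linarith
    have k5 : μ * ‖R y‖ ^ 2 ≤ ‖y‖ ^ 2 := by nlinarith [norm_nonneg (R y), norm_nonneg y]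
    have k6 : μ * q ≤ ‖y‖ ^ 2 := by
      have m1 : q ≤ ‖R y‖ * ‖y‖ := by
        have := mul_nonneg hμ0.le (sq_nonneg ‖R y‖)
        rw [hq]; linarith
      calc μ * q ≤ μ * (‖R y‖ * ‖y‖) := by gcongr
        _ = (μ * ‖R y‖) * ‖y‖ := by ring
        _ ≤ ‖y‖ * ‖y‖ := by gcongr
        _ = ‖y‖ ^ 2 := (sq _).symm
    have k7 : ‖α + β‖ ^ 2 ≤ 2 * (‖α‖ ^ 2 + ‖β‖ ^ 2) := by
      have := norm_add_le α β
      nlinarith [sq_nonneg (‖α‖ - ‖β‖), norm_nonneg (α + β), norm_nonneg α, norm_nonneg β]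
    have k8 : μ * (‖α‖ ^ 2 + ‖β‖ ^ 2) ≤ (2 * c + d) * ‖y‖ ^ 2 := by
      calc μ * (‖α‖ ^ 2 + ‖β‖ ^ 2) ≤ μ * (c * q + (d * ‖R y‖ ^ 2 + c * q)) := by gcongr
        _ = 2 * c * (μ * q) + d * (μ * ‖R y‖ ^ 2) := by ring
        _ ≤ 2 * c * ‖y‖ ^ 2 + d * ‖y‖ ^ 2 := by gcongr
        _ = _ := by ring
    have k9 : ‖W₀ y‖ ^ 2 ≤ (1 / 2 * ‖y‖) ^ 2 := by
      rw [hval, norm_smul, Complex.norm_real, mul_pow, Real.norm_eq_abs, sq_abs]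
      have m1 : μ * (lam ^ 2 * ‖α + β‖ ^ 2) ≤ μ * (1 / 2 * ‖y‖) ^ 2 := by
        calc μ * (lam ^ 2 * ‖α + β‖ ^ 2) ≤ μ * (lam ^ 2 * (2 * (‖α‖ ^ 2 + ‖β‖ ^ 2))) := by gcongr
          _ = 2 * lam ^ 2 * (μ * (‖α‖ ^ 2 + ‖β‖ ^ 2)) := by ring
          _ ≤ 2 * lam ^ 2 * ((2 * c + d) * ‖y‖ ^ 2) := by gcongr
          _ = (μ - 1) * (1 / 2 * ‖y‖) ^ 2 := by rw [hμ]; ring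
          _ ≤ μ * (1 / 2 * ‖y‖) ^ 2 := by gcongr; linarith
      exact le_of_mul_le_mul_left m1 hμ0
    exact (sq_le_sq₀ (norm_nonneg _) (by positivity)).1 k9
  set W : Fock 𝔥 →L[ℂ] Fock 𝔥 := W₀.mkContinuous (1 / 2) hW with hWdef
  intro y
  obtain ⟨w, hw'⟩ := exists_add_eq_of_norm_le W hW y
  refine ⟨R w, ?_⟩
  have : y + ((e - μ : ℝ) : ℂ) • R w = (w + ((e - μ : ℝ) : ℂ) • R w) + W w := by
    rw [← hw']; abel
  rw [this]
  exact mem_graph_add.2 ⟨_, _, hR1 w, mem_graph_smul.2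
    ⟨_, (fieldOperator G).mem_graph ⟨R w, hdom w⟩, rfl⟩, rfl⟩

/-- The upper bound comes from the trial vector `φ ⊗ Ω`: it is annihilated by `a(G)` and orthogonal
to its image under `a*(G)`, so its energy is `e` for every coupling. -/
theorem Admissible.groundEnergy_spec (S : Admissible Hat e G) {φ : 𝔥}
    (hφ : IsEigenvector Hat e φ) (hφn : ‖φ‖ = 1) (lam : ℝ) :
    IsGLB (realSpectrum (hamiltonian Hat G lam)) (groundEnergy Hat G lam) ∧
      FormBound (hamiltonian Hat G lam) (groundEnergy Hat G lam) ∧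
      e - lam ^ 2 * (couplingEnergy G).toReal ≤ groundEnergy Hat G lam ∧
      groundEnergy Hat G lam ≤ e ∧
      ∀ w < groundEnergy Hat G lam, ShiftSurjective (hamiltonian Hat G lam) w := by
  have hφg : (φ, (e : ℂ) • φ) ∈ Hat.graph := hφ.2
  have hfree := tensorVacuum_mem_free hφg
  obtain ⟨α, β, h, -⟩ := S.exists_fieldAction (fieldEnergy_ne_top_of_mem hfree)
  have hα : α = 0 := by
    refine LinearPMap.mem_graph_snd_inj (annihilation G) (x := tensorVacuum φ) ?_ ?_ rfl
    · rw [annihilation_graph]; exact h.ann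
    · rw [annihilation_graph]; exact tensorVacuum_mem_annihilation G φ
  have hmem : (tensorVacuum φ, tensorVacuum ((e : ℂ) • φ) + (lam : ℂ) • (α + β)) ∈
      (hamiltonian Hat G lam).graph :=
    mem_graph_add.2 ⟨_, _, hfree, mem_graph_smul.2 ⟨_, h.mem_graph S, rfl⟩, rfl⟩
  obtain ⟨z, hz, hs⟩ := S.exists_shiftSurjective lam
  obtain ⟨E, h1, h2, h3, h4, h5⟩ := exists_isGLB_realSpectrum (S.symmetric_hamiltonian lam)
    (S.formBound_hamiltonian lam) hz hs hmem (by rw [norm_tensorVacuum, hφn])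
  have hval : (inner ℂ (tensorVacuum φ)
      (tensorVacuum ((e : ℂ) • φ) + (lam : ℂ) • (α + β))).re = e := by
    have hβ : inner ℂ (tensorVacuum φ) β = 0 := by
      rw [← inner_conj_symm, ← h.inner_ann S h, hα, inner_zero_right, map_zero]
    rw [inner_add_right, inner_smul_right, inner_add_right, hβ, hα, inner_zero_right,
      inner_tensorVacuum, wave_tensorVacuum_default, inner_smul_right]
    rw [add_zero, mul_zero, add_zero, Complex.re_ofReal_mul, inner_self_re, hφn]
    ring
  have hE : groundEnergy Hat G lam = E := h1.csInf_eq h1.nonempty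
  rw [hE]
  exact ⟨h1, h2, h3, h4.trans_eq hval, h5⟩

end Hamiltonian

/-! ### Formal solutions of the eigenvalue equation are weak solutions -/

section Weak

variable {𝔥 : Type*} [NormedAddCommGroup 𝔥] [InnerProductSpace ℂ 𝔥] [CompleteSpace 𝔥]
  {Hat : 𝔥 →ₗ.[ℂ] 𝔥} {e : ℝ} {G : R3 → 𝔥 →L[ℂ] 𝔥}

/-- The bound grows with `n` but asks for no field energy; it suffices wherever single components
are considered. -/
theorem lintegral_annFun_le_norm (hGn : AEMeasurable (fun k => ‖G k‖ₑ))
    {n : ℕ} {h : (Fin (n + 1) → R3) → 𝔥} (hh : AEStronglyMeasurable h volume) :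
    ∫⁻ K, ‖annFun G n h K‖ₑ ^ 2 ≤
      ‖((√((n : ℝ) + 1) : ℝ) : ℂ)‖ₑ ^ 2 * (couplingNorm G * ∫⁻ X, ‖h X‖ₑ ^ 2) := by
  have hm : AEMeasurable (fun X : Fin (n + 1) → R3 => ‖h X‖ₑ ^ 2) := hh.enorm.pow_const 2
  have hm2 : AEMeasurable (fun K : Fin n → R3 => ∫⁻ k : R3, ‖h (Fin.cons k K)‖ₑ ^ 2) :=
    (hm.comp_quasiMeasurePreserving
      (measurePreserving_snoc_cons n).quasiMeasurePreserving).lintegral_prod_right'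
  rw [lintegral_cons hm, ← mul_assoc, ← lintegral_const_mul'' _ hm2]
  refine lintegral_mono_ae ?_
  filter_upwards [ae_aestronglyMeasurable_slice hh] with K hK
  rw [annFun, enorm_smul, mul_pow, mul_assoc]
  gcongr
  calc ‖∫ k, (G k).adjoint (h (Fin.cons k K))‖ₑ ^ 2
      ≤ (∫⁻ k, ‖G k‖ₑ * ‖h (Fin.cons k K)‖ₑ) ^ 2 := by
        gcongr
        refine (enorm_integral_le_lintegral_enorm _).trans (lintegral_mono fun k => ?_)
        exact enorm_adjoint_apply_le _ _
    _ ≤ _ := sq_lintegral_mul_le hGn hK.enorm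

variable [TopologicalSpace.SeparableSpace 𝔥]

theorem annFun_memLp (hG : ∀ x, AEStronglyMeasurable (fun k => G k x) volume)
    (hGn : AEMeasurable (fun k => ‖G k‖ₑ)) (h0 : couplingNorm G ≠ ⊤)
    {n : ℕ} {h : (Fin (n + 1) → R3) → 𝔥} (hh : MemLp h 2 volume) :
    MemLp (annFun G n h) 2 volume :=
  memLp_two_of_lintegral (annFun_aestronglyMeasurable hG hh.1)
    (ne_top_of_le_ne_top (ENNReal.mul_ne_top (by finiteness)
      (ENNReal.mul_ne_top h0 (lintegral_sq_ne_top_of_memLp hh)))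
      (lintegral_annFun_le_norm hGn hh.1))

/-- If `χ` solves `(H - t) χ = g` in the sense of functions, then it does so weakly. -/
theorem Admissible.weak_solution (S : Admissible Hat e G) {lam t : ℝ} {χ g : Fock 𝔥}
    {θ : ∀ n, (Fin n → R3) → 𝔥} (hθ : ∀ n, MemLp (θ n) 2 volume)
    (hgraph : ∀ n, ∀ᵐ K, (wave χ n K, θ n K) ∈ Hat.graph)
    (heq : ∀ n, ∀ᵐ K, θ n K + ((∑ i, ‖K i‖ : ℝ) : ℂ) • wave χ n K +
      (lam : ℂ) • (annFun G n (wave χ (n + 1)) K + creFamily G (wave χ) n K) =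
        wave g n K + (t : ℂ) • wave χ n K)
    {η ζ : Fock 𝔥} (hη : (η, ζ) ∈ (hamiltonian Hat G lam).graph) :
    inner ℂ ζ χ = inner ℂ η g + t * inner ℂ η χ := by
  obtain ⟨ζ₀, α, β, h1, h2, -, rfl⟩ := S.mem_graph_hamiltonian.1 hη
  obtain ⟨ζ₁, ζ₂, a1, a2, rfl⟩ := mem_graph_freeHamiltonian.1 h1
  -- As `χ` need not lie in the domain, convergence of these four series is not evident. It is
  -- obtained by moving each operator, component by component, onto `η`: creation on `χ` becomes
  -- annihilation on `η` and conversely, with a shift of `n` by one.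
  set u : ℕ → ℂ := fun n => ∫ K, inner ℂ (wave η n K) (creFamily G (wave χ) n K) with hu
  set v : ℕ → ℂ := fun n => ∫ K, inner ℂ (wave η n K) (annFun G n (wave χ (n + 1)) K) with hv
  set a : ℕ → ℂ := fun n => ∫ K, inner ℂ (wave η n K) (θ n K) with ha
  set b : ℕ → ℂ := fun n => ∫ K, inner ℂ (wave ζ₂ n K) (wave χ n K) with hb
  have sa : HasSum a (inner ℂ ζ₁ χ) := by
    have hfun : a = fun n => ∫ K, inner ℂ (wave ζ₁ n K) (wave χ n K) := by
      funext n
      refine integral_congr_ae ?_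
      filter_upwards [a1 n, hgraph n] with K k1 k2
      exact (S.symmetric k1 k2).symm
    rw [hfun]
    exact hasSum_inner_wave ζ₁ χ
  have sb : HasSum b (inner ℂ ζ₂ χ) := hasSum_inner_wave ζ₂ χ
  have su : HasSum u (inner ℂ α χ) := by
    have hu0 : u 0 = 0 := by simp [hu, creFamily]
    have hcomp : ∀ n, ∫ K, inner ℂ (wave α n K) (wave χ n K) = u (n + 1) := by
      intro n
      have e1 := integral_inner_creFun S.measurable S.measurable_norm S.norm_ne_top
        (wave_memLp χ n) (wave_memLp η (n + 1)) (wave_perm η (n + 1))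
      have e2 := congrArg (starRingEnd ℂ) e1
      rw [← integral_conj, ← integral_conj] at e2
      simp only [inner_conj_symm] at e2
      change _ = ∫ X, inner ℂ (wave η (n + 1) X) (creFun G n (wave χ n) X)
      rw [e2]
      refine integral_congr_ae ?_
      filter_upwards [h2.ann n] with K hK
      rw [hK.2]; rfl
    rw [← hasSum_nat_add_iff' 1, Finset.sum_range_one, hu0, sub_zero]
    have := hasSum_inner_wave α χ
    simp only [hcomp] at this
    exact this
  have sv : HasSum v (inner ℂ β χ) := by
    have h3 := hasSum_inner_wave β χ
    rw [← hasSum_nat_add_iff' 1, Finset.sum_range_one] at h3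
    have hzero : ∫ K, inner ℂ (wave β 0 K) (wave χ 0 K) = 0 := by
      refine integral_eq_zero_of_ae ?_
      filter_upwards [h2.cre 0] with K hK
      rw [hK]
      simp [creFamily]
    rw [hzero, sub_zero] at h3
    have hcomp : ∀ n, ∫ X, inner ℂ (wave β (n + 1) X) (wave χ (n + 1) X) = v n := by
      intro n
      have e1 := integral_inner_creFun S.measurable S.measurable_norm S.norm_ne_top
        (wave_memLp η n) (wave_memLp χ (n + 1)) (wave_perm χ (n + 1))
      simp only [hv]
      rw [← e1]
      refine integral_congr_ae ?_
      filter_upwards [h2.cre (n + 1)] with K hK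
      rw [hK]; rfl
    simp only [hcomp] at h3
    exact h3
  have hcre : ∀ n, MemLp (creFamily G (wave χ) n) 2 volume := fun n => by
    cases n with
    | zero => exact MemLp.zero
    | succ n => exact creFun_memLp S.measurable S.measurable_norm S.norm_ne_top (wave_memLp χ n)
  have hsum : ∀ n, a n + b n + lam * (u n + v n) =
      (∫ K, inner ℂ (wave η n K) (wave g n K)) +
        t * ∫ K, inner ℂ (wave η n K) (wave χ n K) := by
    intro n
    have i1 := integrable_inner_of_memLp (wave_memLp η n) (hθ n)
    have i2 := integrable_inner_of_memLp (wave_memLp ζ₂ n) (wave_memLp χ n)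
    have i3 := integrable_inner_of_memLp (wave_memLp η n) (hcre n)
    have i4 := integrable_inner_of_memLp (wave_memLp η n)
      (annFun_memLp S.measurable S.measurable_norm S.norm_ne_top (wave_memLp χ (n + 1)))
    have i5 := integrable_inner_of_memLp (wave_memLp η n) (wave_memLp g n)
    have i6 := integrable_inner_of_memLp (wave_memLp η n) (wave_memLp χ n)
    have i12 : Integrable (fun K => inner ℂ (wave η n K) (θ n K) +
        inner ℂ (wave ζ₂ n K) (wave χ n K)) := i1.add i2
    have i34 : Integrable (fun K => (lam : ℂ) * (inner ℂ (wave η n K) (creFamily G (wave χ) n K) +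
        inner ℂ (wave η n K) (annFun G n (wave χ (n + 1)) K))) := (i3.add i4).const_mul _
    simp only [ha, hb, hu, hv]
    rw [← integral_add i1 i2, ← integral_add i3 i4, ← integral_const_mul, ← integral_const_mul,
      ← integral_add i12 i34, ← integral_add i5 (i6.const_mul _)]
    refine integral_congr_ae ?_
    filter_upwards [heq n, a2 n] with K k1 k2
    have k3 := congrArg (fun x => inner ℂ (wave η n K) x) k1
    simp only [inner_add_right, inner_smul_right] at k3
    rw [k2, inner_smul_left, Complex.conj_ofReal, ← k3]
    ring
  have hL := (sa.add sb).add ((su.add sv).mul_left (lam : ℂ))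
  have hR := (hasSum_inner_wave η g).add ((hasSum_inner_wave η χ).mul_left (t : ℂ))
  have hfun : (fun n => a n + b n + lam * (u n + v n)) = fun n =>
      (∫ K, inner ℂ (wave η n K) (wave g n K)) +
        t * ∫ K, inner ℂ (wave η n K) (wave χ n K) := funext hsum
  rw [hfun] at hL
  have := hL.unique hR
  rw [← this, inner_add_left, inner_add_left, inner_smul_left, Complex.conj_ofReal,
    inner_add_left]

/-- Norm estimate for formal solutions below the spectrum. -/
theorem Admissible.norm_le_of_solution (S : Admissible Hat e G) {lam t E : ℝ} {χ g : Fock 𝔥}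
    {θ : ∀ n, (Fin n → R3) → 𝔥} (hθ : ∀ n, MemLp (θ n) 2 volume)
    (hgraph : ∀ n, ∀ᵐ K, (wave χ n K, θ n K) ∈ Hat.graph)
    (heq : ∀ n, ∀ᵐ K, θ n K + ((∑ i, ‖K i‖ : ℝ) : ℂ) • wave χ n K +
      (lam : ℂ) • (annFun G n (wave χ (n + 1)) K + creFamily G (wave χ) n K) =
        wave g n K + (t : ℂ) • wave χ n K)
    (hE : FormBound (hamiltonian Hat G lam) E) (ht : t < E)
    (hs : ShiftSurjective (hamiltonian Hat G lam) t) : (E - t) * ‖χ‖ ≤ ‖g‖ := by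
  -- Testing with `η = (H - t)⁻¹ χ` gives `‖χ‖² = ⟨η, g⟩`, and the form bound gives `(E - t) ‖η‖ ≤
  -- ‖χ‖`.
  obtain ⟨η, hη⟩ := hs χ
  have h1 := S.weak_solution hθ hgraph heq hη
  rw [inner_add_left, inner_smul_left, Complex.conj_ofReal] at h1
  have h2 : inner ℂ χ χ = inner ℂ η g := add_right_cancel h1
  have h3 := hE.norm_le hη
  have h4 : ‖χ‖ ^ 2 ≤ ‖η‖ * ‖g‖ := by
    rw [← inner_self_re, h2]
    exact re_inner_le_norm (𝕜 := ℂ) _ _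
  have hpos : 0 < E - t := sub_pos.2 ht
  rcases (norm_nonneg χ).eq_or_lt with h0 | h0
  · rw [← h0, mul_zero]
    exact norm_nonneg g
  · have h5 : ‖χ‖ * ((E - t) * ‖χ‖) ≤ ‖χ‖ * ‖g‖ := by
      calc ‖χ‖ * ((E - t) * ‖χ‖) = (E - t) * ‖χ‖ ^ 2 := by ring
        _ ≤ (E - t) * (‖η‖ * ‖g‖) := by gcongr
        _ = ((E - t) * ‖η‖) * ‖g‖ := by ring
        _ ≤ ‖χ‖ * ‖g‖ := by gcongr
    exact le_of_mul_le_mul_left h5 h0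

end Weak

/-! ### The pull-through formula -/

section PullThrough

variable {𝔥 : Type*} [NormedAddCommGroup 𝔥] [InnerProductSpace ℂ 𝔥]
  {Hat : 𝔥 →ₗ.[ℂ] 𝔥} {e : ℝ} {G : R3 → 𝔥 →L[ℂ] 𝔥}

/-- The components of `a(k) ψ`. -/
def sliceFun (ψ : Fock 𝔥) (k : R3) (n : ℕ) (K : Fin n → R3) : 𝔥 :=
  ((√((n : ℝ) + 1) : ℝ) : ℂ) • wave ψ (n + 1) (Fin.cons k K)

theorem lintegral_slice_aemeasurable (ψ : Fock 𝔥) (n : ℕ) :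
    AEMeasurable fun k : R3 => ∫⁻ K, ‖sliceFun ψ k n K‖ₑ ^ 2 := by
  have hm : AEMeasurable (fun X => ‖((√((n : ℝ) + 1) : ℝ) : ℂ) • wave ψ (n + 1) X‖ₑ ^ 2) :=
    ((wave_aestronglyMeasurable ψ (n + 1)).const_smul _).enorm.pow_const 2
  exact (hm.comp_quasiMeasurePreserving
      (measurePreserving_cons n).quasiMeasurePreserving).lintegral_prod_right'

/-- Tonelli for `∫ w(k) ‖a(k)ψ‖² dk`. The weight `|k|` gives the field energy and the weight `1` the
photon number. -/
theorem lintegral_weight_slice (ψ : Fock 𝔥) {w : R3 → ENNReal} (hw : Measurable w) :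
    ∫⁻ k, w k * ∑' n, ∫⁻ K, ‖sliceFun ψ k n K‖ₑ ^ 2 =
      ∑' n : ℕ, (n + 1 : ENNReal) * ∫⁻ X, w (X 0) * ‖wave ψ (n + 1) X‖ₑ ^ 2 := by
  simp_rw [← ENNReal.tsum_mul_left]
  rw [lintegral_tsum (f := fun n k => w k * ∫⁻ K, ‖sliceFun ψ k n K‖ₑ ^ 2) fun n =>
    hw.aemeasurable.mul (lintegral_slice_aemeasurable ψ n)]
  refine tsum_congr fun n => ?_
  have hm : AEMeasurable (fun X : Fin (n + 1) → R3 => w (X 0) * ‖wave ψ (n + 1) X‖ₑ ^ 2) :=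
    (hw.comp (measurable_pi_apply 0)).aemeasurable.mul
      ((wave_aestronglyMeasurable ψ (n + 1)).enorm.pow_const 2)
  have hm2 : AEMeasurable (fun k : R3 =>
      ∫⁻ K : Fin n → R3, w k * ‖wave ψ (n + 1) (Fin.cons k K)‖ₑ ^ 2) := by
    have := (hm.comp_quasiMeasurePreserving
      (measurePreserving_cons n).quasiMeasurePreserving).lintegral_prod_right'
    simpa using this
  rw [lintegral_cons' hm]
  simp only [Fin.cons_zero]
  rw [← lintegral_const_mul'' _ hm2]
  refine lintegral_congr_ae ?_
  filter_upwards [ae_aestronglyMeasurable_slice' (wave_aestronglyMeasurable ψ (n + 1))] with k hk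
  have e1 : ∫⁻ K, ‖sliceFun ψ k n K‖ₑ ^ 2 =
      (n + 1 : ENNReal) * ∫⁻ K, ‖wave ψ (n + 1) (Fin.cons k K)‖ₑ ^ 2 := by
    rw [← lintegral_const_mul'' _ (hk.enorm.pow_const 2)]
    refine lintegral_congr fun K => ?_
    rw [sliceFun, enorm_smul, mul_pow, enorm_sqrt_sq]
  rw [e1, lintegral_const_mul'' _ (hk.enorm.pow_const 2)]
  ring

/-- `a(k) ψ` is a vector of the Fock space for almost every `k` if `ψ` has finite energy. -/
theorem exists_slice {ψ : Fock 𝔥} (hψ : fieldEnergy ψ ≠ ⊤) :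
    ∀ᵐ k : R3, ∃ χ : Fock 𝔥, ∀ n, wave χ n =ᵐ[volume] sliceFun ψ k n := by
  have hfin : ∫⁻ k : R3, ‖k‖ₑ * ∑' n, ∫⁻ K, ‖sliceFun ψ k n K‖ₑ ^ 2 ≠ ⊤ := by
    rw [lintegral_weight_slice ψ measurable_enorm]
    refine ne_top_of_le_ne_top hψ ?_
    calc ∑' n : ℕ, (n + 1 : ENNReal) * ∫⁻ X, ‖X 0‖ₑ * ‖wave ψ (n + 1) X‖ₑ ^ 2
        = ∑' n : ℕ, ∫⁻ X : Fin (n + 1) → R3,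
            ENNReal.ofReal (∑ i, ‖X i‖) * ‖wave ψ (n + 1) X‖ₑ ^ 2 :=
          tsum_congr fun n => (lintegral_sum_norm_mul (wave_perm ψ (n + 1))
            (wave_aestronglyMeasurable ψ (n + 1))).symm
      _ ≤ fieldEnergy ψ := ENNReal.tsum_comp_le_tsum_of_injective (add_left_injective 1)
            (fun m => ∫⁻ X : Fin m → R3, ENNReal.ofReal (∑ i, ‖X i‖) * ‖wave ψ m X‖ₑ ^ 2)
  have hmeas : AEMeasurable fun k : R3 => ‖k‖ₑ * ∑' n, ∫⁻ K, ‖sliceFun ψ k n K‖ₑ ^ 2 :=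
    measurable_enorm.aemeasurable.mul
      (AEMeasurable.tsum fun n => lintegral_slice_aemeasurable ψ n)
  have hperm : ∀ᵐ k : R3, ∀ n (π : Equiv.Perm (Fin n)), ∀ᵐ K : Fin n → R3,
      wave ψ (n + 1) (fun j => (Fin.cons k K : Fin (n + 1) → R3)
        (Equiv.Perm.decomposeFin.symm (0, π) j)) = wave ψ (n + 1) (Fin.cons k K) :=
    ae_all_iff.2 fun n => ae_all_iff.2 fun π => ae_ae_cons' (wave_perm ψ (n + 1) _)
  filter_upwards [ae_lt_top' hmeas hfin, ae_ne_zero, hperm,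
    ae_all_iff.2 fun n => ae_aestronglyMeasurable_slice' (wave_aestronglyMeasurable ψ (n + 1))]
    with k k1 k2 k3 k4
  refine exists_fock (sliceFun ψ k) (fun n => (k4 n).const_smul _) (fun n π => ?_) fun htop => ?_
  · filter_upwards [k3 n π] with K hK
    simp only [sliceFun]
    rw [cons_perm, hK]
  · rw [htop, ENNReal.mul_top (by simpa using k2)] at k1
    exact lt_irrefl _ k1

/-- The relation `a(k) a*(G) = G(k) + a*(G) a(k)`: either the photon `k` is the created one, or it
is a spectator. -/
theorem creFun_cons (f : ∀ n, (Fin n → R3) → 𝔥) (n : ℕ) (k : R3) (K : Fin n → R3) :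
    ((√((n : ℝ) + 1) : ℝ) : ℂ) • creFun G n (f n) (Fin.cons k K) = G k (f n K) +
      creFamily G (fun m K' => ((√((m : ℝ) + 1) : ℝ) : ℂ) • f (m + 1) (Fin.cons k K')) n K := by
  have hs : ∀ m : ℕ, ((√((m : ℝ) + 1) : ℝ) : ℂ) * (((√((m : ℝ) + 1))⁻¹ : ℝ) : ℂ) = 1 := fun m => by
    rw [← Complex.ofReal_mul, mul_inv_cancel₀ (Real.sqrt_pos.2 (by positivity)).ne',
      Complex.ofReal_one]
  rw [creFun, smul_smul, hs, one_smul, Fin.sum_univ_succ]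
  congr 1
  cases n with
  | zero => simp [creFamily]
  | succ m =>
    rw [creFamily, creFun, Finset.smul_sum]
    refine Finset.sum_congr rfl fun i _ => ?_
    have e : (fun j => (Fin.cons k K : Fin (m + 2) → R3) (i.succ.succAbove j)) =
        Fin.cons k (fun j => K (i.succAbove j)) := by
      funext j
      refine Fin.cases ?_ (fun j => ?_) j
      · simp
      · simp
    simp only [creTerm, Fin.cons_succ, map_smul]
    rw [smul_smul, mul_comm, hs, one_smul, e]

theorem creFamily_congr {f g : ∀ n, (Fin n → R3) → 𝔥} (h : ∀ n, f n =ᵐ[volume] g n) (n : ℕ) :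
    creFamily G f n =ᵐ[volume] creFamily G g n := by
  cases n with
  | zero => exact EventuallyEq.rfl
  | succ m =>
    have : ∀ i : Fin (m + 1), ∀ᵐ X : Fin (m + 1) → R3,
        f m (fun j => X (i.succAbove j)) = g m (fun j => X (i.succAbove j)) := fun i =>
      (quasiMeasurePreserving_remove i).ae (h m)
    filter_upwards [ae_all_iff.2 this] with X hX
    simp only [creFamily, creFun, creTerm, hX]

theorem ae_swap_cons (ψ : Fock 𝔥) : ∀ᵐ k : R3, ∀ n, ∀ᵐ K : Fin n → R3, ∀ᵐ k' : R3,
    wave ψ (n + 2) (Fin.cons k (Fin.cons k' K)) = wave ψ (n + 2) (Fin.cons k' (Fin.cons k K)) := by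
  refine ae_all_iff.2 fun n => ?_
  have h := ae_ae_cons' (ae_ae_cons (wave_perm ψ (n + 2) (Equiv.swap 0 1)))
  filter_upwards [h] with k hk
  filter_upwards [hk] with K hK
  filter_upwards [hK] with k' hk'
  rw [← hk']
  congr 1
  funext j
  refine Fin.cases ?_ (fun j => Fin.cases ?_ (fun j => ?_) j) j
  · simp
  · simp
  · rw [Equiv.swap_apply_of_ne_of_ne (by simp) (by simp [Fin.ext_iff])]
    simp

variable [CompleteSpace 𝔥]

theorem annFun_congr {n : ℕ} {f g : (Fin (n + 1) → R3) → 𝔥} (h : f =ᵐ[volume] g) :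
    annFun G n f =ᵐ[volume] annFun G n g := by
  filter_upwards [ae_ae_cons h] with K hK
  rw [annFun, annFun]
  congr 1
  refine integral_congr_ae ?_
  filter_upwards [hK] with k hk
  rw [hk]

/-- The relation `a(G) a(k) = a(k) a(G)`, which rests on the symmetry in the first two momenta. -/
theorem annFun_slice {ψ : Fock 𝔥} {k : R3} {n : ℕ} {K : Fin n → R3}
    (h : ∀ᵐ k' : R3, wave ψ (n + 2) (Fin.cons k (Fin.cons k' K)) =
      wave ψ (n + 2) (Fin.cons k' (Fin.cons k K))) :
    annFun G n (sliceFun ψ k (n + 1)) K =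
      ((√((n : ℝ) + 1) : ℝ) : ℂ) • annFun G (n + 1) (wave ψ (n + 2)) (Fin.cons k K) := by
  rw [annFun, annFun]
  congr 1
  rw [← integral_smul]
  refine integral_congr_ae ?_
  filter_upwards [h] with k' hk'
  rw [sliceFun, hk', map_smul]

end PullThrough

/-! ### Photon number and vacuum component of ground states. -/

section PhotonNumber

variable {𝔥 : Type*} [NormedAddCommGroup 𝔥] [InnerProductSpace ℂ 𝔥]
  {Hat : 𝔥 →ₗ.[ℂ] 𝔥} {e : ℝ} {G : R3 → 𝔥 →L[ℂ] 𝔥}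

/-- Needed for the vector `(H_at ⊗ 1) ψ`, whose field energy is not controlled; square integrability
of each component of the slice is enough for the weak formulation. -/
theorem ae_sliceFun_memLp (ψ : Fock 𝔥) : ∀ᵐ k : R3, ∀ n, MemLp (sliceFun ψ k n) 2 volume := by
  refine ae_all_iff.2 fun n => ?_
  have h1 : MemLp (fun X => ((√((n : ℝ) + 1) : ℝ) : ℂ) • wave ψ (n + 1) X) 2 volume :=
    (wave_memLp ψ (n + 1)).const_smul _
  have h2 := lintegral_sq_ne_top_of_memLp h1
  rw [lintegral_cons' (h1.1.enorm.pow_const 2)] at h2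
  filter_upwards [ae_lt_top' (lintegral_slice_aemeasurable ψ n) h2,
    ae_aestronglyMeasurable_slice' h1.1] with k k1 k2
  exact memLp_two_of_lintegral k2 k1.ne

/-- The squared norm `∫ ‖G(k)‖² |k|⁻² dk`. -/
def couplingInfrared (G : R3 → 𝔥 →L[ℂ] 𝔥) : ENNReal := ∫⁻ k, (‖k‖ₑ⁻¹) ^ 2 * ‖G k‖ₑ ^ 2

theorem exists_constFibre (B : 𝔥 →L[ℂ] 𝔥) (ψ : Fock 𝔥) :
    ∃ χ : Fock 𝔥, (∀ n, wave χ n =ᵐ[volume] fun K => B (wave ψ n K)) ∧ ‖χ‖ ≤ ‖B‖ * ‖ψ‖ := by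
  obtain ⟨T, hT⟩ := exists_fibreOperator (𝔥 := 𝔥) (fun _ _ => B)
    (fun n x => aestronglyMeasurable_const) (fun _ _ _ => rfl) (norm_nonneg B)
    (fun n => Eventually.of_forall fun _ => le_rfl)
  refine ⟨T ψ, hT ψ, norm_le_of_wave (norm_nonneg _) fun n => ?_⟩
  filter_upwards [hT ψ n] with K hK
  rw [hK]
  exact B.le_opNorm _

theorem lintegral_fin_zero (f : (Fin 0 → R3) → ENNReal) : ∫⁻ K, f K = f default := by
  have h : f = fun _ => f default := funext fun K => congrArg f (Subsingleton.elim _ _)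
  rw [h, lintegral_const, volume_univ_fin_zero, mul_one]

theorem ofReal_norm_sub_tensorVacuum (ψ : Fock 𝔥) (c : ℂ) (φ : 𝔥) :
    ENNReal.ofReal (‖ψ - c • tensorVacuum φ‖ ^ 2) =
      ENNReal.ofReal (‖wave ψ 0 default - c • φ‖ ^ 2) +
        ∑' n, ∫⁻ X, ‖wave ψ (n + 1) X‖ₑ ^ 2 := by
  rw [ofReal_norm_sq, tsum_eq_zero_add' ENNReal.summable, lintegral_fin_zero]
  congr 1
  · have h : wave (ψ - c • tensorVacuum φ) 0 default = wave ψ 0 default - c • φ := by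
      refine ae_fin_zero (p := fun K => wave (ψ - c • tensorVacuum φ) 0 K = wave ψ 0 K - c • φ) ?_
      filter_upwards [wave_sub ψ (c • tensorVacuum φ) 0, wave_smul c (tensorVacuum φ) 0,
        wave_tensorVacuum_zero φ] with K k1 k2 k3
      rw [k1, Pi.sub_apply, k2, Pi.smul_apply, k3]
    rw [h, ENNReal.ofReal_pow (norm_nonneg _), ofReal_norm]
  · refine tsum_congr fun n => lintegral_congr_ae ?_
    filter_upwards [wave_sub ψ (c • tensorVacuum φ) (n + 1),
      wave_smul c (tensorVacuum φ) (n + 1), wave_tensorVacuum_succ φ n] with K k1 k2 k3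
    rw [k1, Pi.sub_apply, k2, Pi.smul_apply, k3]
    simp

variable [CompleteSpace 𝔥] [TopologicalSpace.SeparableSpace 𝔥]

/-- Pull-through estimate: `|k| ‖a(k) ψ‖ ≤ |lam| ‖G(k)‖ ‖ψ‖` for ground states `ψ`. -/
theorem Admissible.pullThrough (S : Admissible Hat e G) {lam E : ℝ} {ψ : Fock 𝔥}
    (hψ : (ψ, (E : ℂ) • ψ) ∈ (hamiltonian Hat G lam).graph)
    (hE : FormBound (hamiltonian Hat G lam) E)
    (hs : ∀ w < E, ShiftSurjective (hamiltonian Hat G lam) w) :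
    ∀ᵐ k : R3, ∃ χ : Fock 𝔥, (∀ n, wave χ n =ᵐ[volume] sliceFun ψ k n) ∧
      ‖k‖ * ‖χ‖ ≤ |lam| * (‖G k‖ * ‖ψ‖) := by
  obtain ⟨χ₀, α, β, h1, h2, -, h3⟩ := S.mem_graph_hamiltonian.1 hψ
  obtain ⟨χ₁, χ₂, a1, a2, rfl⟩ := mem_graph_freeHamiltonian.1 h1
  have hpt : ∀ᵐ k : R3, ∀ n, ∀ᵐ K : Fin n → R3,
      (E : ℂ) • wave ψ (n + 1) (Fin.cons k K) = wave χ₁ (n + 1) (Fin.cons k K) +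
        ((‖k‖ + ∑ i, ‖K i‖ : ℝ) : ℂ) • wave ψ (n + 1) (Fin.cons k K) +
        (lam : ℂ) • (annFun G (n + 1) (wave ψ (n + 2)) (Fin.cons k K) +
          creFun G n (wave ψ n) (Fin.cons k K)) ∧
      (wave ψ (n + 1) (Fin.cons k K), wave χ₁ (n + 1) (Fin.cons k K)) ∈ Hat.graph := by
    refine ae_all_iff.2 fun n => ?_
    have hX : ∀ᵐ X : Fin (n + 1) → R3, (E : ℂ) • wave ψ (n + 1) X = wave χ₁ (n + 1) X +
        ((∑ i, ‖X i‖ : ℝ) : ℂ) • wave ψ (n + 1) X +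
        (lam : ℂ) • (annFun G (n + 1) (wave ψ (n + 2)) X + creFun G n (wave ψ n) X) ∧
        (wave ψ (n + 1) X, wave χ₁ (n + 1) X) ∈ Hat.graph := by
      filter_upwards [a1 (n + 1), a2 (n + 1), h2.ann (n + 1), h2.cre (n + 1),
        wave_smul (E : ℂ) ψ (n + 1), wave_add (χ₁ + χ₂) ((lam : ℂ) • (α + β)) (n + 1),
        wave_add χ₁ χ₂ (n + 1), wave_smul (lam : ℂ) (α + β) (n + 1), wave_add α β (n + 1)]
        with X k1 k2 k3 k4 k5 k6 k7 k8 k9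
      refine ⟨?_, k1⟩
      have k3' : wave α (n + 1) X = annFun G (n + 1) (wave ψ (n + 2)) X := k3.2
      have k4' : wave β (n + 1) X = creFun G n (wave ψ n) X := k4
      have k2' : wave χ₂ (n + 1) X = ((∑ i, ‖X i‖ : ℝ) : ℂ) • wave ψ (n + 1) X := k2
      rw [h3] at k5
      rw [← k2', ← k3', ← k4']
      rw [k6, Pi.add_apply, k7, k8, Pi.add_apply, Pi.smul_apply, k9, Pi.add_apply,
        Pi.smul_apply] at k5
      exact k5.symm
    filter_upwards [ae_ae_cons' hX] with k hk
    filter_upwards [hk] with K hK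
    rw [Fin.sum_univ_succ] at hK
    simpa only [Fin.cons_zero, Fin.cons_succ] using hK
  filter_upwards [hpt, exists_slice (fieldEnergy_ne_top_of_mem h1), ae_sliceFun_memLp χ₁,
    ae_swap_cons ψ, ae_ne_zero] with k k1 k2 k3 k4 k5
  obtain ⟨χ, hχ⟩ := k2
  refine ⟨χ, hχ, ?_⟩
  obtain ⟨γ, hγ, hγn⟩ := exists_constFibre (G k) ψ
  have hk : 0 < ‖k‖ := norm_pos_iff.2 k5
  -- The sliced eigenvalue equation is `(H - (E - |k|)) a(k)ψ = -λ G(k)ψ`. The shift `|k|` is the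
  -- energy of the removed photon, and `E - t = |k|` is the factor gained.
  have key := S.norm_le_of_solution (lam := lam) (t := E - ‖k‖) (E := E) (χ := χ)
    (g := (-lam : ℂ) • γ) (θ := sliceFun χ₁ k) k3
    (fun n => by
      filter_upwards [hχ n, k1 n] with K m1 m2
      rw [m1]
      exact Hat.graph.smul_mem ((√((n : ℝ) + 1) : ℝ) : ℂ) m2.2)
    (fun n => by
      filter_upwards [hχ n, k1 n, hγ n, wave_smul (-lam : ℂ) γ n, annFun_congr (G := G) (hχ (n + 1)),
        creFamily_congr (G := G) hχ n, k4 n] with K m1 m2 m3 m4 m5 m6 m7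
      have c1 := creFun_cons (G := G) (wave ψ) n k K
      rw [m5, m6, m4, Pi.smul_apply, m3, m1, annFun_slice m7]
      have c2 : creFamily G (sliceFun ψ k) n K =
          ((√((n : ℝ) + 1) : ℝ) : ℂ) • creFun G n (wave ψ n) (Fin.cons k K) -
            G k (wave ψ n K) := by
        rw [c1, add_sub_cancel_left]; rfl
      rw [c2]
      have c3 := congrArg (fun x => ((√((n : ℝ) + 1) : ℝ) : ℂ) • x) m2.1
      simp only [sliceFun]
      rw [← sub_eq_zero] at c3 ⊢
      rw [← neg_eq_zero, ← c3]
      push_cast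
      module)
    hE (by linarith) (hs _ (by linarith))
  rw [sub_sub_cancel] at key
  refine key.trans ?_
  rw [norm_smul, norm_neg, Complex.norm_real, Real.norm_eq_abs]
  gcongr

/-- The expected number of photons in a ground state is of second order in the coupling. -/
theorem Admissible.photonNumber_le (S : Admissible Hat e G) {lam E : ℝ} {ψ : Fock 𝔥}
    (hψ : (ψ, (E : ℂ) • ψ) ∈ (hamiltonian Hat G lam).graph)
    (hE : FormBound (hamiltonian Hat G lam) E)
    (hs : ∀ w < E, ShiftSurjective (hamiltonian Hat G lam) w) :
    ∑' n : ℕ, (n + 1 : ENNReal) * ∫⁻ X, ‖wave ψ (n + 1) X‖ₑ ^ 2 ≤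
      ENNReal.ofReal (lam ^ 2 * ‖ψ‖ ^ 2) * couplingInfrared G := by
  have h1 := lintegral_weight_slice ψ (w := fun _ => 1) measurable_const
  simp only [one_mul] at h1
  rw [← h1, couplingInfrared, ← lintegral_const_mul''
    (f := fun k : R3 => (‖k‖ₑ⁻¹) ^ 2 * ‖G k‖ₑ ^ 2) _ ((measurable_enorm.inv.pow_const 2).aemeasurable.mul (S.measurable_norm.pow_const 2))]
  refine lintegral_mono_ae ?_
  filter_upwards [S.pullThrough hψ hE hs, ae_ne_zero] with k hk hk0
  obtain ⟨χ, hχ, hle⟩ := hk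
  have e1 : ∑' n, ∫⁻ K, ‖sliceFun ψ k n K‖ₑ ^ 2 = ENNReal.ofReal (‖χ‖ ^ 2) := by
    rw [ofReal_norm_sq]
    refine tsum_congr fun n => lintegral_congr_ae ?_
    filter_upwards [hχ n] with K hK
    rw [hK]
  have hkpos : 0 < ‖k‖ := norm_pos_iff.2 hk0
  rw [e1, ← ofReal_norm (x := k), ← ofReal_norm (x := G k), ← ENNReal.ofReal_inv_of_pos hkpos,
    ← ENNReal.ofReal_pow (by positivity), ← ENNReal.ofReal_pow (by positivity),
    ← ENNReal.ofReal_mul (by positivity), ← ENNReal.ofReal_mul (by positivity)]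
  refine ENNReal.ofReal_le_ofReal ?_
  have e2 : ‖χ‖ ≤ ‖k‖⁻¹ * (|lam| * (‖G k‖ * ‖ψ‖)) := by
    rw [inv_mul_eq_div, le_div_iff₀ hkpos, mul_comm]
    exact hle
  calc ‖χ‖ ^ 2 ≤ (‖k‖⁻¹ * (|lam| * (‖G k‖ * ‖ψ‖))) ^ 2 := by gcongr
    _ = |lam| ^ 2 * ‖ψ‖ ^ 2 * (‖k‖⁻¹ ^ 2 * ‖G k‖ ^ 2) := by ring
    _ = _ := by rw [sq_abs]

/-- The component of a ground state without photons is almost parallel to the ground state of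
the atom. -/
theorem Admissible.vacuum_estimate (S : Admissible Hat e G) {lam E ε : ℝ} {ψ : Fock 𝔥}
    (hψ : (ψ, (E : ℂ) • ψ) ∈ (hamiltonian Hat G lam).graph) (hEe : E ≤ e) (heε : e < ε)
    {φ : 𝔥} (hφ : IsEigenvector Hat e φ) (hφn : ‖φ‖ = 1)
    (hgap : ∀ x y, (x, y) ∈ Hat.graph → inner ℂ φ x = 0 → ε * ‖x‖ ^ 2 ≤ (inner ℂ x y).re) :
    (ε - e) ^ 2 * ‖wave ψ 0 default - inner ℂ φ (wave ψ 0 default) • φ‖ ^ 2 ≤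
      lam ^ 2 * ((couplingNorm G).toReal * ‖ψ‖ ^ 2) := by
  obtain ⟨χ₀, α, β, h1, h2, -, h3⟩ := S.mem_graph_hamiltonian.1 hψ
  obtain ⟨χ₁, χ₂, a1, a2, rfl⟩ := mem_graph_freeHamiltonian.1 h1
  set u := wave ψ 0 default with hu
  set v := u - inner ℂ φ u • φ with hv
  set x₁ := wave χ₁ 0 default with hx₁
  set a₀ := annFun G 0 (wave ψ 1) default with ha₀
  have hφφ : inner ℂ φ φ = 1 := by
    rw [inner_self_eq_norm_sq_to_K, hφn]; simp
  have g1 : (u, x₁) ∈ Hat.graph := ae_fin_zero (a1 0)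
  -- In the zero-photon sector the field energy and the creation part vanish; only `H_at` and
  -- annihilation out of the one-photon sector remain.
  have g2 : (E : ℂ) • u = x₁ + (lam : ℂ) • a₀ := by
    have : ∀ᵐ K : Fin 0 → R3, (E : ℂ) • wave ψ 0 K = wave χ₁ 0 K +
        (lam : ℂ) • annFun G 0 (wave ψ 1) K := by
      filter_upwards [a2 0, h2.ann 0, h2.cre 0, wave_smul (E : ℂ) ψ 0,
        wave_add (χ₁ + χ₂) ((lam : ℂ) • (α + β)) 0, wave_add χ₁ χ₂ 0,
        wave_smul (lam : ℂ) (α + β) 0, wave_add α β 0]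
        with X k2 k3 k4 k5 k6 k7 k8 k9
      have k3' : wave α 0 X = annFun G 0 (wave ψ 1) X := k3.2
      have k4' : wave β 0 X = 0 := k4
      have k2' : wave χ₂ 0 X = 0 := by
        have : wave χ₂ 0 X = ((∑ i, ‖X i‖ : ℝ) : ℂ) • wave ψ 0 X := k2
        simpa using this
      rw [h3] at k5
      rw [k6, Pi.add_apply, k7, k8, Pi.add_apply, Pi.smul_apply, k9, Pi.add_apply,
        Pi.smul_apply, k2', k3', k4', add_zero, add_zero] at k5
      exact k5.symm
    exact ae_fin_zero this
  have hφg : (φ, (e : ℂ) • φ) ∈ Hat.graph := hφ.2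
  have g3 : (v, x₁ - inner ℂ φ u • ((e : ℂ) • φ)) ∈ Hat.graph :=
    Hat.graph.sub_mem g1 (Hat.graph.smul_mem _ hφg)
  have g4 : inner ℂ φ v = 0 := by
    rw [hv, inner_sub_right, inner_smul_right, hφφ, mul_one, sub_self]
  have g4' : inner ℂ v φ = 0 := by rw [← inner_conj_symm, g4, map_zero]
  have g5 := hgap _ _ g3 g4
  have g6 : inner ℂ v u = inner ℂ v v := by
    have : u = v + inner ℂ φ u • φ := by rw [hv]; abel
    conv_lhs => rw [this]
    rw [inner_add_right, inner_smul_right, g4', mul_zero, add_zero]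
  have g7 : inner ℂ v x₁ = E * inner ℂ v v - lam * inner ℂ v a₀ := by
    have : x₁ = (E : ℂ) • u - (lam : ℂ) • a₀ := by rw [g2]; abel
    rw [this, inner_sub_right, inner_smul_right, inner_smul_right, g6]
  rw [inner_sub_right, inner_smul_right, inner_smul_right, g4', mul_zero, mul_zero, sub_zero, g7,
    Complex.sub_re, Complex.re_ofReal_mul, Complex.re_ofReal_mul, inner_self_re] at g5
  have g8 : ‖a₀‖ ^ 2 ≤ (couplingNorm G).toReal * ‖ψ‖ ^ 2 := by
    have k1 := lintegral_annFun_le_norm S.measurable_norm (wave_aestronglyMeasurable ψ 1)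
    rw [enorm_sqrt_sq, lintegral_fin_zero] at k1
    have k2 : ∫⁻ X, ‖wave ψ 1 X‖ₑ ^ 2 ≤ ENNReal.ofReal (‖ψ‖ ^ 2) := by
      rw [ofReal_norm_sq]
      exact ENNReal.le_tsum (f := fun n => ∫⁻ X, ‖wave ψ n X‖ₑ ^ 2) 1
    have k3 : ENNReal.ofReal (‖a₀‖ ^ 2) ≤ couplingNorm G * ENNReal.ofReal (‖ψ‖ ^ 2) := by
      rw [ENNReal.ofReal_pow (norm_nonneg _), ofReal_norm]
      refine k1.trans ?_
      simp only [Nat.cast_zero, zero_add, one_mul]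
      gcongr
    have k4 := ENNReal.toReal_mono (ENNReal.mul_ne_top S.norm_ne_top ENNReal.ofReal_ne_top) k3
    rwa [ENNReal.toReal_ofReal (by positivity), ENNReal.toReal_mul,
      ENNReal.toReal_ofReal (by positivity)] at k4
  have g9 : |(inner ℂ v a₀).re| ≤ ‖v‖ * ‖a₀‖ :=
    (Complex.abs_re_le_norm _).trans (norm_inner_le_norm _ _)
  have g10 : -(lam * (inner ℂ v a₀).re) ≤ |lam| * (‖v‖ * ‖a₀‖) := by
    refine (neg_le_abs _).trans ?_
    rw [abs_mul]
    gcongr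
  -- The gap bounds `(ε - E) ‖v‖²`; since `E ≤ e`, the constant may be replaced by `ε - e`, which
  -- does not depend on `λ`.
  have g11 : (ε - e) * ‖v‖ ^ 2 ≤ |lam| * ‖a₀‖ * ‖v‖ := by
    nlinarith [mul_nonneg (sub_nonneg.2 hEe) (sq_nonneg ‖v‖)]
  have g12 : (ε - e) * ‖v‖ ≤ |lam| * ‖a₀‖ := by
    rcases (norm_nonneg v).eq_or_lt with h0 | h0
    · rw [← h0, mul_zero]; positivity
    · refine le_of_mul_le_mul_right ?_ h0
      linarith [g11, sq ‖v‖, mul_assoc (ε - e) ‖v‖ ‖v‖, congrArg (fun t => (ε - e) * t) (sq ‖v‖)]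
  have hpos : 0 ≤ ε - e := by linarith
  calc (ε - e) ^ 2 * ‖v‖ ^ 2 = ((ε - e) * ‖v‖) ^ 2 := (mul_pow _ _ _).symm
    _ ≤ (|lam| * ‖a₀‖) ^ 2 := by gcongr
    _ = lam ^ 2 * ‖a₀‖ ^ 2 := by rw [mul_pow, sq_abs]
    _ ≤ _ := by gcongr

/-- Ground states are close to multiples of `φ ⊗ Ω`. -/
theorem Admissible.norm_sub_tensorVacuum_le (S : Admissible Hat e G) {lam E ε : ℝ} {ψ : Fock 𝔥}
    (hψ : (ψ, (E : ℂ) • ψ) ∈ (hamiltonian Hat G lam).graph)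
    (hE : FormBound (hamiltonian Hat G lam) E)
    (hs : ∀ w < E, ShiftSurjective (hamiltonian Hat G lam) w) (hEe : E ≤ e) (heε : e < ε)
    {φ : 𝔥} (hφ : IsEigenvector Hat e φ) (hφn : ‖φ‖ = 1)
    (hgap : ∀ x y, (x, y) ∈ Hat.graph → inner ℂ φ x = 0 → ε * ‖x‖ ^ 2 ≤ (inner ℂ x y).re)
    (hI : couplingInfrared G ≠ ⊤) :
    ‖ψ - inner ℂ (tensorVacuum φ) ψ • tensorVacuum φ‖ ≤
      √((couplingNorm G).toReal / (ε - e) ^ 2 + (couplingInfrared G).toReal) * |lam| * ‖ψ‖ := by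
  have h1 := S.vacuum_estimate hψ hEe heε hφ hφn hgap
  have h2 := S.photonNumber_le hψ hE hs
  have hpos : 0 < (ε - e) ^ 2 := by have := sub_pos.2 heε; positivity
  have h3 : ∑' n, ∫⁻ X, ‖wave ψ (n + 1) X‖ₑ ^ 2 ≤
      ENNReal.ofReal (lam ^ 2 * ‖ψ‖ ^ 2 * (couplingInfrared G).toReal) := by
    rw [ENNReal.ofReal_mul (by positivity), ENNReal.ofReal_toReal hI]
    refine le_trans (ENNReal.tsum_le_tsum fun n => ?_) h2
    -- Outside the vacuum sector there is at least one photon, so that part of the norm is bounded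
    -- by the photon number.
    exact le_mul_of_one_le_left' (by simp)
  have h4 : ‖wave ψ 0 default - inner ℂ φ (wave ψ 0 default) • φ‖ ^ 2 ≤
      lam ^ 2 * ‖ψ‖ ^ 2 * ((couplingNorm G).toReal / (ε - e) ^ 2) := by
    rw [← mul_div_assoc, le_div_iff₀ hpos]
    linarith
  have h5 := ofReal_norm_sub_tensorVacuum ψ (inner ℂ (tensorVacuum φ) ψ) φ
  rw [inner_tensorVacuum] at h5 ⊢
  set r := (couplingNorm G).toReal / (ε - e) ^ 2 + (couplingInfrared G).toReal with hr
  have hr0 : 0 ≤ r := by positivity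
  have h6 : ‖ψ - inner ℂ φ (wave ψ 0 default) • tensorVacuum φ‖ ^ 2 ≤ lam ^ 2 * ‖ψ‖ ^ 2 * r := by
    rw [← ENNReal.ofReal_le_ofReal_iff (by positivity), h5, hr, mul_add,
      ENNReal.ofReal_add (by positivity) (by positivity)]
    exact add_le_add (ENNReal.ofReal_le_ofReal h4) h3
  refine abs_le_of_sq_le_sq' ?_ (by positivity) |>.2
  calc _ ≤ lam ^ 2 * ‖ψ‖ ^ 2 * r := h6
    _ = (√r * |lam| * ‖ψ‖) ^ 2 := by
      rw [mul_pow, mul_pow, Real.sq_sqrt hr0, sq_abs]; ring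

end PhotonNumber

/-! ### Parity of the photon number -/

section Parity

variable {𝔥 : Type*} [NormedAddCommGroup 𝔥] [InnerProductSpace ℂ 𝔥]

/-- The parity operator `(-1)^N`, with `N` the number of photons. -/
def IsParity (Γ : Fock 𝔥 →L[ℂ] Fock 𝔥) : Prop :=
  ∀ ψ n, wave (Γ ψ) n =ᵐ[volume] fun K => (-1 : ℂ) ^ n • wave ψ n K

theorem exists_isParity : ∃ Γ : Fock 𝔥 →L[ℂ] Fock 𝔥, IsParity Γ := by
  obtain ⟨T, hT⟩ := exists_fibreOperator (𝔥 := 𝔥)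
    (fun n _ => (-1 : ℂ) ^ n • ContinuousLinearMap.id ℂ 𝔥)
    (fun n x => aestronglyMeasurable_const) (fun _ _ _ => rfl) zero_le_one
    (fun n => Eventually.of_forall fun _ => by
      rw [norm_smul, norm_pow, norm_neg, norm_one, one_pow, one_mul]
      exact ContinuousLinearMap.norm_id_le)
  exact ⟨T, hT⟩

theorem IsParity.inner {Γ : Fock 𝔥 →L[ℂ] Fock 𝔥} (hΓ : IsParity Γ) (ψ χ : Fock 𝔥) :
    inner ℂ (Γ ψ) (Γ χ) = inner ℂ ψ χ := by
  refine (hasSum_inner_wave (Γ ψ) (Γ χ)).unique ?_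
  refine (hasSum_inner_wave ψ χ).congr_fun fun n => ?_
  refine integral_congr_ae ?_
  filter_upwards [hΓ ψ n, hΓ χ n] with K h1 h2
  rw [h1, h2, inner_smul_left, inner_smul_right, ← mul_assoc, map_pow, map_neg, map_one, ← mul_pow,
    neg_mul_neg, one_mul, one_pow, one_mul]

theorem IsParity.norm {Γ : Fock 𝔥 →L[ℂ] Fock 𝔥} (hΓ : IsParity Γ) (ψ : Fock 𝔥) :
    ‖Γ ψ‖ = ‖ψ‖ := by
  have h : ‖Γ ψ‖ ^ 2 = ‖ψ‖ ^ 2 := by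
    rw [← inner_self_re, hΓ.inner, inner_self_re]
  exact (sq_eq_sq₀ (norm_nonneg _) (norm_nonneg _)).1 h

variable [CompleteSpace 𝔥] {Hat : 𝔥 →ₗ.[ℂ] 𝔥} {e : ℝ} {G : R3 → 𝔥 →L[ℂ] 𝔥}

/-- Annihilation and creation change the photon number by one, so both anticommute with parity. -/
theorem FieldAction.parity {Γ : Fock 𝔥 →L[ℂ] Fock 𝔥} (hΓ : IsParity Γ) {ψ α β : Fock 𝔥}
    (h : FieldAction G ψ α β) : FieldAction G (Γ ψ) ((-1 : ℂ) • Γ α) ((-1 : ℂ) • Γ β) where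
  ann n := by
    filter_upwards [h.ann n, ae_ae_cons (hΓ ψ (n + 1)), hΓ α n, wave_smul (-1 : ℂ) (Γ α) n]
      with K h1 h2 h3 h4
    have h5 : (fun k : R3 => (G k).adjoint (wave (Γ ψ) (n + 1) (Fin.cons k K))) =ᵐ[volume]
        fun k => (-1 : ℂ) ^ (n + 1) • (G k).adjoint (wave ψ (n + 1) (Fin.cons k K)) := by
      filter_upwards [h2] with k hk
      rw [hk, map_smul]
    refine ⟨(h1.1.smul _).congr h5.symm, ?_⟩
    rw [integral_congr_ae h5, integral_smul, h4, Pi.smul_apply, h3, h1.2, smul_smul, smul_comm,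
      pow_succ']
  cre n := by
    filter_upwards [h.cre n, hΓ β n, wave_smul (-1 : ℂ) (Γ β) n, creFamily_congr (G := G) (hΓ ψ) n]
      with K h1 h2 h3 h4
    rw [h3, Pi.smul_apply, h2, h1, h4]
    cases n with
    | zero => simp [creFamily]
    | succ n =>
      simp only [creFamily, creFun, creTerm, map_smul, ← Finset.smul_sum]
      rw [smul_smul, smul_comm, pow_succ', ← mul_assoc, neg_mul_neg, one_mul, one_mul]

variable [TopologicalSpace.SeparableSpace 𝔥]

/-- Conjugation with the parity operator changes the sign of the coupling constant. -/
theorem Admissible.parity_mem_graph (S : Admissible Hat e G) {Γ : Fock 𝔥 →L[ℂ] Fock 𝔥}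
    (hΓ : IsParity Γ) {lam : ℝ} {ψ χ : Fock 𝔥} (h : (ψ, χ) ∈ (hamiltonian Hat G lam).graph) :
    (Γ ψ, Γ χ) ∈ (hamiltonian Hat G (-lam)).graph := by
  obtain ⟨χ₀, α, β, h1, h2, -, rfl⟩ := S.mem_graph_hamiltonian.1 h
  obtain ⟨χ₁, χ₂, a1, a2, rfl⟩ := mem_graph_freeHamiltonian.1 h1
  have h3 : (Γ ψ, Γ χ₁ + Γ χ₂) ∈ (freeHamiltonian Hat).graph := by
    refine mem_graph_freeHamiltonian.2 ⟨_, _, fun n => ?_, fun n => ?_, rfl⟩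
    · filter_upwards [a1 n, hΓ ψ n, hΓ χ₁ n] with K k1 k2 k3
      rw [k2, k3]
      exact Hat.graph.smul_mem _ k1
    · filter_upwards [a2 n, hΓ ψ n, hΓ χ₂ n] with K k1 k2 k3
      rw [k2, k3, k1, smul_comm]
  refine mem_graph_add.2 ⟨_, _, h3, mem_graph_smul.2 ⟨_, (h2.parity hΓ).mem_graph S, rfl⟩, ?_⟩
  simp only [map_add, map_smul]
  push_cast
  module

theorem Admissible.formBound_neg (S : Admissible Hat e G) {lam m : ℝ}
    (h : FormBound (hamiltonian Hat G lam) m) : FormBound (hamiltonian Hat G (-lam)) m := by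
  obtain ⟨Γ, hΓ⟩ := exists_isParity (𝔥 := 𝔥)
  intro ψ χ hψ
  have h1 := S.parity_mem_graph hΓ hψ
  rw [neg_neg] at h1
  have h2 := h h1
  rwa [hΓ.norm, hΓ.inner] at h2

theorem Admissible.le_groundEnergy (S : Admissible Hat e G) {φ : 𝔥} (hφ : IsEigenvector Hat e φ)
    (hφn : ‖φ‖ = 1) {lam m : ℝ} (h : FormBound (hamiltonian Hat G lam) m) :
    m ≤ groundEnergy Hat G lam := by
  obtain ⟨h1, -, -, -, h2⟩ := S.groundEnergy_spec hφ hφn lam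
  refine h1.2 fun w hw => ?_
  by_contra hc
  have hc' := not_le.1 hc
  -- A point below both numbers, where solvability is known; `ShiftSurjective.of_formBound` extends
  -- it to everything below `m`.
  have hs := h2 (min m (groundEnergy Hat G lam) - 1)
    ((sub_one_lt _).trans_le (min_le_right _ _))
  exact hw ((hs.of_formBound h ((sub_one_lt _).trans_le (min_le_left _ _)) hc').mem_resolventSet
    h hc')

theorem Admissible.groundEnergy_neg (S : Admissible Hat e G) {φ : 𝔥} (hφ : IsEigenvector Hat e φ)
    (hφn : ‖φ‖ = 1) (lam : ℝ) : groundEnergy Hat G (-lam) = groundEnergy Hat G lam := by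
  refine le_antisymm ?_ ?_
  · refine S.le_groundEnergy hφ hφn ?_
    have h := S.formBound_neg (S.groundEnergy_spec hφ hφn (-lam)).2.1
    rwa [neg_neg] at h
  · exact S.le_groundEnergy hφ hφn (S.formBound_neg (S.groundEnergy_spec hφ hφn lam).2.1)

theorem Admissible.exists_eigenvector (S : Admissible Hat e G) {φ : 𝔥}
    (hφ : IsEigenvector Hat e φ) (hφn : ‖φ‖ = 1) {lam₀ : ℝ}
    (hground : ∀ lam ∈ Set.Icc 0 lam₀,
      IsSimpleEigenvalue (hamiltonian Hat G lam) (groundEnergy Hat G lam))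
    {lam : ℝ} (hlam : lam ∈ Set.Icc (-lam₀) lam₀) :
    ∃ ψ, IsEigenvector (hamiltonian Hat G lam) (groundEnergy Hat G lam) ψ := by
  have hpos : ∀ t ∈ Set.Icc 0 lam₀,
      ∃ ψ, IsEigenvector (hamiltonian Hat G t) (groundEnergy Hat G t) ψ := by
    intro t ht
    have h1 : 0 < Module.finrank ℂ (eigenspace (hamiltonian Hat G t) (groundEnergy Hat G t)) := by
      rw [hground t ht]
      exact one_pos
    have := Module.nontrivial_of_finrank_pos h1
    obtain ⟨v, hv⟩ := exists_ne (0 : eigenspace (hamiltonian Hat G t) (groundEnergy Hat G t))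
    exact ⟨v, fun h => hv (Subtype.ext h), v.2⟩
  rcases le_total 0 lam with h | h
  · exact hpos lam ⟨h, hlam.2⟩
  · obtain ⟨ψ, h1, h2⟩ := hpos (-lam) ⟨neg_nonneg.2 h, neg_le.1 hlam.1⟩
    obtain ⟨Γ, hΓ⟩ := exists_isParity (𝔥 := 𝔥)
    have h3 := S.parity_mem_graph hΓ h2
    rw [neg_neg, map_smul, S.groundEnergy_neg hφ hφn] at h3
    refine ⟨Γ ψ, fun h0 => h1 ?_, h3⟩
    rw [← norm_eq_zero, ← hΓ.norm, h0, norm_zero]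

end Parity

/-! ### Integrability of the coupling -/

section Coupling

variable {𝔥 : Type*} [NormedAddCommGroup 𝔥] [InnerProductSpace ℂ 𝔥] {G : R3 → 𝔥 →L[ℂ] 𝔥}

/-- Measurability of `‖G(k)‖` is not among the assumptions on `G`; it is recovered from the
integrable function by dividing by `w ≥ 1` and taking the square root. -/
theorem coupling_of_integrable {w : R3 → ℝ} (hw : Measurable w) (h1 : ∀ k, 1 ≤ w k)
    (h : Integrable (fun k => ‖G k‖ ^ 2 * w k)) :
    AEMeasurable (fun k => ‖G k‖ₑ) ∧
      ∀ f : R3 → ENNReal, (∀ᵐ k, f k ≤ ENNReal.ofReal (w k)) → ∫⁻ k, f k * ‖G k‖ₑ ^ 2 ≠ ⊤ := by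
  constructor
  · have h2 : AEMeasurable (fun k => ENNReal.ofReal (√(‖G k‖ ^ 2 * w k / w k))) :=
      ((h.1.aemeasurable.div hw.aemeasurable).sqrt).ennreal_ofReal
    convert h2 using 2 with k
    rw [mul_div_cancel_right₀ _ (zero_lt_one.trans_le (h1 k)).ne', Real.sqrt_sq (norm_nonneg _),
      ofReal_norm]
  · intro f hf
    refine (lt_of_le_of_lt (lintegral_mono_ae ?_) h.2).ne
    filter_upwards [hf] with k hk
    have h0 : 0 ≤ w k := zero_le_one.trans (h1 k)
    rw [← ofReal_norm (x := ‖G k‖ ^ 2 * w k), Real.norm_of_nonneg (by positivity),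
      ENNReal.ofReal_mul (by positivity), ENNReal.ofReal_pow (norm_nonneg _), ofReal_norm, mul_comm]
    gcongr

theorem enorm_inv_eq_ofReal {k : R3} (hk : k ≠ 0) : ‖k‖ₑ⁻¹ = ENNReal.ofReal ‖k‖⁻¹ := by
  rw [ENNReal.ofReal_inv_of_pos (norm_pos_iff.2 hk), ofReal_norm]

theorem coupling_of_integrable_inv (h : Integrable (fun k => ‖G k‖ ^ 2 * (1 + ‖k‖⁻¹))) :
    AEMeasurable (fun k => ‖G k‖ₑ) ∧ couplingNorm G ≠ ⊤ ∧ couplingEnergy G ≠ ⊤ := by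
  obtain ⟨h1, h2⟩ := coupling_of_integrable (w := fun k : R3 => 1 + ‖k‖⁻¹)
    (measurable_const.add measurable_norm.inv)
    (fun k => le_add_of_nonneg_right (inv_nonneg.2 (norm_nonneg k))) h
  refine ⟨h1, ?_, h2 _ ?_⟩
  · have h3 := h2 1 (Eventually.of_forall fun k => by
      rw [Pi.one_apply, ENNReal.one_le_ofReal]
      exact le_add_of_nonneg_right (inv_nonneg.2 (norm_nonneg k)))
    simpa only [Pi.one_apply, one_mul, couplingNorm] using h3
  · filter_upwards [ae_ne_zero] with k hk
    rw [enorm_inv_eq_ofReal hk]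
    exact ENNReal.ofReal_le_ofReal (le_add_of_nonneg_left zero_le_one)

theorem coupling_of_integrable_inv_sq
    (h : Integrable (fun k => ‖G k‖ ^ 2 * (1 + (‖k‖ ^ 2)⁻¹))) :
    AEMeasurable (fun k => ‖G k‖ₑ) ∧ couplingNorm G ≠ ⊤ ∧ couplingEnergy G ≠ ⊤ ∧
      couplingInfrared G ≠ ⊤ := by
  have hnn : ∀ k : R3, 0 ≤ (‖k‖ ^ 2)⁻¹ := fun k => by positivity
  obtain ⟨h1, h2⟩ := coupling_of_integrable (w := fun k : R3 => 1 + (‖k‖ ^ 2)⁻¹)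
    (measurable_const.add (measurable_norm.pow_const 2).inv)
    (fun k => le_add_of_nonneg_right (hnn k)) h
  refine ⟨h1, ?_, h2 _ ?_, h2 _ ?_⟩
  · have h3 := h2 1 (Eventually.of_forall fun k => by
      rw [Pi.one_apply, ENNReal.one_le_ofReal]
      exact le_add_of_nonneg_right (hnn k))
    simpa only [Pi.one_apply, one_mul, couplingNorm] using h3
  · filter_upwards [ae_ne_zero] with k hk
    rw [enorm_inv_eq_ofReal hk]
    refine ENNReal.ofReal_le_ofReal ?_
    rw [← inv_pow]
    -- The inequality `|k|⁻¹ ≤ 1 + |k|⁻²`: the infrared condition of part (b) implies that of part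
    -- (a).
    nlinarith [sq_nonneg (‖k‖⁻¹ - 1), sq_nonneg ‖k‖⁻¹]
  · filter_upwards [ae_ne_zero] with k hk
    rw [enorm_inv_eq_ofReal hk, ← ENNReal.ofReal_pow (by positivity), inv_pow]
    exact ENNReal.ofReal_le_ofReal (le_add_of_nonneg_left zero_le_one)

theorem admissible_of_isSelfAdjoint [CompleteSpace 𝔥] {Hat : 𝔥 →ₗ.[ℂ] 𝔥} {e : ℝ}
    (hHat : IsSelfAdjoint Hat) (he : e ∈ lowerBounds (realSpectrum Hat))
    (hG : ∀ x : 𝔥, AEStronglyMeasurable (fun k => G k x) volume)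
    (h1 : AEMeasurable (fun k => ‖G k‖ₑ)) (h2 : couplingNorm G ≠ ⊤) (h3 : couplingEnergy G ≠ ⊤) :
    Admissible Hat e G where
  symmetric := symmetricOp_of_isSelfAdjoint hHat
  formBound := formBound_of_isSelfAdjoint hHat he
  surjective z hz := by
    refine shiftSurjective_of_mem_resolventSet ?_
    by_contra hc
    exact absurd (he hc) (not_le.2 hz)
  measurable := hG
  measurable_norm := h1
  norm_ne_top := h2
  energy_ne_top := h3

end Coupling

/-- A vector `p` close to the line of the unit vector `u` can be normalized by `⟨u, p⟩ = 1`. -/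
theorem inner_ne_zero_and_norm_sub_le {E : Type*} [NormedAddCommGroup E] [InnerProductSpace ℂ E]
    {u p : E} (hu : ‖u‖ = 1) (hp : p ≠ 0) {δ : ℝ} (hδ : δ ≤ 1 / 2)
    (h : ‖p - inner ℂ u p • u‖ ≤ δ * ‖p‖) :
    inner ℂ u p ≠ 0 ∧ ‖(inner ℂ u p)⁻¹ • p - u‖ ≤ 2 * δ := by
  set c := inner ℂ u p with hc
  have hp0 : 0 < ‖p‖ := norm_pos_iff.2 hp
  have h1 : ‖p‖ ≤ ‖p - c • u‖ + ‖c‖ := by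
    have := norm_add_le (p - c • u) (c • u)
    rwa [sub_add_cancel, norm_smul, hu, mul_one] at this
  -- Since `δ ≤ 1/2`, at least half of the norm of `p` lies along `u`.
  have h2 : ‖p‖ ≤ 2 * ‖c‖ := by nlinarith
  have hc0 : 0 < ‖c‖ := by linarith
  have hc1 : c ≠ 0 := norm_pos_iff.1 hc0
  have hδ0 : 0 ≤ δ := nonneg_of_mul_nonneg_left ((norm_nonneg _).trans h) hp0
  refine ⟨hc1, ?_⟩
  have h3 : c⁻¹ • p - u = c⁻¹ • (p - c • u) := by
    rw [smul_sub, smul_smul, inv_mul_cancel₀ hc1, one_smul]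
  rw [h3, norm_smul, norm_inv, inv_mul_le_iff₀ hc0]
  nlinarith

end SpinBoson

end

/-! ### Ground state energy and ground states at weak coupling. -/

theorem mainTheorem4 {𝔥 : Type*} [NormedAddCommGroup 𝔥] [InnerProductSpace ℂ 𝔥] [CompleteSpace 𝔥]
    [TopologicalSpace.SeparableSpace 𝔥]
    (Hat : 𝔥 →ₗ.[ℂ] 𝔥) (hHat : IsSelfAdjoint Hat)
    (Eat : ℝ) (hEat : IsGLB (SpinBoson.realSpectrum Hat) Eat)
    (hsimple : SpinBoson.IsSimpleEigenvalue Hat Eat)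
    (hgap : ∃ ε₁ : ℝ, Eat < ε₁ ∧ ∀ x ∈ SpinBoson.realSpectrum Hat \ {Eat}, ε₁ ≤ x)
    (φat : 𝔥) (hφat : SpinBoson.IsEigenvector Hat Eat φat) (hφnorm : ‖φat‖ = 1)
    (G : SpinBoson.R3 → 𝔥 →L[ℂ] 𝔥)
    (hG : ∀ x : 𝔥, AEStronglyMeasurable (fun k => G k x) volume)
    (lam₀ : ℝ) (hlam₀ : 0 < lam₀)
    (hground : ∀ lam ∈ Set.Icc 0 lam₀, SpinBoson.IsSimpleEigenvalue
      (SpinBoson.hamiltonian Hat G lam) (SpinBoson.groundEnergy Hat G lam)) :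
    (Integrable (fun k : SpinBoson.R3 => ‖G k‖ ^ 2 * (1 + ‖k‖⁻¹)) →
      (∀ lam : ℝ,
        IsGLB (SpinBoson.realSpectrum (SpinBoson.hamiltonian Hat G lam))
          (SpinBoson.groundEnergy Hat G lam) ∧
        SpinBoson.groundEnergy Hat G lam ≤ Eat) ∧
      (fun lam : ℝ => SpinBoson.groundEnergy Hat G lam - Eat) =O[𝓝 0] (fun lam : ℝ => lam ^ 2)) ∧
    (Integrable (fun k : SpinBoson.R3 => ‖G k‖ ^ 2 * (1 + (‖k‖ ^ 2)⁻¹)) →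
      ∃ ψ : ℝ → SpinBoson.Fock 𝔥,
        (∀ lam ∈ Set.Icc (-lam₀) lam₀, SpinBoson.IsEigenvector
          (SpinBoson.hamiltonian Hat G lam) (SpinBoson.groundEnergy Hat G lam) (ψ lam)) ∧
        (∀ᶠ lam in 𝓝 (0 : ℝ), inner ℂ (SpinBoson.tensorVacuum φat) (ψ lam) = 1) ∧
        (fun lam : ℝ => ψ lam - SpinBoson.tensorVacuum φat) =O[𝓝 0] (fun lam : ℝ => lam)) := by
  open SpinBoson in
  constructor
  · intro hI
    obtain ⟨h1, h2, h3⟩ := coupling_of_integrable_inv hI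
    have S := admissible_of_isSelfAdjoint hHat hEat.1 hG h1 h2 h3
    have hspec := S.groundEnergy_spec hφat hφnorm
    refine ⟨fun lam => ⟨(hspec lam).1, (hspec lam).2.2.2.1⟩, ?_⟩
    refine IsBigO.of_bound (couplingEnergy G).toReal (Eventually.of_forall fun lam => ?_)
    obtain ⟨-, -, k1, k2, -⟩ := hspec lam
    rw [Real.norm_of_nonpos (by linarith), Real.norm_of_nonneg (sq_nonneg lam)]
    linarith
  · intro hI
    obtain ⟨h1, h2, h3, h4⟩ := coupling_of_integrable_inv_sq hI
    have S := admissible_of_isSelfAdjoint hHat hEat.1 hG h1 h2 h3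
    have hspec := S.groundEnergy_spec hφat hφnorm
    obtain ⟨ε, hε, hgap'⟩ := hgap
    have hgapform : ∀ x y, (x, y) ∈ Hat.graph → inner ℂ φat x = 0 →
        ε * ‖x‖ ^ 2 ≤ (inner ℂ x y).re := fun x y hxy hx =>
      gap_of_isSelfAdjoint hHat hEat.1 hε hgap' hsimple hφat hxy hx
    set u := tensorVacuum φat with hu
    have hun : ‖u‖ = 1 := by rw [hu, norm_tensorVacuum, hφnorm]
    have hex := fun lam (hlam : lam ∈ Set.Icc (-lam₀) lam₀) =>
      S.exists_eigenvector hφat hφnorm hground hlam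
    choose! p hp using hex
    set K := √((couplingNorm G).toReal / (ε - Eat) ^ 2 + (couplingInfrared G).toReal) with hK
    have key : ∀ lam ∈ Set.Icc (-lam₀) lam₀, K * |lam| ≤ 1 / 2 →
        inner ℂ u (p lam) ≠ 0 ∧ ‖(inner ℂ u (p lam))⁻¹ • p lam - u‖ ≤ 2 * (K * |lam|) := by
      intro lam hlam hsmall
      obtain ⟨-, k1, -, k2, k3⟩ := hspec lam
      exact inner_ne_zero_and_norm_sub_le hun (hp lam hlam).1 hsmall
        (S.norm_sub_tensorVacuum_le (hp lam hlam).2 k1 k3 k2 hε hφat hφnorm hgapform h4)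
    have hnear : ∀ᶠ lam in 𝓝 (0 : ℝ), lam ∈ Set.Icc (-lam₀) lam₀ ∧ K * |lam| ≤ 1 / 2 := by
      refine Eventually.and (Icc_mem_nhds (neg_lt_zero.2 hlam₀) hlam₀) ?_
      have hcont : Continuous fun lam : ℝ => K * |lam| := by fun_prop
      have := hcont.tendsto 0
      rw [abs_zero, mul_zero] at this
      exact this.eventually_le_const (by norm_num)
    classical
    -- Away from zero the overlap with `φ_at ⊗ Ω` may vanish; the unnormalized eigenvector is kept
    -- there, so the family consists of eigenvectors on the whole interval. Near zero the second
    -- case always applies.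
    refine ⟨fun lam => if inner ℂ u (p lam) = 0 then p lam else (inner ℂ u (p lam))⁻¹ • p lam,
      fun lam hlam => ?_, ?_, IsBigO.of_bound (2 * K) ?_⟩
    · obtain ⟨k1, k2⟩ := hp lam hlam
      dsimp only
      split_ifs with hc
      · exact ⟨k1, k2⟩
      · exact ⟨smul_ne_zero (inv_ne_zero hc) k1, Submodule.smul_mem _ _ k2⟩
    · filter_upwards [hnear] with lam hlam
      have hc := (key lam hlam.1 hlam.2).1
      rw [if_neg hc, inner_smul_right, inv_mul_cancel₀ hc]
    · filter_upwards [hnear] with lam hlam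
      obtain ⟨hc, hle⟩ := key lam hlam.1 hlam.2
      rw [if_neg hc, Real.norm_eq_abs, mul_assoc]
      exact hle
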